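/- For every $C>0$ there is a constant $A\ge 0$, depending only on $C$, such that the following holds for every dimension $n$. Let $(K_N)_{N\in\mathbb N}$ be a sequence of (self-adjoint) trace-class operators on $L^2(\mathbb R^n;\mathbb C)$ with $0\le K_N\le \mathrm I$, and let $\Xi_N$ be a determinantal point process on $\mathbb R^n$ associated with $K_N$, that is, a random measure of the form $\Xi_N=\sum_{\lambda\in\Lambda_N}\delta_\lambda$, with $\Lambda_N\subset\mathbb R^n$ a countable random set without accumulation points, whose Laplace functional $\psi_{\Xi_N}(g)=\mathbb E[e^{-\Xi_N(g)}]$, where $\Xi_N(g)=\int g\,d\Xi_N$, is given by the Fredholm determinant \[ \psi_{\Xi_N}(g)=\det\big[\mathrm I-(1-e^{-g})K_N\big]\qquad\text{for all } g\in C_c^\infty(\mathbb R^n,[0,\infty)). \] Let $f_N\in L^\infty(\mathbb R^n)$ be real-valued with $\|f_N\|_{L^\infty}\le C$. Then $\Xi_N(f_N)$ has a finite second moment for every $N$. Put $\sigma_N=\sqrt{\operatorname{var}\Xi_N(f_N)}$ and assume that $\sigma_N^2\to\infty$ as $N\to\infty$. Then, for all $N$ and all $t\in\mathbb R$ with $|t|\le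 0.69\,\sigma_N/C$ (only $t=0$ if $\sigma_N=0$), the random variable $e^{-t\sigma_N^{-1}\Xi_N(f_N)}$ is integrable and \[ \psi_{\Xi_N}\big(t\sigma_N^{-1}f_N\big)\,\exp\!\Big(t\sigma_N^{-1}\,\mathbb E[\Xi_N(f_N)]\Big)=\exp\!\Big(t^2\big(\tfrac12+\varepsilon_N(t)\big)\Big),\qquad |\varepsilon_N(t)|\le A\,\frac{|t|}{\sigma_N}. \] Moreover, as $N\to\infty$, \[ \frac{\Xi_N(f_N)-\mathbb E[\Xi_N(f_N)]}{\sigma_N}\ \Longrightarrow\ \mathcal N(0,1)\quad\text{in distribution.} \] -/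

import Mathlib

open MeasureTheory Filter Topology
open scoped ENNReal InnerProductSpace

noncomputable section

/-! ### Trace-class operators and Fredholm determinants on a complex Hilbert space -/

section Operators

variable {H : Type} [NormedAddCommGroup H] [InnerProductSpace ℂ H] [CompleteSpace H]

/-- A bounded operator `A` is trace-class if `|A| = (A* A)^{1/2}` has finite trace, that is,
`∑ ⟨e_i, |A| e_i⟩ < ∞` for every orthonormal basis `(e_i)`. -/
def IsTraceClass (A : H →L[ℂ] H) : Prop :=
  ∀ (ι : Type) (b : HilbertBasis ι ℂ H),
    Summable fun i : ι => (⟪b i, CFC.abs A (b i)⟫_ℂ).re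

/-- `HasFredholmDet A d` says that `d` is the Fredholm determinant `det(1 + A)`: for every
orthonormal basis `(e_i)`, it is the limit, along finite sets `s` of indices, of the determinants
of the finite matrices `(δ_ij + ⟨e_i, A e_j⟩)`, `i, j ∈ s`. For a trace-class `A` this limit
exists and does not depend on the basis. -/
def HasFredholmDet (A : H →L[ℂ] H) (d : ℂ) : Prop :=
  ∀ (ι : Type) (b : HilbertBasis ι ℂ H),
    Tendsto
      (fun s : Finset ι => by
        classical exact Matrix.det (1 + Matrix.of fun i j : s => ⟪b i, A (b j)⟫_ℂ))
      atTop (𝓝 d)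

end Operators

/-! ### Multiplication operators on `L²(ℝⁿ)` -/

/-- Euclidean space `ℝⁿ`. -/
abbrev Rn (n : ℕ) : Type := EuclideanSpace ℝ (Fin n)

/-- The complex Hilbert space `L²(ℝⁿ)`. -/
abbrev L2Rn (n : ℕ) : Type := Lp ℂ 2 (volume : Measure (Rn n))

/-- The bounded operator `φ ↦ g φ` on `L²(ℝⁿ)`, for `g ∈ L^∞(ℝⁿ)`. -/
def mulOp {n : ℕ} (g : Rn n → ℂ) (hg : MemLp g ∞ (volume : Measure (Rn n))) :
    L2Rn n →L[ℂ] L2Rn n :=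
  (ContinuousLinearMap.mul ℂ ℂ).holderL volume ∞ 2 2 (hg.toLp g)

/-- `1 - e^{-f}` is in `L^∞` for continuous `f ≥ 0`. -/
theorem memLp_top_one_sub_exp_neg {n : ℕ} {f : Rn n → ℝ} (hf : Continuous f)
    (hf0 : ∀ x, 0 ≤ f x) :
    MemLp (fun x => ((1 - Real.exp (-f x) : ℝ) : ℂ)) ∞ (volume : Measure (Rn n)) := by
  refine memLp_top_of_bound (Continuous.aestronglyMeasurable (by fun_prop)) 1
    (Eventually.of_forall fun x => ?_)
  have h1 : Real.exp (-f x) ≤ 1 := Real.exp_le_one_iff.mpr (neg_nonpos.mpr (hf0 x))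
  have h2 := Real.exp_pos (-f x)
  rw [Complex.norm_real, Real.norm_eq_abs, abs_le]
  constructor <;> linarith

/-! ### Point processes on `ℝⁿ` -/

/-- A (simple) point process on `ℝⁿ`: a random measure which is almost surely of the form
`∑_{x ∈ Λ} δ_x` for a set `Λ` without accumulation points (`Λ` is then countable). -/
structure IsPointProcess {n : ℕ} {Ω : Type*} [MeasurableSpace Ω] (P : Measure Ω)
    (Ξ : Ω → Measure (Rn n)) : Prop where
  measurable : Measurable Ξ
  ae_eq_sum_dirac : ∀ᵐ ω ∂P, ∃ Λ : Set (Rn n), (∀ x, ¬ AccPt x (𝓟 Λ)) ∧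
    Ξ ω = Measure.sum fun x : Λ => Measure.dirac (x : Rn n)

/-- The linear statistic `Ξ(f) = ∫ f dΞ = ∑_{x ∈ Λ} f(x)`. -/
def linStat {n : ℕ} {Ω : Type*} (Ξ : Ω → Measure (Rn n)) (f : Rn n → ℝ) (ω : Ω) : ℝ :=
  ∫ x, f x ∂(Ξ ω)

/-- The Laplace functional `ψ_Ξ(f) = 𝔼[e^{-Ξ(f)}]`. -/
def laplaceFunctional {n : ℕ} {Ω : Type*} [MeasurableSpace Ω] (P : Measure Ω)
    (Ξ : Ω → Measure (Rn n)) (f : Rn n → ℝ) : ℝ :=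
  ∫ ω, Real.exp (-linStat Ξ f ω) ∂P

/-- `Ξ` is a determinantal point process associated with the trace-class operator `K` on
`L²(ℝⁿ)`: it is a point process and `ψ_Ξ(f) = det(1 - (1 - e^{-f}) K)` for every smooth compactly
supported `f ≥ 0`. -/
structure IsDeterminantal {n : ℕ} {Ω : Type*} [MeasurableSpace Ω] (P : Measure Ω)
    (Ξ : Ω → Measure (Rn n)) (K : L2Rn n →L[ℂ] L2Rn n) : Prop where
  isPointProcess : IsPointProcess P Ξ
  traceClass : IsTraceClass K
  laplace : ∀ (f : Rn n → ℝ) (hf : ContDiff ℝ ((⊤ : ℕ∞) : WithTop ℕ∞) f)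
    (hf0 : ∀ x, 0 ≤ f x), HasCompactSupport f →
    HasFredholmDet (-(mulOp _ (memLp_top_one_sub_exp_neg hf.continuous hf0) * K))
      (laplaceFunctional P Ξ f : ℂ)

end

/-! ### Dimension-free bounds for determinants of Gram-type matrices. -/

section DeterminantBounds

open scoped Matrix ComplexOrder

variable {m : Type*} [Fintype m] [DecidableEq m]

/-! Write $X=\Xi(f)$ and $G(t)=\log\mathbb E[e^{tX}]$. The heart of the matter is the cumulant
inequality $|G'''|\le 2C\,G''$. Formally $e^{G(t)}=\det(1-(1-e^{tf})K)$, so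
$G'=\operatorname{tr}(fR)$ with the tilted kernel $R=e^{tf}K(1-(1-e^{tf})K)^{-1}$, which solves
$R'=(1-R)fR$. Hence $G''$ and $G'''$ are explicit traces in $f$ and $R$. Conjugation by $e^{tf/2}$
turns $R$ into a self-adjoint $Q$ with $0\le Q\le 1$, and $\pm QfQ\le CQ$ and its analogue for $1-Q$
give the inequality (`abs_third_cumulant_le`). By Grönwall, $G''(a)\le e^{2C|a-b|}G''(b)$; with
$G''(0)=\operatorname{var}X$, a second-order Taylor formula controls $G(\pm t/\sigma)$ with relative
error $O(|t|/\sigma)$ (`abs_cgf_sub_le`). As $\sigma\to\infty$ the standardized moment generating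
functions tend to $e^{t^2/2}$, and analytic continuation to the imaginary axis gives the
characteristic functions.

The trace calculus is done for finite matrices only. Comparability of $G''$ at two points is
expressed through second differences of $G$ (`SecondDiffComparable`), so that it survives pointwise
limits without any convergence of derivatives.

The remaining work is to reach $\mathbb E[e^{tX}]$ for real bounded $f$ from a Laplace functional
known only for smooth $f\ge0$. With $K=T^2$ and $T$ Hilbert-Schmidt, finite sections of the
determinant are Lipschitz in the $L^2$ norm of a finite measure $\nu$ with density $K(x,x)$,
uniformly in the section. This bounds the mean measure of $\Xi$ and extends the Laplace identity to
bounded measurable $f\ge0$. For a finitely-valued real $f$, a basis diagonalising $f$ turns sections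
into polynomials $\det(1-(1-ze^{t\varphi})K)$. For small $z>0$ they converge to $\mathbb
E[z^{\Xi(\mathbb R^n)}e^{tX}]$, a nonnegative Laplace functional; boundedness on a disc beyond $1$
carries this to $z=1$ and yields integrability as well (`IsDeterminantal.tendsto_sectionPoly_one`).
Simple functions then approximate a general $f$. -/

theorem Matrix.PosSemidef.re_det_le_exp_trace {Q : Matrix m m ℂ} (hQ : Q.PosSemidef) :
    Q.det.re ≤ Real.exp (Q.trace.re - Fintype.card m) := by
  rw [hQ.1.det_eq_prod_eigenvalues, hQ.1.trace_eq_sum_eigenvalues]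
  have h1 : (∏ i, (hQ.1.eigenvalues i : ℂ)).re = ∏ i, hQ.1.eigenvalues i := by
    rw [← Complex.ofReal_prod, Complex.ofReal_re]
  have h2 : (∑ i, (hQ.1.eigenvalues i : ℂ)).re = ∑ i, hQ.1.eigenvalues i := by
    rw [← Complex.ofReal_sum, Complex.ofReal_re]
  have h3 : (∑ i, hQ.1.eigenvalues i) - Fintype.card m = ∑ i, (hQ.1.eigenvalues i - 1) := by
    simp [Finset.sum_sub_distrib]
  erw [h1, h2]
  rw [h3, Real.exp_sum]
  refine Finset.prod_le_prod (fun i _ => hQ.eigenvalues_nonneg i) fun i _ => ?_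
  have := Real.add_one_le_exp (hQ.1.eigenvalues i - 1)
  linarith

/-- The squared modulus is the determinant of $(1+M)^*(1+M)$, whose trace exceeds the dimension by
$2\operatorname{Re}\operatorname{tr}M+\|M\|_{HS}^2$. The size of the matrix cancels, which makes the
bound uniform over finite sections. -/
theorem Matrix.norm_det_one_add_le (M : Matrix m m ℂ) :
    ‖(1 + M).det‖ ≤ Real.exp (M.trace.re + (∑ i, ∑ j, ‖M i j‖ ^ 2) / 2) := by
  have h1 : ‖(1 + M).det‖ ^ 2 = (((1 + M)ᴴ * (1 + M)).det).re := by
    rw [Matrix.det_mul, Matrix.det_conjTranspose, ← Complex.normSq_eq_norm_sq]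
    have := Complex.normSq_eq_conj_mul_self (z := (1 + M).det)
    rw [show star (1 + M).det = (starRingEnd ℂ) (1 + M).det from rfl, ← this, Complex.ofReal_re]
  have h2 := (Matrix.posSemidef_conjTranspose_mul_self (1 + M)).re_det_le_exp_trace
  have h3 : (((1 + M)ᴴ * (1 + M)).trace).re - Fintype.card m
      = 2 * (M.trace.re + (∑ i, ∑ j, ‖M i j‖ ^ 2) / 2) := by
    have e1 : (1 + M)ᴴ * (1 + M) = 1 + (M + Mᴴ) + Mᴴ * M := by
      rw [Matrix.conjTranspose_add, Matrix.conjTranspose_one]; noncomm_ring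
    have e2 : (Mᴴ * M).trace.re = ∑ i, ∑ j, ‖M i j‖ ^ 2 := by
      rw [Finset.sum_comm]
      simp only [Matrix.trace, Matrix.diag_apply, Matrix.mul_apply, Matrix.conjTranspose_apply,
        Complex.re_sum]
      refine Finset.sum_congr rfl fun i _ => Finset.sum_congr rfl fun j _ => ?_
      rw [show star (M j i) = (starRingEnd ℂ) (M j i) from rfl, ← Complex.normSq_eq_conj_mul_self,
        Complex.ofReal_re, Complex.normSq_eq_norm_sq]
    rw [e1, Matrix.trace_add, Matrix.trace_add, Matrix.trace_add, Matrix.trace_one,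
      Matrix.trace_conjTranspose]
    simp only [Complex.add_re, e2, Complex.natCast_re]
    rw [show star M.trace = (starRingEnd ℂ) M.trace from rfl, Complex.conj_re]
    ring
  rw [← h1, h3] at h2
  refine le_of_sq_le_sq ?_ (Real.exp_nonneg _)
  calc _ ≤ _ := h2
    _ = _ := by rw [← Real.exp_nat_mul]; norm_num

variable {H : Type*} [NormedAddCommGroup H] [InnerProductSpace ℂ H]

/-- The form suited to a product of two Hilbert-Schmidt operators: Cauchy-Schwarz bounds both the
trace and the Hilbert-Schmidt norm through $ab$. -/
theorem norm_det_one_add_inner_le (x y : m → H) {a b : ℝ} (ha : 0 ≤ a) (hb : 0 ≤ b)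
    (hx : ∑ i, ‖x i‖ ^ 2 ≤ a ^ 2) (hy : ∑ i, ‖y i‖ ^ 2 ≤ b ^ 2) :
    ‖(1 + Matrix.of fun i j => ⟪x i, y j⟫_ℂ).det‖ ≤ Real.exp (a * b + (a * b) ^ 2 / 2) := by
  refine (Matrix.norm_det_one_add_le _).trans (Real.exp_le_exp.mpr (add_le_add ?_ ?_))
  · calc _ ≤ ∑ i, ‖x i‖ * ‖y i‖ := by
          simp only [Matrix.trace, Matrix.diag_apply, Matrix.of_apply, Complex.re_sum]
          exact Finset.sum_le_sum fun i _ => (Complex.re_le_norm _).trans (norm_inner_le_norm _ _)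
      _ ≤ √(∑ i, ‖x i‖ ^ 2) * √(∑ i, ‖y i‖ ^ 2) := Real.sum_mul_le_sqrt_mul_sqrt _ _ _
      _ ≤ a * b := by
          gcongr
          · exact Real.sqrt_le_iff.mpr ⟨ha, hx⟩
          · exact Real.sqrt_le_iff.mpr ⟨hb, hy⟩
  · refine div_le_div_of_nonneg_right ?_ (by norm_num)
    calc _ ≤ ∑ i, ∑ j, ‖x i‖ ^ 2 * ‖y j‖ ^ 2 := by
          refine Finset.sum_le_sum fun i _ => Finset.sum_le_sum fun j _ => ?_
          rw [← mul_pow]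
          exact pow_le_pow_left₀ (norm_nonneg _) (norm_inner_le_norm _ _) 2
      _ = (∑ i, ‖x i‖ ^ 2) * ∑ i, ‖y i‖ ^ 2 := (Finset.sum_mul_sum _ _ _ _).symm
      _ ≤ a ^ 2 * b ^ 2 := by
          gcongr
      _ = _ := by ring

omit [DecidableEq m] [InnerProductSpace ℂ H] in
theorem sum_norm_add_sq_le (x x' : m → H) {a b : ℝ} (ha : 0 ≤ a) (hb : 0 ≤ b)
    (hx : ∑ i, ‖x i‖ ^ 2 ≤ a ^ 2) (hy : ∑ i, ‖x' i‖ ^ 2 ≤ b ^ 2) :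
    ∑ i, ‖x i + x' i‖ ^ 2 ≤ (a + b) ^ 2 := by
  have h1 : ∑ i, ‖x i‖ * ‖x' i‖ ≤ a * b :=
    (Real.sum_mul_le_sqrt_mul_sqrt _ _ _).trans (by
      gcongr
      · exact Real.sqrt_le_iff.mpr ⟨ha, hx⟩
      · exact Real.sqrt_le_iff.mpr ⟨hb, hy⟩)
  calc _ ≤ ∑ i, (‖x i‖ ^ 2 + 2 * (‖x i‖ * ‖x' i‖) + ‖x' i‖ ^ 2) := by
        refine Finset.sum_le_sum fun i _ => ?_
        calc _ ≤ (‖x i‖ + ‖x' i‖) ^ 2 := pow_le_pow_left₀ (norm_nonneg _) (norm_add_le _ _) 2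
          _ = _ := by ring
    _ ≤ a ^ 2 + 2 * (a * b) + b ^ 2 := by
        rw [Finset.sum_add_distrib, Finset.sum_add_distrib, ← Finset.mul_sum]
        gcongr
    _ = _ := by ring

theorem Matrix.differentiable_det_comp {M : ℂ → Matrix m m ℂ}
    (h : ∀ i j, Differentiable ℂ fun z => M z i j) : Differentiable ℂ fun z => (M z).det := by
  simp only [Matrix.det_apply]
  refine Differentiable.fun_sum fun σ _ => Differentiable.fun_const_smul ?_ _
  exact Differentiable.fun_finsetProd fun i _ => h _ _

/-- Lipschitz dependence of the determinant `det (1 + ⟪x i, y j⟫)` on the family `x`. -/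
theorem norm_det_one_add_inner_sub_le (x x' y : m → H) {a b δ : ℝ} (ha : 0 ≤ a) (hb : 0 ≤ b)
    (hδ : 0 < δ) (hδ1 : δ < 1) (hx : ∑ i, ‖x i‖ ^ 2 ≤ a ^ 2) (hy : ∑ i, ‖y i‖ ^ 2 ≤ b ^ 2)
    (hxx : ∑ i, ‖x' i - x i‖ ^ 2 ≤ δ ^ 2) :
    ‖(1 + Matrix.of fun i j => ⟪x' i, y j⟫_ℂ).det - (1 + Matrix.of fun i j => ⟪x i, y j⟫_ℂ).det‖
      ≤ 2 * Real.exp ((a + 1) * b + ((a + 1) * b) ^ 2 / 2) * δ := by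
  set B := Real.exp ((a + 1) * b + ((a + 1) * b) ^ 2 / 2) with hB
  -- The determinant along the complex line through `x` and `x'`. The conjugate makes it
  -- holomorphic, the inner product being antilinear in its first argument.
  set F : ℂ → ℂ := fun z => (1 + Matrix.of fun i j =>
    ⟪x i + (starRingEnd ℂ z) • (x' i - x i), y j⟫_ℂ).det with hF
  have hdiff : Differentiable ℂ F := by
    refine Matrix.differentiable_det_comp fun i j => ?_
    simp only [Matrix.add_apply, Matrix.of_apply, inner_add_left, inner_smul_left,
      Complex.conj_conj]
    fun_prop
  -- For $|z|<1/\delta$ the displacement has $\ell^2$ norm at most $1$, whence `a + 1` in the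
  -- constant.
  have hbound : ∀ z ∈ Metric.ball (0 : ℂ) (1 / δ), ‖F z‖ ≤ B := by
    intro z hz
    refine norm_det_one_add_inner_le _ _ (by linarith) hb ?_ hy
    refine sum_norm_add_sq_le _ _ ha zero_le_one hx ?_
    have hz' : ‖z‖ * δ ≤ 1 := by
      rw [mem_ball_zero_iff, lt_div_iff₀ hδ] at hz; exact hz.le
    calc _ = ‖z‖ ^ 2 * ∑ i, ‖x' i - x i‖ ^ 2 := by
          rw [Finset.mul_sum]
          refine Finset.sum_congr rfl fun i _ => ?_
          rw [norm_smul, RCLike.norm_conj, mul_pow]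
      _ ≤ ‖z‖ ^ 2 * δ ^ 2 := by gcongr
      _ = (‖z‖ * δ) ^ 2 := by ring
      _ ≤ 1 ^ 2 := by gcongr
  have h0 : (0 : ℂ) ∈ Metric.ball (0 : ℂ) (1 / δ) := by simp [hδ]
  have h1 : (1 : ℂ) ∈ Metric.ball (0 : ℂ) (1 / δ) := by
    simp [one_lt_inv₀ hδ, hδ1]
  -- Schwarz lemma on the disc of radius $1/\delta$, evaluated at $z=1$.
  have := Complex.dist_le_div_mul_dist_of_mapsTo_ball (f := F) (R₂ := 2 * B)
    hdiff.differentiableOn (fun z hz => by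
      rw [Metric.mem_closedBall, dist_eq_norm]
      exact (norm_sub_le _ _).trans (by linarith [hbound z hz, hbound 0 h0])) h1
  rw [dist_eq_norm, dist_zero_right, norm_one, mul_one, div_div_eq_mul_div, div_one] at this
  simpa [hF] using this

end DeterminantBounds

/-! ### The inequality between second and third cumulants, for matrices. -/

section Cumulants

open scoped Matrix ComplexOrder MatrixOrder

variable {m : Type*} [Fintype m] [DecidableEq m]

theorem Matrix.PosSemidef.re_trace_mul_nonneg {A B : Matrix m m ℂ} (hA : A.PosSemidef)
    (hB : B.PosSemidef) : 0 ≤ (A * B).trace.re := by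
  obtain ⟨X, rfl⟩ := CStarAlgebra.nonneg_iff_eq_star_mul_self.mp hA.nonneg
  rw [Matrix.star_eq_conjTranspose, Matrix.mul_assoc, Matrix.trace_mul_comm]
  exact (Complex.le_def.mp (hB.mul_mul_conjTranspose_same X).trace_nonneg).1

/-- $Q(1-Q)=Q(1-Q)Q+(1-Q)Q(1-Q)$, a sum of two congruences of positive matrices. -/
theorem Matrix.posSemidef_mul_one_sub {Q : Matrix m m ℂ} (hQ : Q.PosSemidef)
    (hQ1 : (1 - Q).PosSemidef) : (Q * (1 - Q)).PosSemidef := by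
  have h1 := hQ1.conjTranspose_mul_mul_same Q
  have h2 := hQ.conjTranspose_mul_mul_same (1 - Q)
  rw [hQ.1] at h1
  rw [hQ1.1] at h2
  have : Q * (1 - Q) = Q * (1 - Q) * Q + (1 - Q) * Q * (1 - Q) := by noncomm_ring
  rw [this]
  exact h1.add h2

/-- The real diagonal matrix with entries `f`, as a complex matrix. -/
def realDiag (f : m → ℝ) : Matrix m m ℂ := Matrix.diagonal fun i => (f i : ℂ)

omit [Fintype m] in
theorem realDiag_posSemidef {f : m → ℝ} (hf : ∀ i, 0 ≤ f i) : (realDiag f).PosSemidef :=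
  Matrix.PosSemidef.diagonal fun i => by simpa using hf i

omit [Fintype m] in
theorem realDiag_conjTranspose (f : m → ℝ) : (realDiag f)ᴴ = realDiag f := by
  simp only [realDiag, Matrix.diagonal_conjTranspose]
  congr 1; ext i; simp

theorem realDiag_mul (f g : m → ℝ) : realDiag f * realDiag g = realDiag fun i => f i * g i := by
  simp [realDiag, Matrix.diagonal_mul_diagonal]

omit [Fintype m] in
theorem realDiag_one : realDiag (fun _ : m => (1 : ℝ)) = 1 := by
  simp [realDiag]

omit [Fintype m] in
theorem realDiag_add (f g : m → ℝ) : realDiag f + realDiag g = realDiag fun i => f i + g i := by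
  simp [realDiag, Matrix.diagonal_add]

omit [Fintype m] in
theorem realDiag_neg (f : m → ℝ) : realDiag (fun i => -f i) = -realDiag f := by
  simp [realDiag, Matrix.diagonal_neg]

omit [Fintype m] in
theorem smul_one_sub_realDiag (C : ℝ) (f : m → ℝ) :
    ((C : ℂ) • (1 : Matrix m m ℂ) - realDiag f) = realDiag fun i => C - f i := by
  ext i j
  by_cases h : i = j <;> simp [realDiag, h]

/-- $QfQ\le CQ^2\le CQ$. -/
theorem posSemidef_smul_sub_mul_realDiag_mul {Q : Matrix m m ℂ} {f : m → ℝ} {C : ℝ} (hC : 0 ≤ C)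
    (hQ : Q.PosSemidef) (hQ1 : (1 - Q).PosSemidef) (hf : ∀ i, f i ≤ C) :
    ((C : ℂ) • Q - Q * realDiag f * Q).PosSemidef := by
  have h1 := (realDiag_posSemidef (f := fun i => C - f i) fun i => by
    linarith [hf i]).conjTranspose_mul_mul_same Q
  rw [hQ.1, ← smul_one_sub_realDiag] at h1
  have h2 := (Matrix.posSemidef_mul_one_sub hQ hQ1).smul (a := (C : ℂ)) (by simpa using hC)
  have : (C : ℂ) • Q - Q * realDiag f * Q
      = Q * ((C : ℂ) • 1 - realDiag f) * Q + (C : ℂ) • (Q * (1 - Q)) := by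
    simp only [mul_sub, sub_mul, Matrix.mul_smul, Matrix.smul_mul, mul_one, smul_sub]
    abel
  rw [this]
  exact h1.add h2

theorem re_trace_sandwich_nonneg {P S : Matrix m m ℂ} (f : m → ℝ) (hP : P.PosSemidef)
    (hS : S.PosSemidef) : 0 ≤ (P * (realDiag f * S * realDiag f)).trace.re := by
  have := hS.conjTranspose_mul_mul_same (realDiag f)
  rw [realDiag_conjTranspose] at this
  exact hP.re_trace_mul_nonneg this

/-- The operator inequalities $\pm QfQ\le CQ$ are multiplied by $f$ on both sides and traced against
$P\ge0$. -/
theorem abs_re_trace_sandwich_le {P Q : Matrix m m ℂ} {f : m → ℝ} {C : ℝ} (hC : 0 ≤ C)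
    (hP : P.PosSemidef) (hQ : Q.PosSemidef) (hQ1 : (1 - Q).PosSemidef) (hf : ∀ i, |f i| ≤ C) :
    |(P * (realDiag f * (Q * realDiag f * Q) * realDiag f)).trace.re|
      ≤ C * (P * (realDiag f * Q * realDiag f)).trace.re := by
  have h1 := re_trace_sandwich_nonneg f hP
    (posSemidef_smul_sub_mul_realDiag_mul hC hQ hQ1 fun i => (abs_le.mp (hf i)).2)
  have h2 := re_trace_sandwich_nonneg f hP
    (posSemidef_smul_sub_mul_realDiag_mul (f := fun i => -f i) hC hQ hQ1 fun i => by
      linarith [(abs_le.mp (hf i)).1])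
  rw [realDiag_neg] at h2
  simp only [mul_sub, sub_mul, Matrix.mul_smul, Matrix.smul_mul, Matrix.trace_sub,
    Matrix.trace_smul, Complex.sub_re, smul_eq_mul, Complex.re_ofReal_mul, mul_neg, neg_mul,
    Matrix.trace_neg, Complex.neg_re] at h1 h2
  rw [abs_le]
  constructor <;> linarith

/-- The bound `|κ₃| ≤ 2 C κ₂` between the second and third cumulants of a linear statistic. -/
theorem abs_third_cumulant_le {Q : Matrix m m ℂ} {f : m → ℝ} {C : ℝ} (hC : 0 ≤ C)
    (hQ : Q.PosSemidef) (hQ1 : (1 - Q).PosSemidef) (hf : ∀ i, |f i| ≤ C) :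
    |((realDiag f * (1 - Q) * realDiag f * Q * realDiag f * Q).trace
      - (realDiag f * (1 - Q) * realDiag f * (1 - Q) * realDiag f * Q).trace).re|
      ≤ 2 * C * (realDiag f * (1 - Q) * realDiag f * Q).trace.re := by
  set F := realDiag f
  -- The two traces are treated with the roles of $Q$ and $1-Q$ exchanged. Each costs $C\kappa_2$,
  -- whence the factor $2C$.
  have h1 := abs_re_trace_sandwich_le hC hQ1 hQ hQ1 hf
  have h2 := abs_re_trace_sandwich_le hC hQ hQ1 (by rwa [sub_sub_cancel]) hf
  have e1 : ((1 - Q) * (F * (Q * F * Q) * F)).trace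
      = (F * (1 - Q) * F * Q * F * Q).trace := by
    rw [show (1 - Q) * (F * (Q * F * Q) * F) = ((1 - Q) * F * Q * F * Q) * F by
      simp only [Matrix.mul_assoc], Matrix.trace_mul_comm]; simp only [Matrix.mul_assoc]
  have e2 : (Q * (F * ((1 - Q) * F * (1 - Q)) * F)).trace
      = (F * (1 - Q) * F * (1 - Q) * F * Q).trace := by
    rw [Matrix.trace_mul_comm]; simp only [Matrix.mul_assoc]
  have e3 : ((1 - Q) * (F * Q * F)).trace = (F * (1 - Q) * F * Q).trace := by
    rw [show (1 - Q) * (F * Q * F) = ((1 - Q) * F * Q) * F by simp only [Matrix.mul_assoc],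
      Matrix.trace_mul_comm]; simp only [Matrix.mul_assoc]
  have e4 : (Q * (F * (1 - Q) * F)).trace = (F * (1 - Q) * F * Q).trace := by
    rw [Matrix.trace_mul_comm]
  rw [e1, e3] at h1
  rw [e2, e4] at h2
  rw [Complex.sub_re]
  exact (abs_sub _ _).trans (by linarith)

end Cumulants

/-! ### Jacobi's formula for the derivative of a determinant. -/

section Derivatives

open scoped Matrix

variable {m : Type*} [Fintype m] [DecidableEq m]

/-- Differentiating the Leibniz expansion replaces one column at a time by its derivative; Cramer's
rule identifies the sum with a trace against the adjugate. -/
theorem Matrix.hasDerivAt_det {M : ℝ → Matrix m m ℂ} {M' : Matrix m m ℂ} {t : ℝ}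
    (h : ∀ i j, HasDerivAt (fun t => M t i j) (M' i j) t) :
    HasDerivAt (fun t => (M t).det) (((M t).adjugate * M').trace) t := by
  have h1 : HasDerivAt (fun t => (M t).det)
      (∑ σ : Equiv.Perm m, (Equiv.Perm.sign σ : ℤ) •
        ∑ i, (∏ j ∈ Finset.univ.erase i, M t (σ j) j) * M' (σ i) i) t := by
    simp only [Matrix.det_apply]
    refine HasDerivAt.fun_sum fun σ _ => ?_
    have := (HasDerivAt.fun_finsetProd (u := Finset.univ) fun i _ => h (σ i) i).const_smul
      ((Equiv.Perm.sign σ : ℤ))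
    simpa [Units.smul_def] using! this
  convert h1 using 1
  have h2 : ((M t).adjugate * M').trace = ∑ i, ((M t).updateCol i fun k => M' k i).det := by
    simp only [Matrix.trace, Matrix.diag_apply]
    refine Finset.sum_congr rfl fun i _ => ?_
    rw [← Matrix.cramer_apply, Matrix.cramer_eq_adjugate_mulVec]
    rfl
  rw [h2]
  simp only [Matrix.det_apply, Finset.smul_sum]
  rw [Finset.sum_comm]
  refine Finset.sum_congr rfl fun σ _ => Finset.sum_congr rfl fun i _ => ?_
  rw [Units.smul_def, ← Finset.mul_prod_erase Finset.univ _ (Finset.mem_univ i), mul_comm]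
  congr 1
  congr 1
  · refine Finset.prod_congr rfl fun j hj => ?_
    rw [Matrix.updateCol_ne (Finset.ne_of_mem_erase hj)]
  · rw [Matrix.updateCol_self]

end Derivatives

/-! ### Comparison of second differences, a derivative-free form of $|G'''|\le cG''$. -/

section SecondDifference

/-- The symmetric second difference of `G` at `a` with step `h`. -/
def secondDiff (G : ℝ → ℝ) (a h : ℝ) : ℝ := G (a + h) + G (a - h) - 2 * G a

/-- The second differences of `G` at two points are comparable, up to the exponential of `c` times
the distance. -/
def SecondDiffComparable (c : ℝ) (G : ℝ → ℝ) : Prop :=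
  ∀ a b h, secondDiff G a h ≤ Real.exp (c * |a - b|) * secondDiff G b h

/-- This stability under pointwise limits is the reason for working with differences instead of
derivatives. -/
theorem SecondDiffComparable.of_tendsto {ι : Type*} {l : Filter ι} [l.NeBot] {c : ℝ}
    {F : ι → ℝ → ℝ} {G : ℝ → ℝ} (hF : ∀ i, SecondDiffComparable c (F i))
    (h : ∀ t, Tendsto (fun i => F i t) l (𝓝 (G t))) : SecondDiffComparable c G := by
  have key : ∀ a h', Tendsto (fun i => secondDiff (F i) a h') l (𝓝 (secondDiff G a h')) :=
    fun a h' => ((h _).add (h _)).sub ((h _).const_mul 2)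
  exact fun a b h' => le_of_tendsto_of_tendsto' (key a h') ((key b h').const_mul _)
    fun i => hF i a b h'

theorem secondDiff_nonneg_of_deriv {Φ Φ₁ Φ₂ : ℝ → ℝ} (h1 : ∀ t, HasDerivAt Φ (Φ₁ t) t)
    (h2 : ∀ t, HasDerivAt Φ₁ (Φ₂ t) t) (h3 : ∀ t, 0 ≤ Φ₂ t) (h : ℝ) : 0 ≤ secondDiff Φ 0 h := by
  have hmono : Monotone Φ₁ := monotone_of_deriv_nonneg (fun t => (h2 t).differentiableAt)
    fun t => by rw [(h2 t).deriv]; exact h3 t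
  have hconv : ConvexOn ℝ Set.univ Φ := by
    refine Monotone.convexOn_univ_of_deriv (fun t => (h1 t).differentiableAt) ?_
    have : deriv Φ = Φ₁ := funext fun t => (h1 t).deriv
    rwa [this]
  have := hconv.2 (Set.mem_univ h) (Set.mem_univ (-h)) (show (0 : ℝ) ≤ 1 / 2 by norm_num)
    (show (0 : ℝ) ≤ 1 / 2 by norm_num) (by norm_num)
  simp only [smul_eq_mul] at this
  rw [show 1 / 2 * h + 1 / 2 * -h = 0 by ring] at this
  simp only [secondDiff, zero_add, zero_sub]
  linarith

/-- Grönwall: $e^{ct}g$ is nondecreasing and $e^{-ct}g$ is nonincreasing. -/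
theorem le_exp_mul_of_abs_deriv_le {g g' : ℝ → ℝ} {c : ℝ} (hg : ∀ t, HasDerivAt g (g' t) t)
    (hle : ∀ t, |g' t| ≤ c * g t) (a b : ℝ) :
    g a ≤ Real.exp (c * |a - b|) * g b := by
  have hd1 : ∀ t, HasDerivAt (fun t => Real.exp (c * t) * g t)
      (Real.exp (c * t) * c * g t + Real.exp (c * t) * g' t) t := fun t => by
    have := (((hasDerivAt_id t).const_mul c).exp).mul (hg t)
    simpa using! this
  have hd2 : ∀ t, HasDerivAt (fun t => Real.exp (-c * t) * g t)
      (Real.exp (-c * t) * -c * g t + Real.exp (-c * t) * g' t) t := fun t => by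
    have := (((hasDerivAt_id t).const_mul (-c)).exp).mul (hg t)
    simpa using! this
  have hm1 : Monotone fun t => Real.exp (c * t) * g t :=
    monotone_of_deriv_nonneg (fun t => (hd1 t).differentiableAt) fun t => by
      rw [(hd1 t).deriv]
      have := (abs_le.mp (hle t)).1
      nlinarith [Real.exp_pos (c * t)]
  have hm2 : Antitone fun t => Real.exp (-c * t) * g t :=
    antitone_of_deriv_nonpos (fun t => (hd2 t).differentiableAt) fun t => by
      rw [(hd2 t).deriv]
      have := (abs_le.mp (hle t)).2
      nlinarith [Real.exp_pos (-c * t)]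
  rcases le_total a b with hab | hab
  · have := hm1 hab
    simp only at this
    rw [abs_of_nonpos (by linarith), show c * -(a - b) = c * b - c * a by ring, Real.exp_sub,
      div_mul_eq_mul_div, le_div_iff₀ (Real.exp_pos _)]
    linarith
  · have := hm2 hab
    simp only at this
    rw [abs_of_nonneg (by linarith), show c * (a - b) = -c * b - (-c * a) by ring, Real.exp_sub,
      div_mul_eq_mul_div, le_div_iff₀ (Real.exp_pos _)]
    linarith

/-- The points $a+t$ and $b+t$ stay at distance $|a-b|$, so $t\mapsto e^{c|a-b|}G(b+t)-G(a+t)$ has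
nonnegative second derivative and is convex. -/
theorem SecondDiffComparable.of_abs_deriv_le {G g₁ g₂ g₃ : ℝ → ℝ} {c : ℝ}
    (h1 : ∀ t, HasDerivAt G (g₁ t) t) (h2 : ∀ t, HasDerivAt g₁ (g₂ t) t)
    (h3 : ∀ t, HasDerivAt g₂ (g₃ t) t) (hle : ∀ t, |g₃ t| ≤ c * g₂ t) :
    SecondDiffComparable c G := by
  intro a b h
  set k := Real.exp (c * |a - b|)
  have := secondDiff_nonneg_of_deriv (Φ := fun t => k * G (b + t) - G (a + t))
    (Φ₁ := fun t => k * g₁ (b + t) - g₁ (a + t)) (Φ₂ := fun t => k * g₂ (b + t) - g₂ (a + t))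
    (fun t => (((h1 _).comp_const_add b t).const_mul k).sub ((h1 _).comp_const_add a t))
    (fun t => (((h2 _).comp_const_add b t).const_mul k).sub ((h2 _).comp_const_add a t))
    (fun t => by
      have := le_exp_mul_of_abs_deriv_le h3 hle (a + t) (b + t)
      rw [add_sub_add_right_eq_sub] at this
      linarith) h
  simp only [secondDiff, zero_add, zero_sub, add_zero, ← sub_eq_add_neg] at this ⊢
  linarith

end SecondDifference

/-! ### The logarithm of the tilted determinant and its first three derivatives. -/

noncomputable section LogDet

open scoped Matrix ComplexOrder MatrixOrder Matrix.Norms.Operator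

variable {m : Type*} [Fintype m] [DecidableEq m]

/-- The matrix `1 - (1 - e^{t f}) K`, with `f` regarded as a diagonal matrix. -/
def tiltMatrix (K : Matrix m m ℂ) (f : m → ℝ) (t : ℝ) : Matrix m m ℂ :=
  1 - (1 - realDiag fun i => Real.exp (t * f i)) * K

variable {K : Matrix m m ℂ} {f : m → ℝ}

theorem tiltMatrix_eq (t : ℝ) :
    tiltMatrix K f t = (1 - K) + (realDiag fun i => Real.exp (t * f i)) * K := by
  rw [tiltMatrix]; noncomm_ring

theorem tiltMatrix_conjTranspose (hK : K.PosSemidef) (t : ℝ) :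
    (tiltMatrix K f t)ᴴ = (1 - K) + K * realDiag fun i => Real.exp (t * f i) := by
  rw [tiltMatrix_eq, Matrix.conjTranspose_add, Matrix.conjTranspose_sub, Matrix.conjTranspose_mul,
    realDiag_conjTranspose, hK.1, Matrix.conjTranspose_one]

/-- Let $v$ be in the kernel, $w=Kv$ and $D=e^{tf}$. Then $(1-K)v=-Dw$, so $0\le\langle
v,K(1-K)v\rangle=-\langle w,Dw\rangle$. This forces $w=0$, and then $v=0$. -/
theorem tiltMatrix_det_ne_zero (hK : K.PosSemidef) (hK1 : (1 - K).PosSemidef) (t : ℝ) :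
    (tiltMatrix K f t).det ≠ 0 := by
  intro h0
  obtain ⟨v, hv, hv0⟩ := Matrix.exists_mulVec_eq_zero_iff.mpr h0
  set D : Matrix m m ℂ := realDiag fun i => Real.exp (t * f i) with hD
  have hDpos : D.PosDef := Matrix.PosDef.diagonal fun i => by
    exact_mod_cast Real.exp_pos _
  rw [tiltMatrix_eq, Matrix.add_mulVec, ← Matrix.mulVec_mulVec] at hv0
  set w := K *ᵥ v with hw
  have hw1 : (1 - K) *ᵥ v = -(D *ᵥ w) := eq_neg_of_add_eq_zero_left hv0
  have h1 : 0 ≤ star v ⬝ᵥ ((K * (1 - K)) *ᵥ v) :=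
    (Matrix.posSemidef_mul_one_sub hK hK1).dotProduct_mulVec_nonneg v
  have h2 : star v ⬝ᵥ ((K * (1 - K)) *ᵥ v) = -(star w ⬝ᵥ (D *ᵥ w)) := by
    rw [← Matrix.mulVec_mulVec, hw1, Matrix.mulVec_neg, dotProduct_neg, Matrix.dotProduct_mulVec,
      hw, Matrix.star_mulVec, hK.1]
  have hw0 : w = 0 := by
    by_contra hne
    have h3 := hDpos.dotProduct_mulVec_pos hne
    rw [h2] at h1
    exact absurd (neg_nonneg.mp h1) (not_le_of_gt h3)
  rw [hw0, Matrix.mulVec_zero, neg_zero, Matrix.sub_mulVec, Matrix.one_mulVec, ← hw, hw0,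
    sub_zero] at hw1
  exact hv hw1

/-- Taking adjoints swaps the two factors, and $\det(1-AB)=\det(1-BA)$. -/
theorem tiltMatrix_det_eq_ofReal (hK : K.PosSemidef) (t : ℝ) :
    (tiltMatrix K f t).det = (((tiltMatrix K f t).det.re : ℝ) : ℂ) := by
  have h : (starRingEnd ℂ) (tiltMatrix K f t).det = (tiltMatrix K f t).det := by
    rw [show (starRingEnd ℂ) (tiltMatrix K f t).det = star (tiltMatrix K f t).det from rfl,
      ← Matrix.det_conjTranspose, tiltMatrix, Matrix.conjTranspose_sub, Matrix.conjTranspose_mul,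
      Matrix.conjTranspose_sub, realDiag_conjTranspose, hK.1, Matrix.conjTranspose_one,
      Matrix.det_one_sub_mul_comm]
  exact (Complex.conj_eq_iff_re.mp h).symm

theorem hasDerivAt_tiltMatrix (t : ℝ) :
    HasDerivAt (tiltMatrix K f)
      (realDiag f * (realDiag fun i => Real.exp (t * f i)) * K) t := by
  have h1 : ∀ g : m → ℝ, (realDiag g : Matrix m m ℂ)
      = ∑ i, g i • Matrix.single i i (1 : ℂ) := by
    intro g
    rw [realDiag, ← Matrix.sum_single_eq_diagonal]
    simp [Matrix.smul_single]
  have h2 : HasDerivAt (fun t : ℝ => (realDiag fun i => Real.exp (t * f i) : Matrix m m ℂ))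
      (realDiag f * (realDiag fun i => Real.exp (t * f i))) t := by
    rw [realDiag_mul]
    simp only [h1]
    refine HasDerivAt.fun_sum fun i _ => HasDerivAt.smul_const ?_ _
    have := ((hasDerivAt_id t).mul_const (f i)).exp
    simpa [mul_comm] using this
  have h3 := ((h2.const_sub 1).mul_const K).const_sub 1
  simpa [tiltMatrix] using! h3

/-- The tilted kernel `e^{t f} K (1 - (1 - e^{t f}) K)⁻¹`. -/
def tiltKernel (K : Matrix m m ℂ) (f : m → ℝ) (t : ℝ) : Matrix m m ℂ :=
  (realDiag fun i => Real.exp (t * f i)) * K * (tiltMatrix K f t)⁻¹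

/-- A closed Riccati equation for $R$: it lets every further derivative of the log-determinant be
written in terms of $f$ and $R$. -/
theorem hasDerivAt_tiltKernel (hK : K.PosSemidef) (hK1 : (1 - K).PosSemidef) (t : ℝ) :
    HasDerivAt (tiltKernel K f)
      ((1 - tiltKernel K f t) * realDiag f * tiltKernel K f t) t := by
  set D : Matrix m m ℂ := realDiag fun i => Real.exp (t * f i) with hD
  have hu : IsUnit (tiltMatrix K f t) :=
    (Matrix.isUnit_iff_isUnit_det _).mpr (tiltMatrix_det_ne_zero hK hK1 t).isUnit
  have hinv : HasDerivAt (fun t => (tiltMatrix K f t)⁻¹)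
      (-((tiltMatrix K f t)⁻¹ * (realDiag f * D * K) * (tiltMatrix K f t)⁻¹)) t := by
    have h1 := hasFDerivAt_ringInverse (𝕜 := ℝ) hu.unit
    rw [hu.unit_spec] at h1
    have h2 := h1.comp_hasDerivAt t (hasDerivAt_tiltMatrix t)
    simp only [Matrix.nonsing_inv_eq_ringInverse]
    convert! h2 using 1
    rw [← Matrix.nonsing_inv_eq_ringInverse]
    simp [Matrix.mul_assoc, Matrix.coe_units_inv, hD]
  have hDK : ∀ s : ℝ, (realDiag fun i => Real.exp (s * f i) : Matrix m m ℂ) * K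
      = tiltMatrix K f s - (1 - K) := fun s => by rw [tiltMatrix_eq]; abel
  have h3 := ((hasDerivAt_tiltMatrix (K := K) (f := f) t).sub_const (1 - K)).mul hinv
  have h4 : (fun s => tiltMatrix K f s - (1 - K)) * (fun t => (tiltMatrix K f t)⁻¹)
      = tiltKernel K f := by
    funext s
    simp only [Pi.mul_apply, tiltKernel, hDK]
  rw [h4] at h3
  convert! h3 using 1
  rw [← hDK, ← hD]
  simp only [tiltKernel, ← hD]
  noncomm_ring

/-- $R$ is not self-adjoint, but with $E=e^{tf/2}$ and $M=1-(1-E^2)K$ it is conjugate to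
$Q=EKM^{-1}E$. Congruence by $M^{-1}E$ reduces $Q\ge0$ to $M^*K=K(1-K)+KE^2K\ge0$, and
$1-Q=E^{-1}(1-K)M^{-1}E\ge0$ to $K(1-K)+(1-K)E^{-2}(1-K)\ge0$. The conjugating matrix is diagonal,
so it commutes with $f$ and leaves the traces below unchanged. -/
theorem exists_tiltKernel_eq (hK : K.PosSemidef) (hK1 : (1 - K).PosSemidef) (t : ℝ) :
    ∃ (g : m → ℝ) (Q : Matrix m m ℂ), Q.PosSemidef ∧ (1 - Q).PosSemidef ∧
      realDiag g * realDiag (fun i => (g i)⁻¹) = 1 ∧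
      realDiag (fun i => (g i)⁻¹) * realDiag g = 1 ∧
      tiltKernel K f t = realDiag g * Q * realDiag (fun i => (g i)⁻¹) := by
  set g : m → ℝ := fun i => Real.exp (t * f i / 2) with hg
  set E : Matrix m m ℂ := realDiag g with hE
  set E' : Matrix m m ℂ := realDiag (fun i => (g i)⁻¹) with hE'
  have hgp : ∀ i, g i ≠ 0 := fun i => (Real.exp_pos _).ne'
  have hEE' : E * E' = 1 := by
    rw [hE, hE', realDiag_mul, ← realDiag_one]; congr 1; ext i; exact mul_inv_cancel₀ (hgp i)
  have hE'E : E' * E = 1 := by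
    rw [hE, hE', realDiag_mul, ← realDiag_one]; congr 1; ext i; exact inv_mul_cancel₀ (hgp i)
  have hD : (realDiag fun i => Real.exp (t * f i) : Matrix m m ℂ) = E * E := by
    rw [hE, realDiag_mul]; congr 1; ext i; rw [hg, ← Real.exp_add]; congr 1; ring
  set M := tiltMatrix K f t with hM
  have hdet : IsUnit M.det := (tiltMatrix_det_ne_zero hK hK1 t).isUnit
  have hMM : M * M⁻¹ = 1 := Matrix.mul_nonsing_inv _ hdet
  have hMH : (M⁻¹)ᴴ * Mᴴ = 1 := by
    rw [← Matrix.conjTranspose_mul, hMM, Matrix.conjTranspose_one]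
  have hMe : M = (1 - K) + E * E * K := by rw [hM, tiltMatrix_eq, hD]
  have hMHe : Mᴴ = (1 - K) + K * (E * E) := by rw [hM, tiltMatrix_conjTranspose hK, hD]
  have hEc : Eᴴ = E := realDiag_conjTranspose _
  have hE'c : E'ᴴ = E' := realDiag_conjTranspose _
  have hQ : (E * K * M⁻¹ * E).PosSemidef := by
    have h1 : (Mᴴ * K).PosSemidef := by
      have h2 := hK.conjTranspose_mul_mul_same (E * 1)
      have h3 := (Matrix.posSemidef_conjTranspose_mul_self (E * K))
      have h4 := Matrix.posSemidef_mul_one_sub hK hK1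
      rw [Matrix.conjTranspose_mul, hEc, hK.1] at h3
      have : Mᴴ * K = K * (1 - K) + K * E * (E * K) := by rw [hMHe]; noncomm_ring
      rw [this]; exact h4.add h3
    have h5 := h1.conjTranspose_mul_mul_same (M⁻¹ * E)
    rw [Matrix.conjTranspose_mul, hEc] at h5
    convert h5 using 1
    rw [show E * (M⁻¹)ᴴ * (Mᴴ * K) * (M⁻¹ * E) = E * ((M⁻¹)ᴴ * Mᴴ) * K * M⁻¹ * E by
      simp only [Matrix.mul_assoc], hMH, Matrix.mul_one]
  have hQ1 : (1 - E * K * M⁻¹ * E).PosSemidef := by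
    have h1 : (Mᴴ * E' * (E' * (1 - K))).PosSemidef := by
      have h3 := (Matrix.posSemidef_conjTranspose_mul_self (E' * (1 - K)))
      have h4 := Matrix.posSemidef_mul_one_sub hK hK1
      rw [Matrix.conjTranspose_mul, hE'c, hK1.1] at h3
      have : Mᴴ * E' * (E' * (1 - K)) = K * (1 - K) + (1 - K) * E' * (E' * (1 - K)) := by
        rw [hMHe, show ((1 - K) + K * (E * E)) * E' * (E' * (1 - K))
          = K * (E * (E * E') * E') * (1 - K) + (1 - K) * E' * (E' * (1 - K)) by noncomm_ring,
          hEE', mul_one, hEE', mul_one]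
      rw [this]; exact h4.add h3
    have h5 := h1.conjTranspose_mul_mul_same (M⁻¹ * E)
    rw [Matrix.conjTranspose_mul, hEc] at h5
    convert h5 using 1
    rw [show E * (M⁻¹)ᴴ * (Mᴴ * E' * (E' * (1 - K))) * (M⁻¹ * E)
      = E * ((M⁻¹)ᴴ * Mᴴ) * E' * E' * (1 - K) * M⁻¹ * E by
      simp only [Matrix.mul_assoc], hMH, Matrix.mul_one, hEE', one_mul]
    have h6 : (1 - K) = M - E * E * K := by rw [hMe]; abel
    rw [h6, mul_sub, sub_mul, sub_mul, mul_assoc E' M, hMM, mul_one, hE'E]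
    rw [show E' * (E * E * K) * M⁻¹ * E = (E' * E) * E * K * M⁻¹ * E by
      simp only [Matrix.mul_assoc], hE'E, one_mul]
  refine ⟨g, E * K * M⁻¹ * E, hQ, hQ1, hEE', hE'E, ?_⟩
  rw [tiltKernel, hD, ← hE, ← hE', ← hM]
  rw [show E * (E * K * M⁻¹ * E) * E' = E * E * K * M⁻¹ * (E * E') by
    simp only [Matrix.mul_assoc], hEE', mul_one]

omit [DecidableEq m] in
theorem hasDerivAt_re_trace {A : ℝ → Matrix m m ℂ} {A' : Matrix m m ℂ} {t : ℝ}
    (h : HasDerivAt A A' t) : HasDerivAt (fun t => (A t).trace.re) A'.trace.re t := by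
  let L : Matrix m m ℂ →ₗ[ℝ] ℝ := Complex.reLm ∘ₗ (Matrix.traceLinearMap m ℝ ℂ)
  have hL : Continuous L := by
    exact Complex.continuous_re.comp (continuous_id.matrix_trace)
  have := (ContinuousLinearMap.mk L hL).hasFDerivAt.comp_hasDerivAt t h
  exact this

theorem abs_third_cumulant_tiltKernel_le (hK : K.PosSemidef) (hK1 : (1 - K).PosSemidef) {C : ℝ}
    (hC : 0 ≤ C) (hf : ∀ i, |f i| ≤ C) (t : ℝ) :
    |((realDiag f * (1 - tiltKernel K f t) * realDiag f * tiltKernel K f t * realDiag f *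
        tiltKernel K f t).trace
      - (realDiag f * (1 - tiltKernel K f t) * realDiag f * (1 - tiltKernel K f t) * realDiag f *
        tiltKernel K f t).trace).re|
      ≤ 2 * C * (realDiag f * (1 - tiltKernel K f t) * realDiag f * tiltKernel K f t).trace.re := by
  obtain ⟨g, Q, hQ, hQ1, hEE', hE'E, hR⟩ := exists_tiltKernel_eq (f := f) hK hK1 t
  set E : Matrix m m ℂ := realDiag g with hE
  set E' : Matrix m m ℂ := realDiag (fun i => (g i)⁻¹) with hE'
  set F : Matrix m m ℂ := realDiag f with hF
  have hF' : F = E * F * E' := by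
    have : E * F = F * E := by
      rw [hE, hF, realDiag_mul, realDiag_mul]; congr 1; ext i; ring
    rw [this, mul_assoc, hEE', mul_one]
  have h1R : 1 - tiltKernel K f t = E * (1 - Q) * E' := by
    rw [hR, mul_sub, sub_mul, mul_one, hEE']
  have hconj : ∀ A B : Matrix m m ℂ, (E * A * E') * (E * B * E') = E * (A * B) * E' := by
    intro A B
    rw [show (E * A * E') * (E * B * E') = E * A * (E' * E) * B * E' by
      simp only [Matrix.mul_assoc], hE'E, mul_one]
    simp only [Matrix.mul_assoc]
  have htr : ∀ A : Matrix m m ℂ, (E * A * E').trace = A.trace := fun A => by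
    rw [Matrix.trace_mul_comm, ← mul_assoc, hE'E, one_mul]
  have hb := abs_third_cumulant_le hC hQ hQ1 hf
  rw [← hF] at hb
  rw [h1R, hR, hF']
  simp only [hconj, htr]
  exact hb

/-- The determinant is real, continuous in $t$, never zero, and equal to $1$ at $t=0$. -/
theorem re_det_tiltMatrix_pos (hK : K.PosSemidef) (hK1 : (1 - K).PosSemidef) (t : ℝ) :
    0 < (tiltMatrix K f t).det.re := by
  have hne : ∀ s, (tiltMatrix K f s).det.re ≠ 0 := fun s h0 => by
    have := tiltMatrix_det_eq_ofReal (f := f) hK s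
    rw [h0, Complex.ofReal_zero] at this
    exact tiltMatrix_det_ne_zero hK hK1 s this
  have h0 : (tiltMatrix K f 0).det.re = 1 := by
    simp [tiltMatrix, realDiag_one]
  have hcont : Continuous fun s => (tiltMatrix K f s).det.re := by
    have : Continuous (tiltMatrix K f) :=
      continuous_iff_continuousAt.mpr fun s => (hasDerivAt_tiltMatrix s).continuousAt
    exact Complex.continuous_re.comp this.matrix_det
  by_contra hneg
  obtain ⟨s, hs⟩ := mem_range_of_exists_le_of_exists_ge hcont ⟨t, not_lt.mp hneg⟩
    ⟨0, h0.symm ▸ zero_le_one⟩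
  exact hne s hs

/-- Jacobi's formula gives the first derivative $\operatorname{tr}(fR)$; the Riccati equation gives
the next two as $\kappa_2$ and $\kappa_3$ of the tilted kernel. -/
theorem secondDiffComparable_log_det (hK : K.PosSemidef) (hK1 : (1 - K).PosSemidef) {C : ℝ}
    (hC : 0 ≤ C) (hf : ∀ i, |f i| ≤ C) :
    SecondDiffComparable (2 * C) fun t => Real.log (tiltMatrix K f t).det.re := by
  set F : Matrix m m ℂ := realDiag f with hF
  have hdet : ∀ t, HasDerivAt (fun t => (tiltMatrix K f t).det.re)
      ((tiltMatrix K f t).det.re * (F * tiltKernel K f t).trace.re) t := by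
    intro t
    have h1 : HasDerivAt (fun t => (tiltMatrix K f t).det)
        (((tiltMatrix K f t).adjugate * (F * (realDiag fun i => Real.exp (t * f i)) * K)).trace)
        t := by
      refine Matrix.hasDerivAt_det fun i j => ?_
      have := hasDerivAt_pi.mp (hasDerivAt_pi.mp (hasDerivAt_tiltMatrix (K := K) (f := f) t) i) j
      exact this
    have h2 := Complex.reCLM.hasFDerivAt.comp_hasDerivAt t h1
    convert! h2 using 1
    have hu : IsUnit (tiltMatrix K f t).det := (tiltMatrix_det_ne_zero hK hK1 t).isUnit
    have hadj : (tiltMatrix K f t).adjugate = (tiltMatrix K f t).det • (tiltMatrix K f t)⁻¹ := by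
      rw [Matrix.inv_def, smul_smul, Ring.mul_inverse_cancel _ hu, one_smul]
    have htr : ((tiltMatrix K f t)⁻¹ * (F * (realDiag fun i => Real.exp (t * f i)) * K)).trace
        = (F * tiltKernel K f t).trace := by
      rw [Matrix.trace_mul_comm, tiltKernel]
      simp only [Matrix.mul_assoc]
    rw [hadj, Matrix.smul_mul, Matrix.trace_smul, htr, smul_eq_mul,
      Complex.reCLM_apply, tiltMatrix_det_eq_ofReal hK t, Complex.re_ofReal_mul,
      Complex.ofReal_re]
  have hR := fun t => hasDerivAt_tiltKernel (f := f) hK hK1 t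
  refine SecondDiffComparable.of_abs_deriv_le
    (g₁ := fun t => (F * tiltKernel K f t).trace.re)
    (g₂ := fun t => (F * (1 - tiltKernel K f t) * F * tiltKernel K f t).trace.re)
    (g₃ := fun t => -((F * (1 - tiltKernel K f t) * F * tiltKernel K f t * F *
        tiltKernel K f t).trace - (F * (1 - tiltKernel K f t) * F * (1 - tiltKernel K f t) * F *
        tiltKernel K f t).trace).re) ?_ ?_ ?_ ?_
  · intro t
    have := (hdet t).log (re_det_tiltMatrix_pos hK hK1 t).ne'
    rwa [mul_div_cancel_left₀ _ (re_det_tiltMatrix_pos hK hK1 t).ne'] at this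
  · intro t
    have := hasDerivAt_re_trace ((hR t).const_mul F)
    simpa only [mul_assoc] using this
  · intro t
    have := hasDerivAt_re_trace ((((hR t).const_sub 1).const_mul F).mul_const F |>.mul (hR t))
    convert! this using 1
    rw [← Complex.neg_re, neg_sub, ← Matrix.trace_sub]
    congr 2
    noncomm_ring
  · intro t
    rw [abs_neg]
    exact abs_third_cumulant_tiltKernel_le hK hK1 hC hf t

end LogDet

/-! ### A Vitali-type theorem through Taylor coefficients. -/

section PowerSeries

variable {ι : Type*} {l : Filter ι}

theorem norm_tsum_shift_le {d : ℕ → ℂ} {B r u : ℝ} (hr : 0 < r) (hu : 0 < u)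
    (hur : u ≤ r / 2) (hd : ∀ k, ‖d k‖ * r ^ k ≤ B) (k : ℕ) :
    ‖∑' j, d (j + k) * (u : ℂ) ^ (j + k)‖ ≤ 2 * B * (u / r) ^ k := by
  have hB : 0 ≤ B := le_trans (by positivity) (hd 0)
  have hq : u / r ≤ 1 / 2 := by rw [div_le_iff₀ hr]; linarith
  have hq0 : 0 ≤ u / r := by positivity
  have hterm : ∀ j, ‖d (j + k) * (u : ℂ) ^ (j + k)‖ ≤ B * (u / r) ^ k * (1 / 2) ^ j := by
    intro j
    rw [norm_mul, norm_pow, Complex.norm_real, Real.norm_of_nonneg hu.le]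
    calc ‖d (j + k)‖ * u ^ (j + k) = ‖d (j + k)‖ * r ^ (j + k) * (u / r) ^ (j + k) := by
          rw [mul_assoc, ← mul_pow, mul_div_cancel₀ _ hr.ne']
      _ ≤ B * (u / r) ^ (j + k) := by gcongr; exact hd _
      _ = B * (u / r) ^ k * (u / r) ^ j := by rw [pow_add]; ring
      _ ≤ _ := by gcongr
  have hs : HasSum (fun j : ℕ => B * (u / r) ^ k * (1 / 2 : ℝ) ^ j) (B * (u / r) ^ k * 2) :=
    hasSum_geometric_two.mul_left _
  exact (tsum_of_norm_bounded hs hterm).trans_eq (by ring)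

/-- Induction on `k`: once the lower coefficients tend to zero, the series divided by $u^k$ is the
`k`-th coefficient up to $O(u)$, uniformly along the filter. -/
theorem tendsto_coeff_zero_of_tendsto_powerSeries {d : ι → ℕ → ℂ} {B r : ℝ} (hr : 0 < r)
    (hd : ∀ᶠ s in l, ∀ k, ‖d s k‖ * r ^ k ≤ B)
    (h : ∀ u : ℝ, 0 < u → u < r → Tendsto (fun s => ∑' k, d s k * (u : ℂ) ^ k) l (𝓝 0)) (k : ℕ) :
    Tendsto (fun s => d s k) l (𝓝 0) := by
  induction k using Nat.strong_induction_on with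
  | _ k ih =>
    rw [tendsto_zero_iff_norm_tendsto_zero]
    rw [Metric.tendsto_nhds]
    intro ε hε
    have hB1 : 0 < |B| + 1 := by positivity
    -- Fixed before the limit is taken, so small that the tail beyond order `k` is at most
    -- $(\varepsilon/2)u^k$.
    obtain ⟨u, hu0, hur, hue⟩ : ∃ u : ℝ, 0 < u ∧ u ≤ r / 2 ∧
        2 * (|B| + 1) * u / r ^ (k + 1) ≤ ε / 2 := by
      refine ⟨min (r / 2) (ε / 2 * r ^ (k + 1) / (2 * (|B| + 1))), by positivity,
        min_le_left _ _, ?_⟩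
      rw [div_le_iff₀ (by positivity), ← le_div_iff₀' (by positivity)]
      exact min_le_right _ _
    have hlim : Tendsto (fun s => ‖(∑' k, d s k * (u : ℂ) ^ k)
        - ∑ j ∈ Finset.range k, d s j * (u : ℂ) ^ j‖) l (𝓝 0) := by
      rw [← norm_zero (E := ℂ)]
      refine Tendsto.norm ?_
      have := (h u hu0 (by linarith)).sub (tendsto_finsetSum (Finset.range k) fun j hj =>
        (ih j (Finset.mem_range.mp hj)).mul_const ((u : ℂ) ^ j))
      simpa using this
    filter_upwards [hd, (Metric.tendsto_nhds.mp hlim) (ε / 2 * u ^ k) (by positivity)]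
      with s hs hs2
    have hs' : ∀ k, ‖d s k‖ * r ^ k ≤ |B| + 1 := fun k =>
      (hs k).trans ((le_abs_self B).trans (by linarith))
    rw [dist_zero_right, norm_norm] at hs2 ⊢
    have hsum : Summable fun j => d s j * (u : ℂ) ^ j := by
      refine Summable.of_norm_bounded (g := fun j => (|B| + 1) * (1 / 2) ^ j)
        (summable_geometric_two.mul_left _) fun j => ?_
      rw [norm_mul, norm_pow, Complex.norm_real, Real.norm_of_nonneg hu0.le]
      calc ‖d s j‖ * u ^ j ≤ ‖d s j‖ * (r / 2) ^ j := by gcongr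
        _ = ‖d s j‖ * r ^ j * (1 / 2) ^ j := by rw [mul_assoc, ← mul_pow]; ring
        _ ≤ _ := by gcongr; exact hs' j
    have hsplit := hsum.sum_add_tsum_nat_add (k + 1)
    rw [Finset.sum_range_succ] at hsplit
    have htail := norm_tsum_shift_le hr hu0 hur hs' (k + 1)
    set T := ∑' j, d s (j + (k + 1)) * (u : ℂ) ^ (j + (k + 1))
    have heq : d s k * (u : ℂ) ^ k = ((∑' k, d s k * (u : ℂ) ^ k)
        - ∑ j ∈ Finset.range k, d s j * (u : ℂ) ^ j) - T := by
      rw [← hsplit]; ring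
    have hnorm : ‖d s k‖ * u ^ k < ε * u ^ k := by
      calc ‖d s k‖ * u ^ k = ‖d s k * (u : ℂ) ^ k‖ := by
            rw [norm_mul, norm_pow, Complex.norm_real, Real.norm_of_nonneg hu0.le]
        _ ≤ _ := heq ▸ norm_sub_le _ _
        _ < ε / 2 * u ^ k + 2 * (|B| + 1) * (u / r) ^ (k + 1) := by linarith
        _ = (ε / 2 + 2 * (|B| + 1) * u / r ^ (k + 1)) * u ^ k := by
            rw [div_pow]; ring
        _ ≤ (ε / 2 + ε / 2) * u ^ k := by gcongr
        _ = _ := by ring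
    exact lt_of_mul_lt_mul_right hnorm (by positivity)

theorem tendsto_coeff_of_tendsto_powerSeries {a : ι → ℕ → ℂ} {α : ℕ → ℂ} {B r : ℝ} (hr : 0 < r)
    (ha : ∀ᶠ s in l, ∀ k, ‖a s k‖ * r ^ k ≤ B) (hα : ∀ k, ‖α k‖ * r ^ k ≤ B)
    (h : ∀ u : ℝ, 0 < u → u < r →
      Tendsto (fun s => ∑' k, a s k * (u : ℂ) ^ k) l (𝓝 (∑' k, α k * (u : ℂ) ^ k))) (k : ℕ) :
    Tendsto (fun s => a s k) l (𝓝 (α k)) := by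
  have hsum : ∀ c : ℕ → ℂ, (∀ k, ‖c k‖ * r ^ k ≤ B) → ∀ u : ℝ, 0 < u → u < r →
      Summable fun j => c j * (u : ℂ) ^ j := by
    intro c hc u hu hur
    refine Summable.of_norm_bounded (g := fun j => B * (u / r) ^ j)
      ((summable_geometric_of_lt_one (by positivity) ((div_lt_one hr).mpr hur)).mul_left _)
      fun j => ?_
    rw [norm_mul, norm_pow, Complex.norm_real, Real.norm_of_nonneg hu.le]
    calc ‖c j‖ * u ^ j = ‖c j‖ * r ^ j * (u / r) ^ j := by
          rw [mul_assoc, ← mul_pow, mul_div_cancel₀ _ hr.ne']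
      _ ≤ _ := by gcongr; exact hc j
  have := tendsto_coeff_zero_of_tendsto_powerSeries (l := l) (d := fun s k => a s k - α k)
    (B := B + B) hr ?_ ?_ k
  · simpa using this.add_const (α k)
  · filter_upwards [ha] with s hs k
    calc _ ≤ (‖a s k‖ + ‖α k‖) * r ^ k := by gcongr; exact norm_sub_le _ _
      _ ≤ _ := by rw [add_mul]; exact add_le_add (hs k) (hα k)
  · intro u hu hur
    have h1 := (h u hu hur).sub_const (∑' k, α k * (u : ℂ) ^ k)
    rw [sub_self] at h1
    refine h1.congr' ?_
    filter_upwards [ha] with s hs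
    rw [← (hsum _ hs u hu hur).tsum_sub (hsum _ hα u hu hur)]
    simp only [sub_mul]

theorem tendsto_powerSeries_of_tendsto_coeff {a : ι → ℕ → ℂ} {α : ℕ → ℂ} {B R : ℝ}
    (ha : ∀ᶠ s in l, ∀ k, ‖a s k‖ * R ^ k ≤ B)
    (h : ∀ k, Tendsto (fun s => a s k) l (𝓝 (α k))) {z : ℂ} (hz : ‖z‖ < R) :
    Tendsto (fun s => ∑' k, a s k * z ^ k) l (𝓝 (∑' k, α k * z ^ k)) := by
  have hR : 0 < R := (norm_nonneg z).trans_lt hz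
  refine tendsto_tsum_of_dominated_convergence (bound := fun k => B * (‖z‖ / R) ^ k)
    ((summable_geometric_of_lt_one (by positivity) ((div_lt_one hR).mpr hz)).mul_left _)
    (fun k => (h k).mul_const _) ?_
  filter_upwards [ha] with s hs k
  rw [norm_mul, norm_pow]
  calc ‖a s k‖ * ‖z‖ ^ k = ‖a s k‖ * R ^ k * (‖z‖ / R) ^ k := by
        rw [mul_assoc, ← mul_pow, mul_div_cancel₀ _ hR.ne']
    _ ≤ _ := by gcongr; exact hs k

/-- Taylor coefficients at `0`. -/
noncomputable def taylorCoeff (F : ℂ → ℂ) (k : ℕ) : ℂ := (k.factorial : ℂ)⁻¹ * iteratedDeriv k F 0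

theorem hasSum_taylorCoeff {F : ℂ → ℂ} {R : ℝ} (hF : DifferentiableOn ℂ F (Metric.ball 0 R))
    {z : ℂ} (hz : ‖z‖ < R) : HasSum (fun k => taylorCoeff F k * z ^ k) (F z) := by
  have := Complex.hasSum_taylorSeries_on_ball hF (z := z) (by simpa using hz)
  convert! this using 2 with k
  simp only [taylorCoeff, sub_zero, smul_eq_mul]
  ring

theorem norm_taylorCoeff_mul_pow_le {F : ℂ → ℂ} {R R' B : ℝ} (hR : 0 < R) (hRR : R < R')
    (hF : DifferentiableOn ℂ F (Metric.ball 0 R')) (hB : ∀ z, ‖z‖ < R' → ‖F z‖ ≤ B) (k : ℕ) :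
    ‖taylorCoeff F k‖ * R ^ k ≤ B := by
  have h1 := Complex.norm_iteratedDeriv_le_of_forall_mem_sphere_norm_le k hR
    (f := F) (c := 0) (C := B) ?_ ?_
  · rw [taylorCoeff, norm_mul, norm_inv, Complex.norm_natCast]
    rw [le_div_iff₀ (by positivity)] at h1
    rw [mul_assoc, inv_mul_le_iff₀ (by positivity)]
    exact h1
  · refine DifferentiableOn.diffContOnCl ?_
    rw [closure_ball _ hR.ne']
    exact hF.mono (Metric.closedBall_subset_ball hRR)
  · intro z hz
    exact hB z (by rw [mem_sphere_zero_iff_norm.mp hz]; exact hRR)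

/-- Uniformly bounded holomorphic functions on a disc which converge on a real interval `(0, r)`
converge in the whole disc. -/
theorem tendsto_of_tendsto_on_real {F : ι → ℂ → ℂ} {F₀ : ℂ → ℂ} {B R r : ℝ} (hr : 0 < r)
    (hF : ∀ᶠ s in l, DifferentiableOn ℂ (F s) (Metric.ball 0 R))
    (hB : ∀ᶠ s in l, ∀ z, ‖z‖ < R → ‖F s z‖ ≤ B)
    (hF₀ : DifferentiableOn ℂ F₀ (Metric.ball 0 R)) (hB₀ : ∀ z, ‖z‖ < R → ‖F₀ z‖ ≤ B)
    (h : ∀ u : ℝ, 0 < u → u < r → Tendsto (fun s => F s u) l (𝓝 (F₀ u))) {z : ℂ} (hz : ‖z‖ < R) :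
    Tendsto (fun s => F s z) l (𝓝 (F₀ z)) := by
  -- Cauchy estimates are taken on the circle of radius `R'`, with room left for geometric decay at
  -- `z`.
  obtain ⟨R', hzR', hR'R⟩ := exists_between hz
  have hR' : 0 < R' := (norm_nonneg z).trans_lt hzR'
  have ha : ∀ᶠ s in l, ∀ k, ‖taylorCoeff (F s) k‖ * R' ^ k ≤ B := by
    filter_upwards [hF, hB] with s h1 h2 k
    exact norm_taylorCoeff_mul_pow_le hR' hR'R h1 h2 k
  have hα : ∀ k, ‖taylorCoeff F₀ k‖ * R' ^ k ≤ B := fun k =>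
    norm_taylorCoeff_mul_pow_le hR' hR'R hF₀ hB₀ k
  have hmin : 0 < min r R' := lt_min hr hR'
  have hle : ∀ c : ℂ, ∀ k : ℕ, ‖c‖ * R' ^ k ≤ B → ‖c‖ * (min r R') ^ k ≤ B := fun c k hc =>
    le_trans (by gcongr; exact min_le_right _ _) hc
  have hcoeff := tendsto_coeff_of_tendsto_powerSeries (l := l)
    (a := fun s => taylorCoeff (F s)) (α := taylorCoeff F₀) (B := B) hmin
    (by filter_upwards [ha] with s hs k using hle _ _ (hs k)) (fun k => hle _ _ (hα k)) ?_
  · have := tendsto_powerSeries_of_tendsto_coeff ha hcoeff hzR'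
    rw [(hasSum_taylorCoeff hF₀ hz).tsum_eq] at this
    refine this.congr' ?_
    filter_upwards [hF] with s hs
    exact (hasSum_taylorCoeff hs hz).tsum_eq
  · intro u hu hur
    have hu' : ‖(u : ℂ)‖ < R := by
      rw [Complex.norm_real, Real.norm_of_nonneg hu.le]
      exact (hur.trans_le (min_le_right _ _)).trans hR'R
    rw [(hasSum_taylorCoeff hF₀ hu').tsum_eq]
    refine (h u hu (hur.trans_le (min_le_left _ _))).congr' ?_
    filter_upwards [hF] with s hs
    exact (hasSum_taylorCoeff hs hu').tsum_eq.symm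

end PowerSeries

/-! ### Multiplication operators on $L^2(\mathbb R^n)$. -/

section MultiplicationOperators

variable {n : ℕ}

theorem coeFn_mulOp {g : Rn n → ℂ} (hg : MemLp g ∞ (volume : Measure (Rn n))) (φ : L2Rn n) :
    mulOp g hg φ =ᵐ[volume] fun x => g x * φ x := by
  have h1 : mulOp g hg φ = (ContinuousLinearMap.mul ℂ ℂ).holder 2 (hg.toLp g) φ := rfl
  rw [h1]
  filter_upwards [(ContinuousLinearMap.mul ℂ ℂ).coeFn_holder (r := 2) (hg.toLp g) φ, hg.coeFn_toLp]
    with x h2 h3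
  rw [h2, h3]
  rfl

theorem inner_mulOp_left {h : Rn n → ℝ} (hh : MemLp (fun x => (h x : ℂ)) ∞ volume)
    (φ ψ : L2Rn n) : ⟪mulOp _ hh φ, ψ⟫_ℂ = ⟪φ, mulOp _ hh ψ⟫_ℂ := by
  rw [L2.inner_def, L2.inner_def]
  refine integral_congr_ae ?_
  filter_upwards [coeFn_mulOp hh φ, coeFn_mulOp hh ψ] with x h1 h2
  rw [h1, h2]
  simp only [RCLike.inner_apply, map_mul, Complex.conj_ofReal]
  ring

theorem enorm_L2_sq (φ : L2Rn n) : ‖φ‖ₑ ^ 2 = ∫⁻ x, ‖φ x‖ₑ ^ 2 := by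
  have h := eLpNorm_nnreal_pow_eq_lintegral (f := φ) (μ := (volume : Measure (Rn n)))
    (p := 2) two_ne_zero
  rw [Lp.enorm_def]
  simpa using! h

theorem enorm_mulOp_sq {g : Rn n → ℂ} (hg : MemLp g ∞ (volume : Measure (Rn n))) (φ : L2Rn n) :
    ‖mulOp g hg φ‖ₑ ^ 2 = ∫⁻ x, ‖g x‖ₑ ^ 2 * ‖φ x‖ₑ ^ 2 := by
  rw [enorm_L2_sq]
  refine lintegral_congr_ae ?_
  filter_upwards [coeFn_mulOp hg φ] with x hx
  rw [hx, enorm_mul, mul_pow]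

theorem memLp_top_ofReal {h : Rn n → ℝ} (hm : Measurable h) {L : ℝ} (hL : ∀ x, |h x| ≤ L) :
    MemLp (fun x => (h x : ℂ)) ∞ (volume : Measure (Rn n)) :=
  memLp_top_of_bound (Complex.measurable_ofReal.comp hm).aestronglyMeasurable L
    (Eventually.of_forall fun x => by simpa using hL x)

end MultiplicationOperators

/-! ### Parseval's identity and basis independence of Hilbert-Schmidt norms. -/

section Parseval

variable {H : Type*} [NormedAddCommGroup H] [InnerProductSpace ℂ H] {ι κ : Type*}

theorem HilbertBasis.tsum_enorm_inner_sq (b : HilbertBasis ι ℂ H) (x : H) :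
    ∑' i, ‖⟪b i, x⟫_ℂ‖ₑ ^ 2 = ‖x‖ₑ ^ 2 := by
  have h1 : HasSum (fun i => ‖⟪b i, x⟫_ℂ‖ ^ 2) (‖x‖ ^ 2) := by
    have := Complex.hasSum_re (b.hasSum_inner_mul_inner x x)
    rw [inner_self_eq_norm_sq_to_K] at this
    have h2 : ((‖x‖ : ℂ) ^ 2).re = ‖x‖ ^ 2 := by norm_cast
    erw [h2] at this
    convert! this using 2 with i
    rw [← inner_conj_symm x (b i), ← Complex.normSq_eq_conj_mul_self, Complex.ofReal_re,
      Complex.normSq_eq_norm_sq]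
  simp_rw [← ofReal_norm, ← ENNReal.ofReal_pow (norm_nonneg _)]
  rw [← ENNReal.ofReal_tsum_of_nonneg (fun _ => by positivity) h1.summable, h1.tsum_eq]

/-- Both sides are the double sum of $|\langle b_k,Ae_i\rangle|^2$; with values in $[0,\infty]$ the
exchange needs no summability. -/
theorem tsum_enorm_apply_sq_comm [CompleteSpace H] (e : HilbertBasis ι ℂ H)
    (b : HilbertBasis κ ℂ H)
    (A A' : H →L[ℂ] H) (hA : ∀ x y, ⟪A x, y⟫_ℂ = ⟪x, A' y⟫_ℂ) :
    ∑' i, ‖A (e i)‖ₑ ^ 2 = ∑' k, ‖A' (b k)‖ₑ ^ 2 := by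
  simp_rw [← b.tsum_enorm_inner_sq (A (e _)), ← e.tsum_enorm_inner_sq (A' (b _))]
  rw [ENNReal.tsum_comm]
  refine tsum_congr fun k => tsum_congr fun i => ?_
  rw [← hA, ← inner_conj_symm, ← ofReal_norm, ← ofReal_norm, RCLike.norm_conj]

end Parseval

/-! ### Bases diagonalising multiplication by a finitely-valued function. -/

section AdaptedBasis

variable {n : ℕ}

/-- For a function `f` with finitely many values there is a Hilbert basis of `L²(ℝⁿ)` which
diagonalises the multiplication by every function of `f`. -/
theorem exists_hilbertBasis_adapted {f : Rn n → ℝ} (hf : Measurable f)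
    (hfin : (Set.range f).Finite) :
    ∃ (ι : Type) (e : HilbertBasis ι ℂ (L2Rn n)) (φ : ι → ℝ), (∀ i, φ i ∈ Set.range f) ∧
      ∀ (g : ℝ → ℝ) (hg : MemLp (fun x => ((g (f x) : ℝ) : ℂ)) ∞ volume) (i : ι),
        mulOp _ hg (e i) = ((g (φ i) : ℝ) : ℂ) • e i := by
  have hind : ∀ c : ℝ, MemLp (fun x => (((f ⁻¹' {c}).indicator 1 x : ℝ) : ℂ)) ∞
      (volume : Measure (Rn n)) := fun c =>
    memLp_top_ofReal (measurable_one.indicator (hf (measurableSet_singleton c))) (L := 1)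
      fun x => by by_cases h : x ∈ f ⁻¹' {c} <;> simp [h]
  -- The orthogonal projections onto functions supported on a level set of `f`. Bases of their
  -- ranges, some possibly empty, are glued together.
  let p : ℝ → (L2Rn n →L[ℂ] L2Rn n) := fun c => mulOp _ (hind c)
  let V : ℝ → Submodule ℂ (L2Rn n) := fun c => (p c - ContinuousLinearMap.id ℂ (L2Rn n)).ker
  have hV : ∀ c v, v ∈ V c ↔ p c v = v := fun c v => by
    simp [V, sub_eq_zero]
  have hcomplete : ∀ c, CompleteSpace (V c) := fun c =>
    (ContinuousLinearMap.isClosed_ker _).completeSpace_coe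
  have hp : ∀ c v, p c v =ᵐ[volume] fun x => (((f ⁻¹' {c}).indicator 1 x : ℝ) : ℂ) * v x :=
    fun c v => coeFn_mulOp _ v
  have hpp : ∀ c v, p c (p c v) = p c v := fun c v => by
    refine Lp.ext ?_
    filter_upwards [hp c (p c v), hp c v] with x h1 h2
    rw [h1, h2]
    by_cases h : x ∈ f ⁻¹' {c} <;> simp [h]
  have hpq : ∀ c d v, c ≠ d → p c (p d v) = 0 := fun c d v hcd => by
    refine Lp.ext ?_
    filter_upwards [hp c (p d v), hp d v, Lp.coeFn_zero ℂ 2 (volume : Measure (Rn n))]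
      with x h1 h2 h3
    rw [h1, h2, h3]
    by_cases h : f x = c
    · have : f x ≠ d := fun h' => hcd (h ▸ h')
      simp [this]
    · simp [h]
  choose w b hb using fun c => exists_hilbertBasis ℂ (V c)
  let ι : Type := Σ c : Set.range f, w c
  let v : ι → L2Rn n := fun i => ((i.2 : V i.1) : L2Rn n)
  have hmem : ∀ i : ι, p i.1 (v i) = v i := fun i => (hV _ _).mp (i.2 : V i.1).2
  have hv : Orthonormal ℂ v := by
    constructor
    · rintro ⟨c, i⟩
      have := (b c).orthonormal.1 i
      rw [hb] at this
      exact this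
    · rintro ⟨c, i⟩ ⟨d, j⟩ hij
      by_cases hcd : c = d
      · subst hcd
        have := (b c).orthonormal.2 (i := i) (j := j) fun h => hij (by rw [h])
        rw [hb] at this
        exact this
      · rw [← hmem ⟨c, i⟩, ← hmem ⟨d, j⟩, inner_mulOp_left]
        change ⟪v ⟨c, i⟩, p c (p d _)⟫_ℂ = 0
        rw [hpq _ _ _ fun h => hcd (Subtype.ext h), inner_zero_right]
  -- A vector orthogonal to the family is killed by each of the finitely many projections, hence
  -- vanishes almost everywhere on every level set.
  have hbot : (Submodule.span ℂ (Set.range v))ᗮ = ⊥ := by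
    rw [Submodule.eq_bot_iff]
    intro x hx
    have hx' : ∀ i, ⟪v i, x⟫_ℂ = 0 := fun i =>
      (Submodule.mem_orthogonal _ _).mp hx _ (Submodule.subset_span ⟨i, rfl⟩)
    have hpx : ∀ c : Set.range f, p c x = 0 := by
      intro c
      let y : V c := ⟨p c x, (hV _ _).mpr (hpp _ _)⟩
      have hy : ∀ i, ⟪b c i, y⟫_ℂ = 0 := fun i => by
        have h1 : ⟪v ⟨c, i⟩, p c x⟫_ℂ = 0 := by
          rw [← inner_mulOp_left (h := (f ⁻¹' {(c : ℝ)}).indicator 1) (hind c)]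
          change ⟪p c (v ⟨c, i⟩), x⟫_ℂ = 0
          rw [hmem ⟨c, i⟩]; exact hx' _
        rw [hb]; exact h1
      have hy0 : y = 0 := by
        have := (b c).tsum_enorm_inner_sq y
        simp only [hy, enorm_zero, ne_eq, OfNat.ofNat_ne_zero, not_false_eq_true, zero_pow,
          tsum_zero] at this
        exact enorm_eq_zero.mp (pow_eq_zero_iff two_ne_zero |>.mp this.symm)
      exact congrArg Subtype.val hy0
    refine Lp.ext ?_
    have : ∀ᵐ z ∂(volume : Measure (Rn n)), ∀ c ∈ Set.range f,
        (((f ⁻¹' {c}).indicator 1 z : ℝ) : ℂ) * x z = 0 := by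
      rw [ae_ball_iff hfin.countable]
      intro c hc
      filter_upwards [hp c x, Lp.coeFn_zero ℂ 2 (volume : Measure (Rn n))] with z h1 h2
      rw [← h1, hpx ⟨c, hc⟩, h2]; rfl
    filter_upwards [this, Lp.coeFn_zero ℂ 2 (volume : Measure (Rn n))] with z h1 h2
    have := h1 (f z) ⟨z, rfl⟩
    rw [h2]
    simpa using this
  refine ⟨ι, HilbertBasis.mkOfOrthogonalEqBot hv hbot, fun i => i.1, fun i => i.1.2, ?_⟩
  intro g hg i
  rw [HilbertBasis.coe_mkOfOrthogonalEqBot]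
  refine Lp.ext ?_
  have h0 := hp i.1 (v i)
  rw [hmem i] at h0
  filter_upwards [coeFn_mulOp hg (v i), h0, Lp.coeFn_smul ((g i.1 : ℝ) : ℂ) (v i)] with x h1 h2 h3
  rw [h1, h3, Pi.smul_apply, h2]
  by_cases h : f x = i.1 <;> simp [h]

end AdaptedBasis

/-! ### The Hilbert-Schmidt square root and the intensity measure. -/

section TraceClass

theorem exists_sqrt_of_traceClass {H : Type} [NormedAddCommGroup H]
    [InnerProductSpace ℂ H] [CompleteSpace H] {K : H →L[ℂ] H} (hK : 0 ≤ K) (hT : IsTraceClass K) :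
    ∃ T : H →L[ℂ] H, (∀ x y, ⟪T x, y⟫_ℂ = ⟪x, T y⟫_ℂ) ∧ (∀ x, T (T x) = K x) ∧
      ∃ (κ : Type) (b : HilbertBasis κ ℂ (H)), ∑' k, ‖T (b k)‖ₑ ^ 2 ≠ ∞ := by
  obtain ⟨w, b, -⟩ := exists_hilbertBasis ℂ (H)
  have hsa : IsSelfAdjoint (CFC.sqrt K) := (CFC.sqrt_nonneg K).isSelfAdjoint
  have hsymm : ∀ x y, ⟪CFC.sqrt K x, y⟫_ℂ = ⟪x, CFC.sqrt K y⟫_ℂ := fun x y => by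
    conv_lhs => rw [← hsa.adjoint_eq, ContinuousLinearMap.adjoint_inner_left]
  have hTT : ∀ x, CFC.sqrt K (CFC.sqrt K x) = K x := fun x => by
    conv_rhs => rw [← CFC.sqrt_mul_sqrt_self K hK]
    rfl
  refine ⟨CFC.sqrt K, hsymm, hTT, w, b, ?_⟩
  have h := hT w b
  rw [CFC.abs_of_nonneg K hK] at h
  have h2 : ∀ k, (⟪b k, K (b k)⟫_ℂ).re = ‖CFC.sqrt K (b k)‖ ^ 2 := fun k => by
    rw [← hTT, ← hsymm, inner_self_eq_norm_sq_to_K]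
    norm_cast
  simp_rw [h2] at h
  have h3 : ∀ k, ‖CFC.sqrt K (b k)‖ₑ ^ 2 = ENNReal.ofReal (‖CFC.sqrt K (b k)‖ ^ 2) := fun k => by
    rw [ENNReal.ofReal_pow (norm_nonneg _), ofReal_norm]
  simp_rw [h3]
  rw [← ENNReal.ofReal_tsum_of_nonneg (fun _ => by positivity) h]
  exact ENNReal.ofReal_ne_top

variable {n : ℕ}

/-- For a nonnegative trace-class `K = T²`, the measure with density `K(x, x)` computes the
Hilbert-Schmidt norm of `T h`. -/
theorem exists_intensity {K : L2Rn n →L[ℂ] L2Rn n} (hK : 0 ≤ K) (hT : IsTraceClass K) :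
    ∃ (T : L2Rn n →L[ℂ] L2Rn n) (ν : Measure (Rn n)), IsFiniteMeasure ν ∧ ν ≪ volume ∧
      (∀ x y, ⟪T x, T y⟫_ℂ = ⟪x, K y⟫_ℂ) ∧
      ∀ (ι : Type) (e : HilbertBasis ι ℂ (L2Rn n)),
        ∑' i, ‖T (e i)‖ₑ ^ 2 = ν Set.univ ∧
        ∀ (h : Rn n → ℝ) (hh : MemLp (fun x => (h x : ℂ)) ∞ volume), Measurable h →
          ∑' i, ‖T (mulOp _ hh (e i))‖ₑ ^ 2 = ∫⁻ x, ‖h x‖ₑ ^ 2 ∂ν := by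
  obtain ⟨T, hsymm, hTT, κ, b, hb⟩ := exists_sqrt_of_traceClass hK hT
  -- The density is $K(x,x)=\sum_k|Tb_k(x)|^2$; no kernel has to be chosen.
  let ν : Measure (Rn n) := Measure.sum fun k => volume.withDensity fun x => ‖T (b k) x‖ₑ ^ 2
  have hmeas : ∀ k, AEMeasurable (fun x => ‖T (b k) x‖ₑ ^ 2) volume := fun k =>
    ((Lp.aestronglyMeasurable (T (b k))).enorm).pow_const 2
  have huniv : ν Set.univ = ∑' k, ‖T (b k)‖ₑ ^ 2 := by
    simp only [ν, Measure.sum_apply _ MeasurableSet.univ, withDensity_apply _ MeasurableSet.univ,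
      Measure.restrict_univ, enorm_L2_sq]
  refine ⟨T, ν, ⟨?_⟩, ?_, fun x y => by rw [hsymm, hTT], fun ι e => ⟨?_, fun h hh hm => ?_⟩⟩
  · rw [huniv]; exact hb.lt_top
  · refine Measure.AbsolutelyContinuous.mk fun s hs hs0 => ?_
    simp only [ν, Measure.sum_apply _ hs]
    simp [withDensity_absolutelyContinuous _ _ hs0]
  · rw [huniv]; exact tsum_enorm_apply_sq_comm e b T T hsymm
  -- Passing to the adjoint puts multiplication by `h` outside, where the sum of $\|hTb_k\|^2$ is an
  -- integral against `ν`.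
  · have h1 := tsum_enorm_apply_sq_comm e b (T * mulOp _ hh) (mulOp _ hh * T) fun x y => by
      rw [mul_apply_eq_comp, mul_apply_eq_comp, hsymm, inner_mulOp_left]
    simp only [mul_apply_eq_comp] at h1
    rw [h1]
    simp only [ν, lintegral_sum_measure]
    refine tsum_congr fun k => ?_
    rw [enorm_mulOp_sq, lintegral_withDensity_eq_lintegral_mul₀ (hmeas k)
      (hm.enorm.pow_const 2).aemeasurable]
    refine lintegral_congr fun x => ?_
    simp only [Pi.mul_apply]
    rw [mul_comm]
    congr 2
    rw [← ofReal_norm, ← ofReal_norm, Complex.norm_real]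

end TraceClass

/-! ### Estimates of finite sections, uniform in the basis and the section. -/

section FredholmEstimates

variable {n : ℕ} {ι : Type}

/-- The finite section of `det (1 + A)` on the basis vectors with index in `s`. -/
noncomputable def sectionDet (A : L2Rn n →L[ℂ] L2Rn n) (e : HilbertBasis ι ℂ (L2Rn n))
    (s : Finset ι) : ℂ := by
  classical exact Matrix.det (1 + Matrix.of fun i j : s => ⟪e i, A (e j)⟫_ℂ)

theorem HasFredholmDet.tendsto_sectionDet {A : L2Rn n →L[ℂ] L2Rn n} {d : ℂ}
    (h : HasFredholmDet A d) (e : HilbertBasis ι ℂ (L2Rn n)) :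
    Tendsto (sectionDet A e) atTop (𝓝 d) := h ι e

theorem sectionDet_zero (e : HilbertBasis ι ℂ (L2Rn n)) (s : Finset ι) : sectionDet 0 e s = 1 := by
  classical
  have : (Matrix.of fun i j : s => ⟪e i, (0 : L2Rn n →L[ℂ] L2Rn n) (e j)⟫_ℂ) = 0 := by
    ext i j; simp
  rw [sectionDet, this, add_zero, Matrix.det_one]

theorem sum_norm_sq_le_of_tsum_enorm_sq_le {H : Type*} [NormedAddCommGroup H] {v : ι → H} {a : ℝ}
    (h : ∑' i, ‖v i‖ₑ ^ 2 ≤ ENNReal.ofReal (a ^ 2)) (s : Finset ι) :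
    ∑ i : s, ‖v i‖ ^ 2 ≤ a ^ 2 := by
  have h1 : ∑ i ∈ s, ‖v i‖ₑ ^ 2 ≤ ENNReal.ofReal (a ^ 2) := (ENNReal.sum_le_tsum s).trans h
  have h2 : ∑ i ∈ s, ‖v i‖ₑ ^ 2 = ENNReal.ofReal (∑ i ∈ s, ‖v i‖ ^ 2) := by
    rw [ENNReal.ofReal_sum_of_nonneg fun i _ => by positivity]
    refine Finset.sum_congr rfl fun i _ => ?_
    rw [ENNReal.ofReal_pow (norm_nonneg _), ofReal_norm]
  rw [h2, ENNReal.ofReal_le_ofReal_iff (by positivity)] at h1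
  rwa [Finset.sum_coe_sort s fun i => ‖v i‖ ^ 2]

/-- The entries are inner products of $-T(he_i)$, or of $\bar c_iTe_i$, with $Te_j$; the squared
norms of these vectors sum to at most $L^2\nu(\mathbb R^n)$ and $\nu(\mathbb R^n)$. The Lipschitz
bound serves to approximate test functions, the bound with complex factors to control polynomials on
a disc. -/
theorem exists_fredholm_estimates {K : L2Rn n →L[ℂ] L2Rn n} (hK : 0 ≤ K) (hT : IsTraceClass K) :
    ∃ ν : Measure (Rn n), IsFiniteMeasure ν ∧ ν ≪ volume ∧
      (∀ L : ℝ, 0 ≤ L → ∃ c : ℝ, 0 ≤ c ∧ ∀ (ι : Type) (e : HilbertBasis ι ℂ (L2Rn n))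
        (s : Finset ι) (h h' : Rn n → ℝ) (hh : MemLp (fun x => (h x : ℂ)) ∞ volume)
        (hh' : MemLp (fun x => (h' x : ℂ)) ∞ volume) (δ : ℝ), Measurable h → Measurable h' →
        (∀ x, |h x| ≤ L) → 0 < δ → δ < 1 →
        ∫⁻ x, ‖h' x - h x‖ₑ ^ 2 ∂ν ≤ ENNReal.ofReal (δ ^ 2) →
        ‖sectionDet (-(mulOp _ hh' * K)) e s - sectionDet (-(mulOp _ hh * K)) e s‖ ≤ c * δ) ∧
      (∀ L : ℝ, 0 ≤ L → ∃ B : ℝ, ∀ (ι : Type) (e : HilbertBasis ι ℂ (L2Rn n))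
        (s : Finset ι) [DecidableEq s] (c : ι → ℂ), (∀ i, ‖c i‖ ≤ L) →
        ‖Matrix.det (1 + Matrix.of fun i j : s => c i * ⟪e i, K (e j)⟫_ℂ)‖ ≤ B) := by
  classical
  obtain ⟨T, ν, hν, hac, hTT, hHS⟩ := exists_intensity hK hT
  set b : ℝ := √(ν.real Set.univ) with hb
  have hb0 : 0 ≤ b := Real.sqrt_nonneg _
  have hbν : ENNReal.ofReal (b ^ 2) = ν Set.univ := by
    rw [hb, Real.sq_sqrt measureReal_nonneg, ofReal_measureReal]
  refine ⟨ν, hν, hac, fun L hL => ?_, fun L hL => ?_⟩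
  · refine ⟨2 * Real.exp ((L * b + 1) * b + ((L * b + 1) * b) ^ 2 / 2), ?_, fun ι e s h h' hh hh' δ hm hm' hhL hδ hδ1 hdiff => ?_⟩
    rotate_left
    · have hmat : ∀ (k : Rn n → ℝ) (hk : MemLp (fun x => (k x : ℂ)) ∞ volume),
          sectionDet (-(mulOp _ hk * K)) e s = Matrix.det (1 + Matrix.of fun i j : s =>
            ⟪-T (mulOp _ hk (e i)), T (e j)⟫_ℂ) := fun k hk => by
        rw [sectionDet]
        congr! 3
        funext i j
        rw [neg_apply, mul_apply_eq_comp, inner_neg_right, inner_neg_left, hTT,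
          inner_mulOp_left]
      rw [hmat, hmat]
      have hLb : 0 ≤ L * b := by positivity
      refine norm_det_one_add_inner_sub_le (a := L * b) (b := b) _ _ _ hLb hb0 hδ hδ1 ?_ ?_ ?_
      · refine sum_norm_sq_le_of_tsum_enorm_sq_le (v := fun i => -T (mulOp _ hh (e i))) ?_ s
        simp only [enorm_neg]
        rw [((hHS ι e).2 h hh hm)]
        calc ∫⁻ x, ‖h x‖ₑ ^ 2 ∂ν ≤ ∫⁻ x, ENNReal.ofReal (L ^ 2) ∂ν := by
              refine lintegral_mono fun x => ?_
              rw [← ofReal_norm, ← ENNReal.ofReal_pow (norm_nonneg _)]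
              exact ENNReal.ofReal_le_ofReal (pow_le_pow_left₀ (norm_nonneg _) (hhL x) 2)
          _ = _ := by
              rw [lintegral_const, ← hbν, ← ENNReal.ofReal_mul (by positivity), mul_pow]
      · refine sum_norm_sq_le_of_tsum_enorm_sq_le (v := fun i => T (e i)) ?_ s
        rw [(hHS ι e).1, hbν]
      · have hsub : MemLp (fun x => ((h' x - h x : ℝ) : ℂ)) ∞ (volume : Measure (Rn n)) := by
          simpa using! hh'.sub hh
        refine sum_norm_sq_le_of_tsum_enorm_sq_le
          (v := fun i => -T (mulOp _ hh' (e i)) - -T (mulOp _ hh (e i))) ?_ s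
        have : ∀ i, ‖-T (mulOp _ hh' (e i)) - -T (mulOp _ hh (e i))‖ₑ
            = ‖T (mulOp _ hsub (e i))‖ₑ := fun i => by
          rw [neg_sub_neg, ← enorm_neg, neg_sub, ← map_sub]
          congr 2
          refine Lp.ext ?_
          filter_upwards [Lp.coeFn_sub (mulOp _ hh' (e i)) (mulOp _ hh (e i)),
            coeFn_mulOp hh' (e i), coeFn_mulOp hh (e i), coeFn_mulOp hsub (e i)] with x h1 h2 h3 h4
          rw [h1, Pi.sub_apply, h2, h3, h4]
          push_cast; ring
        simp only [this]
        rw [(hHS ι e).2 _ hsub (hm'.sub hm)]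
        exact hdiff
    · positivity
  · refine ⟨Real.exp (L * b * b + (L * b * b) ^ 2 / 2), fun ι e s _ c hc => ?_⟩
    · have hmat : (Matrix.of fun i j : s => c i * ⟪e i, K (e j)⟫_ℂ) = Matrix.of fun i j : s =>
          ⟪(starRingEnd ℂ) (c i) • T (e i), T (e j)⟫_ℂ := by
        ext i j
        rw [Matrix.of_apply, Matrix.of_apply, inner_smul_left, Complex.conj_conj, hTT]
      rw [hmat]
      have hy : ∑ i : s, ‖T (e i)‖ ^ 2 ≤ b ^ 2 :=
        sum_norm_sq_le_of_tsum_enorm_sq_le (v := fun i => T (e i)) 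
          (by rw [(hHS ι e).1, hbν]) s
      refine norm_det_one_add_inner_le (a := L * b) (b := b) _ _ (by positivity) hb0 ?_ hy
      calc _ ≤ ∑ i : s, L ^ 2 * ‖T (e i)‖ ^ 2 := by
            refine Finset.sum_le_sum fun i _ => ?_
            rw [norm_smul, RCLike.norm_conj, mul_pow]
            gcongr
            exact hc i
        _ ≤ _ := by rw [← Finset.mul_sum, mul_pow]; gcongr

/-- In an adapted basis the finite sections are finite determinants with a diagonal factor. -/
theorem sectionDet_eq_of_eigenbasis {K : L2Rn n →L[ℂ] L2Rn n} {h : Rn n → ℝ}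
    (hh : MemLp (fun x => (h x : ℂ)) ∞ volume) (e : HilbertBasis ι ℂ (L2Rn n)) {c : ι → ℝ}
    (he : ∀ i, mulOp _ hh (e i) = (c i : ℂ) • e i) (s : Finset ι) [DecidableEq s] :
    sectionDet (-(mulOp _ hh * K)) e s
      = Matrix.det (1 + Matrix.of fun i j : s => -(c i : ℂ) * ⟪e i, K (e j)⟫_ℂ) := by
  classical
  have : (Matrix.of fun i j : s => ⟪e i, (-(mulOp _ hh * K)) (e j)⟫_ℂ)
      = Matrix.of fun i j : s => -(c i : ℂ) * ⟪e i, K (e j)⟫_ℂ := by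
    ext i j
    rw [Matrix.of_apply, Matrix.of_apply, neg_apply, mul_apply_eq_comp, inner_neg_right,
      ← inner_mulOp_left, he, inner_smul_left, Complex.conj_ofReal, neg_mul]
  rw [sectionDet, this]
  congr!

open scoped Matrix ComplexOrder in
theorem posSemidef_compression {K : L2Rn n →L[ℂ] L2Rn n} (hK : 0 ≤ K)
    (e : HilbertBasis ι ℂ (L2Rn n)) (s : Finset ι) :
    (Matrix.of fun i j : s => ⟪e i, K (e j)⟫_ℂ).PosSemidef := by
  have hpos : K.IsPositive := (ContinuousLinearMap.nonneg_iff_isPositive K).mp hK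
  refine Matrix.PosSemidef.of_dotProduct_mulVec_nonneg ?_ fun x => ?_
  · ext i j
    simp only [Matrix.conjTranspose_apply, Matrix.of_apply]
    rw [← hpos.isSelfAdjoint.adjoint_eq, ContinuousLinearMap.adjoint_inner_right,
      hpos.isSelfAdjoint.adjoint_eq]
    exact inner_conj_symm _ _
  · have h1 : star x ⬝ᵥ ((Matrix.of fun i j : s => ⟪e i, K (e j)⟫_ℂ) *ᵥ x)
        = ⟪∑ i : s, x i • e i, K (∑ j : s, x j • e j)⟫_ℂ := by
      simp only [map_sum, map_smul, sum_inner, inner_sum, inner_smul_left, inner_smul_right,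
        dotProduct, Matrix.mulVec, Matrix.of_apply, Finset.mul_sum, Pi.star_apply]
      rw [Finset.sum_comm]
      refine Finset.sum_congr rfl fun i _ => Finset.sum_congr rfl fun j _ => ?_
      rw [show star (x j) = (starRingEnd ℂ) (x j) from rfl]
      ring
    rw [h1]
    exact hpos.inner_nonneg_right _

open scoped Matrix ComplexOrder in
theorem posSemidef_one_sub_compression {K : L2Rn n →L[ℂ] L2Rn n} (hK : K ≤ 1)
    (e : HilbertBasis ι ℂ (L2Rn n)) (s : Finset ι) [DecidableEq s] :
    (1 - Matrix.of fun i j : s => ⟪e i, K (e j)⟫_ℂ).PosSemidef := by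
  have := posSemidef_compression (sub_nonneg.mpr hK) e s
  convert this using 1
  ext i j
  rw [Matrix.sub_apply, Matrix.of_apply, Matrix.of_apply, sub_apply, inner_sub_right,
    one_apply_eq_self]
  congr 1
  by_cases h : i = j
  · subst h
    rw [Matrix.one_apply_eq, inner_self_eq_norm_sq_to_K, e.orthonormal.1]
    simp
  · rw [Matrix.one_apply_ne h, e.orthonormal.2 fun h' => h (Subtype.ext h')]

end FredholmEstimates

/-! ### Local finiteness and measurability of linear statistics. -/

section PointProcess

variable {n : ℕ}

theorem sum_dirac_isCompact_lt_top {Λ : Set (Rn n)} (hΛ : ∀ x, ¬ AccPt x (𝓟 Λ)) {C : Set (Rn n)}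
    (hC : IsCompact C) : (Measure.sum fun x : Λ => Measure.dirac (x : Rn n)) C < ∞ := by
  have hfin : (Λ ∩ C).Finite := by
    by_contra h
    obtain ⟨x, -, hx⟩ := Set.Infinite.exists_accPt_of_subset_isCompact h hC Set.inter_subset_right
    exact hΛ x (hx.mono (principal_mono.mpr Set.inter_subset_left))
  have hfin' : {x : Λ | (x : Rn n) ∈ C}.Finite := by
    refine Set.Finite.of_finite_image (f := Subtype.val) (hfin.subset ?_)
      Subtype.val_injective.injOn
    rintro _ ⟨x, hx, rfl⟩
    exact ⟨x.2, hx⟩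
  rw [Measure.sum_apply _ hC.measurableSet, tsum_eq_sum (s := hfin'.toFinset)]
  · refine ENNReal.sum_lt_top.mpr fun x _ => ?_
    exact measure_lt_top _ _
  · intro x hx
    rw [Measure.dirac_apply' _ hC.measurableSet, Set.indicator_of_notMem]
    simpa using hx

theorem sum_dirac_univ (Λ : Set (Rn n)) :
    (Measure.sum fun x : Λ => Measure.dirac (x : Rn n)) Set.univ = (ENat.card Λ : ℝ≥0∞) := by
  rw [Measure.sum_apply _ MeasurableSet.univ]
  simp [ENNReal.tsum_one]

variable {Ω : Type*} [MeasurableSpace Ω] {P : Measure Ω} {Ξ : Ω → Measure (Rn n)}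

omit [MeasurableSpace Ω] in
theorem linStat_const_mul (c : ℝ) (f : Rn n → ℝ) (ω : Ω) :
    linStat Ξ (fun x => c * f x) ω = c * linStat Ξ f ω := integral_const_mul _ _

omit [MeasurableSpace Ω] in
theorem linStat_eq_toReal {g : Rn n → ℝ} (hg : Measurable g) (hg0 : ∀ x, 0 ≤ g x) (ω : Ω) :
    linStat Ξ g ω = (∫⁻ x, ENNReal.ofReal (g x) ∂Ξ ω).toReal :=
  integral_eq_lintegral_of_nonneg_ae (ae_of_all _ hg0) hg.aestronglyMeasurable

omit [MeasurableSpace Ω] in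
theorem linStat_nonneg {g : Rn n → ℝ} (hg0 : ∀ x, 0 ≤ g x) (ω : Ω) : 0 ≤ linStat Ξ g ω :=
  integral_nonneg hg0

theorem measurable_linStat_of_nonneg (hΞ : Measurable Ξ) {g : Rn n → ℝ} (hg : Measurable g)
    (hg0 : ∀ x, 0 ≤ g x) : Measurable (linStat Ξ g) := by
  rw [show linStat Ξ g = fun ω => (∫⁻ x, ENNReal.ofReal (g x) ∂Ξ ω).toReal from
    funext (linStat_eq_toReal hg hg0)]
  exact ((Measure.measurable_lintegral hg.ennreal_ofReal).comp hΞ).ennreal_toReal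

theorem IsPointProcess.ae_isCompact_lt_top (h : IsPointProcess P Ξ) :
    ∀ᵐ ω ∂P, ∀ C, IsCompact C → Ξ ω C < ∞ := by
  filter_upwards [h.ae_eq_sum_dirac] with ω hω C hC
  obtain ⟨Λ, hΛ, hΞ⟩ := hω
  rw [hΞ]
  exact sum_dirac_isCompact_lt_top hΛ hC

/-- Local finiteness excludes, almost surely, the default value $0$ of the integral of a
nonintegrable function. -/
theorem IsPointProcess.ae_ofReal_linStat (h : IsPointProcess P Ξ) {g : Rn n → ℝ}
    (hg : Continuous g) (hgc : HasCompactSupport g) (hg0 : ∀ x, 0 ≤ g x) :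
    ∀ᵐ ω ∂P, Integrable g (Ξ ω) ∧
      ENNReal.ofReal (linStat Ξ g ω) = ∫⁻ x, ENNReal.ofReal (g x) ∂Ξ ω := by
  filter_upwards [h.ae_isCompact_lt_top] with ω hω
  have : IsFiniteMeasureOnCompacts (Ξ ω) := ⟨fun C hC => hω C hC⟩
  have hi : Integrable g (Ξ ω) := hg.integrable_of_hasCompactSupport hgc
  exact ⟨hi, ofReal_integral_eq_lintegral_ofReal hi (ae_of_all _ hg0)⟩

end PointProcess

/-! ### The mean measure is finite and absolutely continuous. -/

section MeanMeasure

variable {n : ℕ} {Ω : Type*} [MeasurableSpace Ω] {P : Measure Ω} [IsProbabilityMeasure P]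
  {Ξ : Ω → Measure (Rn n)} {K : L2Rn n →L[ℂ] L2Rn n}

omit [IsProbabilityMeasure P] in
theorem IsDeterminantal.measurable (h : IsDeterminantal P Ξ K) : Measurable Ξ :=
  (IsDeterminantal.isPointProcess h).measurable

omit [IsProbabilityMeasure P] in
theorem IsDeterminantal.ae_eq_sum_dirac (h : IsDeterminantal P Ξ K) :
    ∀ᵐ ω ∂P, ∃ Λ : Set (Rn n), (∀ x, ¬ AccPt x (𝓟 Λ)) ∧
      Ξ ω = Measure.sum fun x : Λ => Measure.dirac (x : Rn n) :=
  (IsDeterminantal.isPointProcess h).ae_eq_sum_dirac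

theorem mulOp_zero (h : MemLp (fun _ : Rn n => ((0 : ℝ) : ℂ)) ∞ volume) : mulOp _ h = 0 := by
  ext1 φ
  refine Lp.ext ?_
  filter_upwards [coeFn_mulOp h φ, Lp.coeFn_zero ℂ 2 (volume : Measure (Rn n))] with x h1 h2
  rw [h1, zero_apply, h2]
  simp

theorem one_sub_exp_neg_nonneg_le {x : ℝ} (hx : 0 ≤ x) :
    0 ≤ 1 - Real.exp (-x) ∧ 1 - Real.exp (-x) ≤ x ∧ 1 - Real.exp (-x) ≤ 1 := by
  have h1 := Real.add_one_le_exp (-x)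
  have h2 := Real.exp_pos (-x)
  have h3 : Real.exp (-x) ≤ 1 := Real.exp_le_one_iff.mpr (by linarith)
  exact ⟨by linarith, by linarith, by linarith⟩

theorem tendsto_one_sub_exp_div (x : ℝ) {ε : ℕ → ℝ} (h0 : ∀ k, 0 < ε k)
    (hε : Tendsto ε atTop (𝓝 0)) :
    Tendsto (fun k => (1 - Real.exp (-(ε k * x))) / ε k) atTop (𝓝 x) := by
  have h1 : HasDerivAt (fun t : ℝ => 1 - Real.exp (-(t * x))) x 0 := by
    have := (((hasDerivAt_id (0 : ℝ)).mul_const x).neg.exp).const_sub 1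
    simpa using! this
  have h2 := h1.tendsto_slope_zero.comp (tendsto_nhdsWithin_iff.mpr
    ⟨hε, Eventually.of_forall fun k => (h0 k).ne'⟩)
  refine h2.congr fun k => ?_
  simp [div_eq_inv_mul]

/-- With $X=\Xi(g)$, the Lipschitz bound at $h=0$ gives $\mathbb E[1-e^{-\varepsilon X}]\le
c\varepsilon\gamma$, because $1-e^{-\varepsilon g}\le\varepsilon g$. Division by $\varepsilon$ and
Fatou as $\varepsilon\to0$ give the mean. -/
theorem IsDeterminantal.lintegral_linStat_le (h : IsDeterminantal P Ξ K) {ν : Measure (Rn n)}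
    {c : ℝ} (hν : ∀ (ι : Type) (e : HilbertBasis ι ℂ (L2Rn n))
        (s : Finset ι) (h h' : Rn n → ℝ) (hh : MemLp (fun x => (h x : ℂ)) ∞ volume)
        (hh' : MemLp (fun x => (h' x : ℂ)) ∞ volume) (δ : ℝ), Measurable h → Measurable h' →
        (∀ x, |h x| ≤ 1) → 0 < δ → δ < 1 →
        ∫⁻ x, ‖h' x - h x‖ₑ ^ 2 ∂ν ≤ ENNReal.ofReal (δ ^ 2) →
        ‖sectionDet (-(mulOp _ hh' * K)) e s - sectionDet (-(mulOp _ hh * K)) e s‖ ≤ c * δ)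
    {g : Rn n → ℝ} (hg : ContDiff ℝ ((⊤ : ℕ∞) : WithTop ℕ∞) g) (hgc : HasCompactSupport g)
    (hg0 : ∀ x, 0 ≤ g x) {γ : ℝ} (hγ : 0 < γ)
    (hgγ : ∫⁻ x, ‖g x‖ₑ ^ 2 ∂ν ≤ ENNReal.ofReal (γ ^ 2)) :
    ∫⁻ ω, ∫⁻ x, ENNReal.ofReal (g x) ∂Ξ ω ∂P ≤ ENNReal.ofReal (c * γ) := by
  have hXm := measurable_linStat_of_nonneg h.measurable hg.continuous.measurable hg0
  have hX0 : ∀ ω, 0 ≤ linStat Ξ g ω := fun ω => linStat_nonneg hg0 ω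
  set X := linStat Ξ g with hX
  have key : ∀ ε : ℝ, 0 < ε → ε * γ < 1 →
      ∫⁻ ω, ENNReal.ofReal ((1 - Real.exp (-(ε * X ω))) / ε) ∂P ≤ ENNReal.ofReal (c * γ) := by
    intro ε hε hεγ
    have hεg0 : ∀ x, 0 ≤ ε * g x := fun x => mul_nonneg hε.le (hg0 x)
    have hεg : ContDiff ℝ ((⊤ : ℕ∞) : WithTop ℕ∞) fun x => ε * g x := contDiff_const.mul hg
    have hεgc : HasCompactSupport fun x => ε * g x := hgc.mul_left
    obtain ⟨w, e, -⟩ := exists_hilbertBasis ℂ (L2Rn n)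
    have h0 : MemLp (fun _ : Rn n => ((0 : ℝ) : ℂ)) ∞ (volume : Measure (Rn n)) := by
      simp
    have hlim := ((h.laplace _ hεg hεg0 hεgc).tendsto_sectionDet e).sub_const 1 |>.norm
    have hle := le_of_tendsto hlim (Eventually.of_forall fun s => by
      have := hν w e s (fun _ => 0) (fun x => 1 - Real.exp (-(ε * g x))) h0
        (memLp_top_one_sub_exp_neg hεg.continuous hεg0) (ε * γ) measurable_const
        (by have := hg.continuous.measurable; fun_prop) (by simp) (by positivity) hεγ ?_
      · rw [mulOp_zero, zero_mul, neg_zero, sectionDet_zero] at this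
        exact this
      · calc _ ≤ ∫⁻ x, ENNReal.ofReal (ε ^ 2) * ‖g x‖ₑ ^ 2 ∂ν := by
              refine lintegral_mono fun x => ?_
              obtain ⟨h1, h2, -⟩ := one_sub_exp_neg_nonneg_le (hεg0 x)
              rw [sub_zero, ← ofReal_norm, ← ofReal_norm, ← ENNReal.ofReal_pow (norm_nonneg _),
                ← ENNReal.ofReal_pow (norm_nonneg _), ← ENNReal.ofReal_mul (by positivity),
                ← mul_pow, Real.norm_of_nonneg h1, Real.norm_of_nonneg (hg0 x)]
              exact ENNReal.ofReal_le_ofReal (pow_le_pow_left₀ h1 h2 2)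
          _ = ENNReal.ofReal (ε ^ 2) * ∫⁻ x, ‖g x‖ₑ ^ 2 ∂ν :=
              lintegral_const_mul _ (by have := hg.continuous.measurable; fun_prop)
          _ ≤ _ := by
              rw [mul_pow, ENNReal.ofReal_mul (by positivity)]
              gcongr)
    have hint : Integrable (fun ω => Real.exp (-(ε * X ω))) P := by
      refine Integrable.of_bound (by fun_prop) 1 (ae_of_all _ fun ω => ?_)
      rw [Real.norm_of_nonneg (Real.exp_nonneg _)]
      exact Real.exp_le_one_iff.mpr (by have := hX0 ω; nlinarith)
    have hlap : laplaceFunctional P Ξ (fun x => ε * g x) = ∫ ω, Real.exp (-(ε * X ω)) ∂P := by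
      simp only [laplaceFunctional, linStat_const_mul, hX]
    have hone : ∫ ω, (1 - Real.exp (-(ε * X ω))) ∂P ≤ c * (ε * γ) := by
      rw [integral_sub (integrable_const _) hint, ← hlap]
      simp only [integral_const, probReal_univ, smul_eq_mul, mul_one]
      refine le_trans ?_ hle
      rw [← Complex.ofReal_one, ← Complex.ofReal_sub, Complex.norm_real, Real.norm_eq_abs,
        abs_sub_comm]
      exact le_abs_self _
    rw [← ofReal_integral_eq_lintegral_ofReal]
    · refine ENNReal.ofReal_le_ofReal ?_
      rw [integral_div, div_le_iff₀ hε]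
      linarith
    · exact ((integrable_const _).sub hint).div_const _
    · exact ae_of_all _ fun ω =>
        div_nonneg (one_sub_exp_neg_nonneg_le (mul_nonneg hε.le (hX0 ω))).1 hε.le
  -- A null sequence satisfying $\varepsilon_k\gamma<1$ from the start, as the Lipschitz bound
  -- requires.
  let ε : ℕ → ℝ := fun k => 1 / ((k : ℝ) + 1 + γ)
  have hε0 : ∀ k, 0 < ε k := fun k => by positivity
  have hεγ : ∀ k, ε k * γ < 1 := fun k => by
    simp only [ε]
    rw [div_mul_eq_mul_div, one_mul, div_lt_one (by positivity)]
    have : (0 : ℝ) ≤ k := Nat.cast_nonneg k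
    linarith
  have hεlim : Tendsto ε atTop (𝓝 0) := by
    refine squeeze_zero (fun k => (hε0 k).le) (fun k => ?_) tendsto_one_div_add_atTop_nhds_zero_nat
    exact one_div_le_one_div_of_le (by positivity) (by linarith)
  calc ∫⁻ ω, ∫⁻ x, ENNReal.ofReal (g x) ∂Ξ ω ∂P
      = ∫⁻ ω, liminf (fun k => ENNReal.ofReal ((1 - Real.exp (-(ε k * X ω))) / ε k)) atTop ∂P := by
        refine lintegral_congr_ae ?_
        filter_upwards [IsPointProcess.ae_ofReal_linStat (IsDeterminantal.isPointProcess h)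
          hg.continuous hgc hg0] with ω hω
        rw [← hω.2]
        exact ((ENNReal.tendsto_ofReal
          (tendsto_one_sub_exp_div (X ω) hε0 hεlim)).liminf_eq).symm
    _ ≤ liminf (fun k => ∫⁻ ω, ENNReal.ofReal ((1 - Real.exp (-(ε k * X ω))) / ε k) ∂P) atTop :=
        lintegral_liminf_le fun k => by fun_prop
    _ ≤ liminf (fun _ : ℕ => ENNReal.ofReal (c * γ)) atTop :=
        liminf_le_liminf (Eventually.of_forall fun k => key _ (hε0 k) (hεγ k))
    _ = _ := liminf_const _

open scoped Manifold in
theorem exists_smooth_bump {C U : Set (Rn n)} (hC : IsCompact C) (hU : IsOpen U) (hCU : C ⊆ U) :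
    ∃ g : Rn n → ℝ, ContDiff ℝ ((⊤ : ℕ∞) : WithTop ℕ∞) g ∧ HasCompactSupport g ∧
      (∀ x, 0 ≤ g x) ∧ (∀ x, g x ≤ 1) ∧ (∀ x ∈ C, g x = 1) ∧ ∀ x ∉ U, g x = 0 := by
  obtain ⟨D, hD, hCD, hDU⟩ := exists_compact_between hC hU hCU
  obtain ⟨g, hg, hr, hs, h1⟩ := exists_contMDiff_support_eq_eq_one_iff (n := ⊤) 𝓘(ℝ, Rn n)
    isOpen_interior hC.isClosed hCD
  refine ⟨g, contMDiff_iff_contDiff.mp hg, ?_, fun x => (hr ⟨x, rfl⟩).1, fun x => (hr ⟨x, rfl⟩).2,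
    fun x hx => (h1 x).mp hx, fun x hx => ?_⟩
  · exact HasCompactSupport.of_support_subset_isCompact hD (hs ▸ interior_subset)
  · by_contra hne
    have : x ∈ Function.support g := hne
    rw [hs] at this
    exact hx (hDU (interior_subset this))

/-- Smooth bumps bound the mean measure of a compact $C$ by $c\gamma$ whenever some open $U\supseteq
C$ has $\nu(U)\le\gamma^2$. Taking $U=\mathbb R^n$ gives finiteness. On a Lebesgue-null set, which
is $\nu$-null, inner regularity of the mean measure and outer regularity of $\nu$ give mass zero. -/
theorem IsDeterminantal.exists_estimates (h : IsDeterminantal P Ξ K) (hK : 0 ≤ K) :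
    IsFiniteMeasure (P.bind Ξ) ∧ P.bind Ξ ≪ volume ∧
    ∃ ν : Measure (Rn n), IsFiniteMeasure ν ∧
      (∃ c : ℝ, 0 ≤ c ∧ ∀ (ι : Type) (e : HilbertBasis ι ℂ (L2Rn n))
        (s : Finset ι) (h h' : Rn n → ℝ) (hh : MemLp (fun x => (h x : ℂ)) ∞ volume)
        (hh' : MemLp (fun x => (h' x : ℂ)) ∞ volume) (δ : ℝ), Measurable h → Measurable h' →
        (∀ x, |h x| ≤ 1) → 0 < δ → δ < 1 →
        ∫⁻ x, ‖h' x - h x‖ₑ ^ 2 ∂ν ≤ ENNReal.ofReal (δ ^ 2) →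
        ‖sectionDet (-(mulOp _ hh' * K)) e s - sectionDet (-(mulOp _ hh * K)) e s‖ ≤ c * δ) := by
  obtain ⟨ν, hνfin, hac, hL, -⟩ := exists_fredholm_estimates hK h.traceClass
  obtain ⟨c, hc, hν⟩ := hL 1 zero_le_one
  have hΞ := h.measurable
  have hmain : ∀ C U : Set (Rn n), IsCompact C → IsOpen U → C ⊆ U → ∀ γ : ℝ, 0 < γ →
      ν U ≤ ENNReal.ofReal (γ ^ 2) → P.bind Ξ C ≤ ENNReal.ofReal (c * γ) := by
    intro C U hC hU hCU γ hγ hUγ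
    obtain ⟨g, hg, hgc, hg0, hg1, hgC, hgU⟩ := exists_smooth_bump hC hU hCU
    rw [Measure.bind_apply hC.measurableSet hΞ.aemeasurable]
    refine le_trans (lintegral_mono fun ω => ?_)
      (h.lintegral_linStat_le hν hg hgc hg0 hγ (le_trans ?_ hUγ))
    · rw [← lintegral_indicator_one hC.measurableSet]
      refine lintegral_mono fun x => ?_
      by_cases hx : x ∈ C
      · simp [hx, hgC x hx]
      · simp [hx]
    · rw [← lintegral_indicator_one hU.measurableSet]
      refine lintegral_mono fun x => ?_
      by_cases hx : x ∈ U
      · simp only [hx, Set.indicator_of_mem, Pi.one_apply]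
        rw [← ofReal_norm, Real.norm_of_nonneg (hg0 x)]
        exact pow_le_one₀ zero_le (ENNReal.ofReal_le_one.mpr (hg1 x))
      · simp [hx, hgU x hx]
  have hfin : IsFiniteMeasure (P.bind Ξ) := by
    constructor
    -- The summand $1$ keeps `γ` positive when `ν` vanishes.
    set γ := √(ν.real Set.univ) + 1
    have hγ : 0 < γ := by positivity
    have hγν : ν Set.univ ≤ ENNReal.ofReal (γ ^ 2) := by
      rw [← ofReal_measureReal]
      refine ENNReal.ofReal_le_ofReal ?_
      have h1 := Real.sq_sqrt (measureReal_nonneg (μ := ν) (s := Set.univ))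
      have h2 := Real.sqrt_nonneg (ν.real Set.univ)
      simp only [γ]
      nlinarith
    have hun : (Set.univ : Set (Rn n)) = ⋃ k : ℕ, Metric.closedBall 0 (k : ℝ) :=
      (Metric.iUnion_closedBall_nat _).symm
    have hmono : Monotone fun k : ℕ => Metric.closedBall (0 : Rn n) (k : ℝ) := fun i j hij =>
      Metric.closedBall_subset_closedBall (by exact_mod_cast hij)
    rw [hun, hmono.measure_iUnion]
    refine lt_of_le_of_lt (iSup_le fun k => ?_) (ENNReal.ofReal_lt_top (r := c * γ))
    exact hmain _ _ (isCompact_closedBall _ _) isOpen_univ (Set.subset_univ _) γ hγ hγν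
  refine ⟨hfin, ?_, ν, hνfin, c, hc, hν⟩
  refine Measure.AbsolutelyContinuous.mk fun S hS hS0 => ?_
  by_contra hne
  obtain ⟨C, hCS, hC, hlt⟩ := hS.exists_lt_isCompact_of_ne_top (measure_ne_top (P.bind Ξ) S)
    (pos_iff_ne_zero.mpr hne)
  have hC0 : ν C = 0 := hac (measure_mono_null hCS hS0)
  have hle : ∀ γ : ℝ, 0 < γ → P.bind Ξ C ≤ ENNReal.ofReal (c * γ) := by
    intro γ hγ
    obtain ⟨U, hCU, hU, hlt'⟩ := C.exists_isOpen_lt_of_lt (μ := ν) (ENNReal.ofReal (γ ^ 2))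
      (by rw [hC0, ENNReal.ofReal_pos]; positivity)
    exact hmain C U hC hU hCU γ hγ hlt'.le
  have hlim : Tendsto (fun γ : ℝ => ENNReal.ofReal (c * γ)) (𝓝[>] 0) (𝓝 0) := by
    have : Tendsto (fun γ : ℝ => c * γ) (𝓝[>] 0) (𝓝 0) := by
      have := (continuous_const_mul c).tendsto (0 : ℝ)
      rw [mul_zero] at this
      exact this.mono_left nhdsWithin_le_nhds
    simpa using ENNReal.tendsto_ofReal this
  have := ge_of_tendsto hlim (eventually_mem_nhdsWithin.mono fun γ hγ => hle γ hγ)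
  exact absurd this (not_le_of_gt hlt)

end MeanMeasure

/-! ### Smooth nonnegative approximation in $L^1$. -/

section SmoothApproximation

variable {n : ℕ}

/-- Approximating $\sqrt f$ in $L^2$ and squaring keeps both smoothness and nonnegativity;
$\|g^2-f\|_1\le\|\sqrt f-g\|_2\,\|\sqrt f+g\|_2$. -/
theorem exists_smooth_nonneg_approx (μ : Measure (Rn n)) [IsFiniteMeasure μ] {f : Rn n → ℝ}
    (hf : Measurable f) (hf0 : ∀ x, 0 ≤ f x) {L : ℝ} (hL : ∀ x, f x ≤ L) {η : ℝ} (hη : 0 < η) :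
    ∃ g : Rn n → ℝ, ContDiff ℝ ((⊤ : ℕ∞) : WithTop ℕ∞) g ∧ HasCompactSupport g ∧
      (∀ x, 0 ≤ g x) ∧ ∫⁻ x, ‖g x - f x‖ₑ ∂μ ≤ ENNReal.ofReal η := by
  set r : Rn n → ℝ := fun x => √(f x) with hr
  have hrm : Measurable r := hf.sqrt
  have hr2 : MemLp r 2 μ := MemLp.of_bound hrm.aestronglyMeasurable (√L) (ae_of_all _ fun x => by
    rw [Real.norm_of_nonneg (Real.sqrt_nonneg _)]
    exact Real.sqrt_le_sqrt (hL x))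
  set A := (eLpNorm r 2 μ).toReal with hA
  have hA0 : 0 ≤ A := ENNReal.toReal_nonneg
  obtain ⟨ε, hε, hεη⟩ : ∃ ε : ℝ, 0 < ε ∧ ε * (2 * A + ε) ≤ η := by
    refine ⟨min 1 (η / (2 * A + 1)), by positivity, ?_⟩
    calc min 1 (η / (2 * A + 1)) * (2 * A + min 1 (η / (2 * A + 1)))
        ≤ η / (2 * A + 1) * (2 * A + 1) := by
          gcongr
          · exact min_le_right _ _
          · exact min_le_left _ _
      _ = η := by field_simp
  obtain ⟨g, hgc, hg, hgr⟩ := hr2.exist_eLpNorm_sub_le (by norm_num) (by norm_num) hε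
  refine ⟨fun x => g x * g x, hg.mul hg, hgc.mul_left, fun x => mul_self_nonneg _, ?_⟩
  have hgm : AEStronglyMeasurable g μ := hg.continuous.aestronglyMeasurable
  have h1 : ∫⁻ x, ‖g x * g x - f x‖ₑ ∂μ = eLpNorm ((r - g) • (r + g)) 1 μ := by
    rw [eLpNorm_one_eq_lintegral_enorm]
    refine lintegral_congr fun x => ?_
    rw [← enorm_neg]
    congr 1
    simp only [Pi.smul_apply', Pi.sub_apply, Pi.add_apply, smul_eq_mul, hr]
    ring_nf
    rw [Real.sq_sqrt (hf0 x)]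
  rw [h1]
  calc eLpNorm ((r - g) • (r + g)) 1 μ ≤ eLpNorm (r - g) 2 μ * eLpNorm (r + g) 2 μ :=
        eLpNorm_smul_le_mul_eLpNorm (hrm.aestronglyMeasurable.add hgm)
          (hrm.aestronglyMeasurable.sub hgm)
    _ ≤ ENNReal.ofReal ε * ENNReal.ofReal (2 * A + ε) := by
        gcongr
        have h2 : r + g = (r + r) - (r - g) := by abel
        have h3 : eLpNorm r 2 μ = ENNReal.ofReal A := (ENNReal.ofReal_toReal hr2.2.ne).symm
        rw [h2]
        refine (eLpNorm_sub_le (hrm.aestronglyMeasurable.add hrm.aestronglyMeasurable)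
          (hrm.aestronglyMeasurable.sub hgm) (by norm_num)).trans ?_
        rw [ENNReal.ofReal_add (by positivity) hε.le, two_mul, ENNReal.ofReal_add hA0 hA0, ← h3]
        gcongr
        exact eLpNorm_add_le hrm.aestronglyMeasurable hrm.aestronglyMeasurable (by norm_num)
    _ ≤ _ := by
        rw [← ENNReal.ofReal_mul hε.le]
        exact ENNReal.ofReal_le_ofReal hεη

theorem abs_exp_neg_sub_le {a b : ℝ} (ha : 0 ≤ a) (hb : 0 ≤ b) :
    |Real.exp (-a) - Real.exp (-b)| ≤ |a - b| := by
  wlog hab : a ≤ b generalizing a b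
  · rw [abs_sub_comm, abs_sub_comm a]; exact this hb ha (le_of_not_ge hab)
  have h1 : Real.exp (-b) = Real.exp (-a) * Real.exp (-(b - a)) := by
    rw [← Real.exp_add]; congr 1; ring
  have h2 := Real.add_one_le_exp (-(b - a))
  have h3 : Real.exp (-a) ≤ 1 := Real.exp_le_one_iff.mpr (by linarith)
  have h4 := Real.exp_pos (-a)
  have h5 : Real.exp (-(b - a)) ≤ 1 := Real.exp_le_one_iff.mpr (by linarith)
  rw [abs_of_nonneg (by rw [h1]; nlinarith), abs_of_nonpos (by linarith), h1]
  nlinarith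

end SmoothApproximation

/-! ### The Laplace functional of bounded measurable nonnegative functions. -/

section LaplaceIdentity

variable {n : ℕ} {Ω : Type*} [MeasurableSpace Ω] {P : Measure Ω} [IsProbabilityMeasure P]
  {Ξ : Ω → Measure (Rn n)} {K : L2Rn n →L[ℂ] L2Rn n}

/-- The expected number of points is finite, so there are almost surely finitely many. -/
theorem IsDeterminantal.ae_natCast (h : IsDeterminantal P Ξ K) (hK : 0 ≤ K) :
    ∀ᵐ ω ∂P, ∃ k : ℕ, Ξ ω Set.univ = k := by
  obtain ⟨hfin, -, -⟩ := h.exists_estimates hK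
  have hΞ := h.measurable
  have h1 : ∫⁻ ω, Ξ ω Set.univ ∂P ≠ ∞ := by
    rw [← Measure.bind_apply MeasurableSet.univ hΞ.aemeasurable]
    exact measure_ne_top _ _
  have h2 : ∀ᵐ ω ∂P, Ξ ω Set.univ < ∞ :=
    ae_lt_top ((Measure.measurable_coe MeasurableSet.univ).comp hΞ) h1
  filter_upwards [h2, h.ae_eq_sum_dirac] with ω hω hω2
  obtain ⟨Λ, -, hΛ⟩ := hω2
  rw [hΛ, sum_dirac_univ] at hω ⊢
  obtain ⟨k, hk⟩ := ENat.ne_top_iff_exists.mp (show ENat.card Λ ≠ ⊤ by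
    intro h; rw [h] at hω; simp at hω)
  exact ⟨k, by rw [← hk]; rfl⟩

theorem IsDeterminantal.ae_isFiniteMeasure (h : IsDeterminantal P Ξ K) (hK : 0 ≤ K) :
    ∀ᵐ ω ∂P, IsFiniteMeasure (Ξ ω) := by
  filter_upwards [h.ae_natCast hK] with ω ⟨k, hk⟩
  exact ⟨by rw [hk]; exact ENNReal.natCast_lt_top k⟩

theorem integrable_exp_neg_linStat (hΞ : Measurable Ξ) {g : Rn n → ℝ} (hg : Measurable g)
    (hg0 : ∀ x, 0 ≤ g x) : Integrable (fun ω => Real.exp (-linStat Ξ g ω)) P := by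
  have := measurable_linStat_of_nonneg hΞ hg hg0
  refine Integrable.of_bound (by fun_prop) 1 (ae_of_all _ fun ω => ?_)
  rw [Real.norm_of_nonneg (Real.exp_nonneg _)]
  exact Real.exp_le_one_iff.mpr (neg_nonpos.mpr (linStat_nonneg hg0 ω))

/-- $e^{-x}$ is $1$-Lipschitz on $[0,\infty)$, and the expectation of $\int|g-f|\,d\Xi$ is an
integral against the mean measure. -/
theorem IsDeterminantal.abs_laplaceFunctional_sub_le (h : IsDeterminantal P Ξ K) (hK : 0 ≤ K)
    {f g : Rn n → ℝ} (hf : Measurable f) (hg : Measurable g) (hf0 : ∀ x, 0 ≤ f x)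
    (hg0 : ∀ x, 0 ≤ g x) {Lf Lg : ℝ} (hfL : ∀ x, f x ≤ Lf) (hgL : ∀ x, g x ≤ Lg) {η : ℝ}
    (hη : 0 ≤ η) (hfg : ∫⁻ x, ‖g x - f x‖ₑ ∂(P.bind Ξ) ≤ ENNReal.ofReal η) :
    |laplaceFunctional P Ξ g - laplaceFunctional P Ξ f| ≤ η := by
  have hΞ := h.measurable
  have hif := integrable_exp_neg_linStat (P := P) hΞ hf hf0
  have hig := integrable_exp_neg_linStat (P := P) hΞ hg hg0
  have h1 : laplaceFunctional P Ξ g - laplaceFunctional P Ξ f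
      = ∫ ω, (Real.exp (-linStat Ξ g ω) - Real.exp (-linStat Ξ f ω)) ∂P :=
    (integral_sub hig hif).symm
  have h2 : ‖∫ ω, (Real.exp (-linStat Ξ g ω) - Real.exp (-linStat Ξ f ω)) ∂P‖ₑ
      ≤ ENNReal.ofReal η := by
    refine (enorm_integral_le_lintegral_enorm _).trans (le_trans (lintegral_mono_ae ?_)
      ((Measure.lintegral_bind hΞ.aemeasurable
        (hg.sub hf).enorm.aemeasurable).symm.trans_le hfg))
    filter_upwards [h.ae_isFiniteMeasure hK] with ω hω
    have h3 : Integrable g (Ξ ω) := Integrable.of_bound hg.aestronglyMeasurable Lg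
      (ae_of_all _ fun x => by rw [Real.norm_of_nonneg (hg0 x)]; exact hgL x)
    have h4 : Integrable f (Ξ ω) := Integrable.of_bound hf.aestronglyMeasurable Lf
      (ae_of_all _ fun x => by rw [Real.norm_of_nonneg (hf0 x)]; exact hfL x)
    calc _ ≤ ‖linStat Ξ g ω - linStat Ξ f ω‖ₑ := by
          rw [← ofReal_norm, ← ofReal_norm]
          exact ENNReal.ofReal_le_ofReal
            (abs_exp_neg_sub_le (linStat_nonneg hg0 ω) (linStat_nonneg hf0 ω))
      _ = ‖∫ x, (g x - f x) ∂(Ξ ω)‖ₑ := by rw [integral_sub h3 h4]; rfl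
      _ ≤ _ := enorm_integral_le_lintegral_enorm _
  rw [h1, ← Real.norm_eq_abs]
  rwa [← ofReal_norm, ENNReal.ofReal_le_ofReal_iff hη] at h2

/-- The Laplace functional is a Fredholm determinant for all bounded measurable `f ≥ 0`. -/
theorem IsDeterminantal.tendsto_sectionDet (h : IsDeterminantal P Ξ K) (hK : 0 ≤ K)
    {f : Rn n → ℝ} (hf : Measurable f) (hf0 : ∀ x, 0 ≤ f x) {L : ℝ} (hL : ∀ x, f x ≤ L)
    (hh : MemLp (fun x => ((1 - Real.exp (-f x) : ℝ) : ℂ)) ∞ (volume : Measure (Rn n)))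
    {ι : Type} (e : HilbertBasis ι ℂ (L2Rn n)) :
    Tendsto (sectionDet (-(mulOp _ hh * K)) e) atTop (𝓝 (laplaceFunctional P Ξ f : ℂ)) := by
  obtain ⟨hfin, -, ν, hνfin, c, hc, hν⟩ := h.exists_estimates hK
  rw [Metric.tendsto_nhds]
  intro ε hε
  obtain ⟨δ, hδ, hδ1, hδε⟩ : ∃ δ : ℝ, 0 < δ ∧ δ < 1 ∧ c * δ ≤ ε / 4 := by
    refine ⟨min (1 / 2) (ε / 4 / (c + 1)), by positivity,
      (min_le_left _ _).trans_lt (by norm_num), ?_⟩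
    calc c * min (1 / 2) (ε / 4 / (c + 1)) ≤ (c + 1) * (ε / 4 / (c + 1)) := by
          gcongr
          · linarith
          · exact min_le_right _ _
      _ = ε / 4 := by field_simp
  set η := min (δ ^ 2) (ε / 4) with hη
  have hη0 : 0 < η := by positivity
  -- One approximation for two purposes: the mean measure controls the Laplace functionals, and `ν`
  -- controls the finite sections.
  obtain ⟨g, hg, hgc, hg0, hgf⟩ := exists_smooth_nonneg_approx (P.bind Ξ + ν) hf hf0 hL hη0
  have hgf1 : ∫⁻ x, ‖g x - f x‖ₑ ∂(P.bind Ξ) ≤ ENNReal.ofReal η :=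
    (lintegral_mono' (Measure.le_add_right le_rfl) le_rfl).trans hgf
  have hgf2 : ∫⁻ x, ‖g x - f x‖ₑ ∂ν ≤ ENNReal.ofReal η :=
    (lintegral_mono' (Measure.le_add_left le_rfl) le_rfl).trans hgf
  have hgm : Measurable g := hg.continuous.measurable
  obtain ⟨Lg, hLg⟩ := hgc.exists_bound_of_continuous hg.continuous
  have hlap := h.abs_laplaceFunctional_sub_le hK hf hgm hf0 hg0 hL
    (fun x => (le_abs_self _).trans (hLg x)) hη0.le hgf1
  have hlim := (h.laplace g hg hg0 hgc).tendsto_sectionDet e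
  filter_upwards [(Metric.tendsto_nhds.mp hlim) (ε / 4) (by positivity)] with s hs
  -- The difference $d$ of the two functions $1-e^{-\cdot}$ satisfies $|d|\le1$, so $|d|^2\le|g-f|$
  -- turns the $L^1$ estimate into the required $L^2$ one.
  have hsec := hν ι e s _ _ hh (memLp_top_one_sub_exp_neg hg.continuous hg0) δ (by fun_prop)
    (by fun_prop) (fun x => by
      obtain ⟨h1, -, h3⟩ := one_sub_exp_neg_nonneg_le (hf0 x)
      rwa [abs_of_nonneg h1]) hδ hδ1 (by
      refine le_trans (lintegral_mono fun x => ?_) (hgf2.trans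
        (ENNReal.ofReal_le_ofReal (min_le_left _ _)))
      have h1 := abs_exp_neg_sub_le (hf0 x) (hg0 x)
      obtain ⟨h2, -, h3⟩ := one_sub_exp_neg_nonneg_le (hf0 x)
      obtain ⟨h4, -, h5⟩ := one_sub_exp_neg_nonneg_le (hg0 x)
      rw [← ofReal_norm, ← ofReal_norm, ← ENNReal.ofReal_pow (norm_nonneg _)]
      refine ENNReal.ofReal_le_ofReal ?_
      rw [Real.norm_eq_abs, Real.norm_eq_abs, abs_sub_comm (g x)]
      rw [show 1 - Real.exp (-g x) - (1 - Real.exp (-f x))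
        = Real.exp (-f x) - Real.exp (-g x) by ring]
      have h6 : |Real.exp (-f x) - Real.exp (-g x)| ≤ 1 := by
        rw [abs_le]; constructor <;> linarith
      have h7 := abs_nonneg (Real.exp (-f x) - Real.exp (-g x))
      nlinarith)
  have h8 : ‖((laplaceFunctional P Ξ g : ℝ) : ℂ) - (laplaceFunctional P Ξ f : ℝ)‖ ≤ ε / 4 := by
    rw [← Complex.ofReal_sub, Complex.norm_real]
    exact hlap.trans (min_le_right _ _)
  rw [dist_eq_norm] at hs ⊢
  rw [norm_sub_rev] at hsec
  calc _ ≤ _ := norm_sub_le_norm_sub_add_norm_sub _ (sectionDet _ e s) _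
    _ ≤ c * δ + (ε / 4 + ε / 4) := by
        refine add_le_add hsec ((norm_sub_le_norm_sub_add_norm_sub _ _ _).trans
          (add_le_add hs.le h8))
    _ < ε := by linarith

end LaplaceIdentity

/-! ### Generating functions jointly in the number of points and a real statistic. -/

section LinearStatistics

variable {n : ℕ} {Ω : Type*} [MeasurableSpace Ω] {P : Measure Ω} [IsProbabilityMeasure P]
  {Ξ : Ω → Measure (Rn n)} {K : L2Rn n →L[ℂ] L2Rn n} {f : Rn n → ℝ} {C : ℝ}

theorem integrable_of_measurable_of_abs_le {μ : Measure (Rn n)} [IsFiniteMeasure μ]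
    (hf : Measurable f) (hC : ∀ x, |f x| ≤ C) : Integrable f μ :=
  Integrable.of_bound hf.aestronglyMeasurable C (ae_of_all _ hC)

theorem IsDeterminantal.aemeasurable_linStat (h : IsDeterminantal P Ξ K) (hK : 0 ≤ K)
    (hf : Measurable f) (hC : ∀ x, |f x| ≤ C) : AEMeasurable (linStat Ξ f) P := by
  have hΞ := h.measurable
  have hp : Measurable fun x => max (f x) 0 := hf.max measurable_const
  have hm : Measurable fun x => max (-f x) 0 := hf.neg.max measurable_const
  refine ⟨fun ω => linStat Ξ (fun x => max (f x) 0) ω - linStat Ξ (fun x => max (-f x) 0) ω,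
    (measurable_linStat_of_nonneg hΞ hp fun x => le_max_right _ _).sub
      (measurable_linStat_of_nonneg hΞ hm fun x => le_max_right _ _), ?_⟩
  filter_upwards [h.ae_isFiniteMeasure hK] with ω hω
  have hC0 : 0 ≤ C := (abs_nonneg _).trans (hC 0)
  have h1 : Integrable (fun x => max (f x) 0) (Ξ ω) :=
    integrable_of_measurable_of_abs_le (C := C) hp fun x => by
      rw [abs_of_nonneg (le_max_right _ _)]
      exact max_le ((le_abs_self _).trans (hC x)) hC0
  have h2 : Integrable (fun x => max (-f x) 0) (Ξ ω) :=
    integrable_of_measurable_of_abs_le (C := C) hm fun x => by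
      rw [abs_of_nonneg (le_max_right _ _)]
      exact max_le ((neg_le_abs _).trans (hC x)) hC0
  simp only [linStat]
  rw [← integral_sub h1 h2]
  refine integral_congr_ae (ae_of_all _ fun x => ?_)
  simp only
  rcases le_total 0 (f x) with h0 | h0
  · rw [max_eq_left h0, max_eq_right (by linarith), sub_zero]
  · rw [max_eq_right h0, max_eq_left (by linarith)]; ring

omit [MeasurableSpace Ω] in
theorem abs_linStat_le (hC : ∀ x, |f x| ≤ C) (ω : Ω) [IsFiniteMeasure (Ξ ω)] :
    |linStat Ξ f ω| ≤ C * (Ξ ω).real Set.univ := by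
  have := norm_integral_le_of_norm_le_const (μ := Ξ ω) (f := f) (ae_of_all _ hC)
  simpa [linStat] using this

/-- The polynomial `z ↦ det (1 - (1 - z e^{t φ}) K)` attached to a finite section. -/
noncomputable def sectionPoly {ι : Type} (K : L2Rn n →L[ℂ] L2Rn n) (e : HilbertBasis ι ℂ (L2Rn n))
    (φ : ι → ℝ) (t : ℝ) (s : Finset ι) (z : ℂ) : ℂ := by
  classical exact Matrix.det (1 + Matrix.of fun i j : s =>
    -(1 - z * Real.exp (t * φ i)) * ⟪e i, K (e j)⟫_ℂ)

theorem differentiable_sectionPoly {ι : Type} (e : HilbertBasis ι ℂ (L2Rn n)) (φ : ι → ℝ) (t : ℝ)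
    (s : Finset ι) : Differentiable ℂ (sectionPoly K e φ t s) := by
  classical
  refine Matrix.differentiable_det_comp fun i j => ?_
  simp only [Matrix.add_apply, Matrix.of_apply]
  fun_prop

theorem sectionPoly_one {ι : Type} (e : HilbertBasis ι ℂ (L2Rn n)) (φ : ι → ℝ) (t : ℝ)
    (s : Finset ι) [DecidableEq s] : sectionPoly K e φ t s 1
      = (tiltMatrix (Matrix.of fun i j : s => ⟪e i, K (e j)⟫_ℂ) (fun i => φ i) t).det := by
  classical
  have : (1 + Matrix.of fun i j : s => -(1 - 1 * Real.exp (t * φ i)) * ⟪e i, K (e j)⟫_ℂ)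
      = tiltMatrix (Matrix.of fun i j : s => ⟪e i, K (e j)⟫_ℂ) (fun i => φ i) t := by
    rw [tiltMatrix, sub_eq_add_neg]
    congr 1
    rw [← realDiag_one, sub_eq_add_neg, ← realDiag_neg, realDiag_add]
    ext i j
    rw [Matrix.neg_apply, realDiag, Matrix.diagonal_mul, Matrix.of_apply, Matrix.of_apply]
    push_cast
    ring
  rw [sectionPoly, ← this]
  congr!

/-- For such `u` the function $-tf-\log u$ is nonnegative, and its Laplace functional is $\mathbb
E[u^{\Xi(\mathbb R^n)}e^{t\Xi(f)}]$: the number of points absorbs the wrong sign of $tf$. -/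
theorem IsDeterminantal.tendsto_sectionPoly_of_small (h : IsDeterminantal P Ξ K) (hK : 0 ≤ K)
    (hf : Measurable f) (hC : ∀ x, |f x| ≤ C) {ι : Type} (e : HilbertBasis ι ℂ (L2Rn n))
    {φ : ι → ℝ} (he : ∀ (g : ℝ → ℝ) (hg : MemLp (fun x => ((g (f x) : ℝ) : ℂ)) ∞ volume) (i : ι),
      mulOp _ hg (e i) = ((g (φ i) : ℝ) : ℂ) • e i) (t : ℝ) {u : ℝ} (hu : 0 < u)
    (hur : u < Real.exp (-(|t| * C))) :
    Tendsto (fun s => sectionPoly K e φ t s u) atTop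
      (𝓝 ((∫ ω, Real.exp (Real.log u * (Ξ ω).real Set.univ + t * linStat Ξ f ω) ∂P : ℝ) : ℂ)) := by
  set g : ℝ → ℝ := fun y => -(t * y) - Real.log u with hg
  have hgf : ∀ x, |t * f x| ≤ |t| * C := fun x => by
    rw [abs_mul]; exact mul_le_mul_of_nonneg_left (hC x) (abs_nonneg t)
  have hlog : Real.log u < -(|t| * C) := by
    have := Real.log_lt_log hu hur
    rwa [Real.log_exp] at this
  have hg0 : ∀ x, 0 ≤ g (f x) := fun x => by
    have := (abs_le.mp (hgf x)).2
    simp only [hg]; linarith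
  have hgL : ∀ x, g (f x) ≤ |t| * C - Real.log u := fun x => by
    have := (abs_le.mp (hgf x)).1
    simp only [hg]; linarith
  have hgm : Measurable fun x => g (f x) := by simp only [hg]; fun_prop
  have hh : MemLp (fun x => ((1 - Real.exp (-g (f x)) : ℝ) : ℂ)) ∞ (volume : Measure (Rn n)) :=
    memLp_top_ofReal (h := fun x => 1 - Real.exp (-g (f x))) (by fun_prop) (L := 1) fun x => by
      obtain ⟨h1, -, h3⟩ := one_sub_exp_neg_nonneg_le (hg0 x)
      rwa [abs_of_nonneg h1]
  have hlim := h.tendsto_sectionDet hK hgm hg0 hgL hh e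
  have hexp : ∀ y, 1 - Real.exp (-g y) = 1 - u * Real.exp (t * y) := fun y => by
    rw [hg, neg_sub, sub_neg_eq_add, Real.exp_add, Real.exp_log hu]
  have h1 : laplaceFunctional P Ξ (fun x => g (f x))
      = ∫ ω, Real.exp (Real.log u * (Ξ ω).real Set.univ + t * linStat Ξ f ω) ∂P := by
    refine integral_congr_ae ?_
    filter_upwards [h.ae_isFiniteMeasure hK] with ω hω
    have hi : Integrable f (Ξ ω) := integrable_of_measurable_of_abs_le hf hC
    congr 1
    simp only [linStat, hg]
    have hi' : Integrable (fun x => -(t * f x)) (Ξ ω) := (hi.const_mul t).neg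
    rw [integral_sub hi' (integrable_const _), integral_neg, integral_const_mul,
      integral_const, smul_eq_mul]
    ring
  rw [← h1]
  refine hlim.congr fun s => ?_
  classical
  rw [sectionDet_eq_of_eigenbasis (c := fun i => 1 - Real.exp (-g (φ i))) hh e
    (he (fun y => 1 - Real.exp (-g y)) hh), sectionPoly]
  congr! 3
  ext i j
  rw [hexp]
  push_cast
  rfl

theorem IsDeterminantal.hasSum_setIntegral (h : IsDeterminantal P Ξ K) (hK : 0 ≤ K)
    {G : Ω → ℝ} (hG : Integrable G P) :
    HasSum (fun k : ℕ => ∫ ω in {ω | Ξ ω Set.univ = k}, G ω ∂P) (∫ ω, G ω ∂P) := by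
  have hΞ := h.measurable
  have hm : ∀ k : ℕ, MeasurableSet {ω | Ξ ω Set.univ = k} := fun k =>
    ((Measure.measurable_coe MeasurableSet.univ).comp hΞ) (measurableSet_singleton _)
  have hd : Pairwise (Function.onFun Disjoint fun k : ℕ => {ω | Ξ ω Set.univ = k}) := by
    intro i j hij
    refine Set.disjoint_left.mpr fun ω hi hj => hij ?_
    have : (i : ℝ≥0∞) = j := Eq.trans (Eq.symm hi) hj
    exact_mod_cast this
  have := hasSum_integral_iUnion (μ := P) (f := G) hm hd hG.integrableOn
  rwa [setIntegral_eq_integral_of_ae_compl_eq_zero] at this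
  filter_upwards [h.ae_natCast hK] with ω ⟨k, hk⟩ hω
  exact absurd (Set.mem_iUnion.mpr ⟨k, hk⟩) hω

theorem IsDeterminantal.integrable_of_summable (h : IsDeterminantal P Ξ K) (hK : 0 ≤ K)
    {G : Ω → ℝ} (hG : ∀ k : ℕ, IntegrableOn G {ω | Ξ ω Set.univ = k} P)
    (hs : Summable fun k : ℕ => ∫ ω in {ω | Ξ ω Set.univ = k}, ‖G ω‖ ∂P) : Integrable G P := by
  have := integrableOn_iUnion_of_summable_integral_norm hG hs
  rwa [IntegrableOn, Measure.restrict_eq_self_of_ae_mem] at this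
  filter_upwards [h.ae_natCast hK] with ω ⟨k, hk⟩
  exact Set.mem_iUnion.mpr ⟨k, hk⟩

end LinearStatistics

/-! ### Exponential moments of finitely-valued statistics. -/

section ExponentialMoments

variable {n : ℕ} {Ω : Type*} [MeasurableSpace Ω] {P : Measure Ω} [IsProbabilityMeasure P]
  {Ξ : Ω → Measure (Rn n)} {K : L2Rn n →L[ℂ] L2Rn n} {f : Rn n → ℝ} {C : ℝ}

omit [MeasurableSpace Ω] in
theorem abs_mul_linStat_le (hC : ∀ x, |f x| ≤ C) (t : ℝ) {ω : Ω} {k : ℕ}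
    (hk : Ξ ω Set.univ = k) : |t * linStat Ξ f ω| ≤ |t| * C * k := by
  have : IsFiniteMeasure (Ξ ω) := ⟨by rw [hk]; exact ENNReal.natCast_lt_top k⟩
  have h1 := abs_linStat_le (Ξ := Ξ) hC ω
  rw [measureReal_def, hk, ENNReal.toReal_natCast] at h1
  rw [abs_mul, mul_assoc]
  exact mul_le_mul_of_nonneg_left h1 (abs_nonneg t)

theorem IsDeterminantal.integrableOn_exp (h : IsDeterminantal P Ξ K) (hK : 0 ≤ K)
    (hf : Measurable f) (hC : ∀ x, |f x| ≤ C) (t : ℝ) (k : ℕ) :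
    IntegrableOn (fun ω => Real.exp (t * linStat Ξ f ω)) {ω | Ξ ω Set.univ = k} P ∧
    ∫ ω in {ω | Ξ ω Set.univ = k}, Real.exp (t * linStat Ξ f ω) ∂P ≤ Real.exp (|t| * C) ^ k := by
  have hm : MeasurableSet {ω | Ξ ω Set.univ = k} :=
    ((Measure.measurable_coe MeasurableSet.univ).comp h.measurable)
      (measurableSet_singleton _)
  have hX := h.aemeasurable_linStat hK hf hC
  have hbound : ∀ ω ∈ {ω | Ξ ω Set.univ = k},
      ‖Real.exp (t * linStat Ξ f ω)‖ ≤ Real.exp (|t| * C) ^ k := fun ω hω => by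
    rw [Real.norm_of_nonneg (Real.exp_nonneg _), ← Real.exp_nat_mul, mul_comm (k : ℝ)]
    exact Real.exp_le_exp.mpr ((le_abs_self _).trans (abs_mul_linStat_le hC t hω))
  have hint : IntegrableOn (fun ω => Real.exp (t * linStat Ξ f ω)) {ω | Ξ ω Set.univ = k} P := by
    refine Integrable.of_bound
      (Real.measurable_exp.comp_aemeasurable (hX.const_mul t)).aestronglyMeasurable.restrict
      (Real.exp (|t| * C) ^ k) ?_
    exact (ae_restrict_iff' hm).mpr (ae_of_all _ hbound)
  refine ⟨hint, (le_abs_self _).trans ?_⟩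
  refine (norm_setIntegral_le_of_norm_le_const (measure_lt_top _ _) hbound).trans ?_
  exact mul_le_of_le_one_right (by positivity) measureReal_le_one

/-- Let $\alpha_k$ be the expectation of $e^{t\Xi(f)}$ on the event of exactly $k$ points.
Convergence for small $u$ identifies $\alpha_k$ as the limit of the polynomial coefficients, which
are $O(2^{-k})$ uniformly. Thus $\sum_k\alpha_k$ converges, giving integrability, and the limit may
be taken at $z=1$. -/
theorem IsDeterminantal.tendsto_sectionPoly_one (h : IsDeterminantal P Ξ K) (hK : 0 ≤ K)
    (hf : Measurable f) (hC : ∀ x, |f x| ≤ C) {ι : Type} (e : HilbertBasis ι ℂ (L2Rn n))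
    {φ : ι → ℝ} (hφ : ∀ i, |φ i| ≤ C)
    (he : ∀ (g : ℝ → ℝ) (hg : MemLp (fun x => ((g (f x) : ℝ) : ℂ)) ∞ volume) (i : ι),
      mulOp _ hg (e i) = ((g (φ i) : ℝ) : ℂ) • e i) (t : ℝ) :
    Integrable (fun ω => Real.exp (t * linStat Ξ f ω)) P ∧
    Tendsto (fun s => sectionPoly K e φ t s 1) atTop
      (𝓝 ((∫ ω, Real.exp (t * linStat Ξ f ω) ∂P : ℝ) : ℂ)) := by
  have hC0 : 0 ≤ C := (abs_nonneg _).trans (hC 0)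
  have hX := h.aemeasurable_linStat hK hf hC
  have hNm : Measurable fun ω => (Ξ ω).real Set.univ :=
    ((Measure.measurable_coe MeasurableSet.univ).comp h.measurable).ennreal_toReal
  set ρ := Real.exp (|t| * C) with hρ
  have hρ0 : 0 < ρ := Real.exp_pos _
  set S : ℕ → Set Ω := fun k => {ω | Ξ ω Set.univ = k} with hS
  have hSm : ∀ k, MeasurableSet (S k) := fun k =>
    ((Measure.measurable_coe MeasurableSet.univ).comp h.measurable)
      (measurableSet_singleton _)
  set α : ℕ → ℝ := fun k => ∫ ω in S k, Real.exp (t * linStat Ξ f ω) ∂P with hα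
  have hα0 : ∀ k, 0 ≤ α k := fun k => integral_nonneg fun ω => Real.exp_nonneg _
  have hαle : ∀ k, α k ≤ ρ ^ k := fun k => (h.integrableOn_exp hK hf hC t k).2
  -- Any radius above $1$ would do; $3$ allows Cauchy estimates at radius $2$.
  obtain ⟨B₀, hB₀⟩ : ∃ B : ℝ, ∀ (s : Finset ι) (z : ℂ), ‖z‖ < 3 →
      ‖sectionPoly K e φ t s z‖ ≤ B := by
    obtain ⟨ν, -, -, -, hL⟩ := exists_fredholm_estimates hK h.traceClass
    obtain ⟨B, hB⟩ := hL (1 + 3 * ρ) (by positivity)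
    refine ⟨B, fun s z hz => ?_⟩
    classical
    refine hB ι e s (fun i => -(1 - z * Real.exp (t * φ i))) fun i => ?_
    rw [norm_neg]
    refine (norm_sub_le _ _).trans ?_
    rw [norm_one, norm_mul, Complex.norm_real, Real.norm_of_nonneg (Real.exp_nonneg _)]
    gcongr
    refine Real.exp_le_exp.mpr ((le_abs_self _).trans ?_)
    rw [abs_mul]
    exact mul_le_mul_of_nonneg_left (hφ i) (abs_nonneg t)
  -- The $1$ accommodates the a priori bound $\alpha_k\rho^{-k}\le1$.
  set B := max B₀ 1 with hBdef
  have hB : ∀ (s : Finset ι) (k : ℕ), ‖taylorCoeff (sectionPoly K e φ t s) k‖ * 2 ^ k ≤ B :=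
    fun s k => norm_taylorCoeff_mul_pow_le (R' := 3) (by norm_num) (by norm_num)
      (differentiable_sectionPoly e φ t s).differentiableOn
      (fun z hz => (hB₀ s z hz).trans (le_max_left _ _)) k
  have hr1 : ρ⁻¹ ≤ 1 := inv_le_one_of_one_le₀ (Real.one_le_exp (by positivity))
  have hcoeff := tendsto_coeff_of_tendsto_powerSeries (l := atTop)
    (a := fun s => taylorCoeff (sectionPoly K e φ t s)) (α := fun k => (α k : ℂ)) (B := B)
    (r := ρ⁻¹) (by positivity) (Eventually.of_forall fun s k => ?_) (fun k => ?_) ?_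
  · have hα2 : ∀ k, α k * 2 ^ k ≤ B := fun k => by
      have h1 := le_of_tendsto ((hcoeff k).norm.mul_const (2 ^ k))
        (Eventually.of_forall fun s => hB s k)
      rwa [Complex.norm_real, Real.norm_of_nonneg (hα0 k)] at h1
    have hsum : Summable α := by
      refine Summable.of_nonneg_of_le hα0 (fun k => ?_)
        (summable_geometric_two.mul_left B)
      rw [div_pow, one_pow, mul_one_div, le_div_iff₀ (by positivity)]
      exact hα2 k
    have hint : Integrable (fun ω => Real.exp (t * linStat Ξ f ω)) P := by
      refine h.integrable_of_summable hK (fun k => (h.integrableOn_exp hK hf hC t k).1) ?_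
      simpa only [Real.norm_of_nonneg (Real.exp_nonneg _)] using hsum
    refine ⟨hint, ?_⟩
    have hlim := tendsto_powerSeries_of_tendsto_coeff (l := atTop) (R := 2)
      (Eventually.of_forall hB) hcoeff (z := 1) (by simp)
    have h2 : HasSum (fun k => (α k : ℂ) * 1 ^ k)
        ((∫ ω, Real.exp (t * linStat Ξ f ω) ∂P : ℝ) : ℂ) := by
      simpa using Complex.hasSum_ofReal.mpr (h.hasSum_setIntegral hK hint)
    rw [h2.tsum_eq] at hlim
    refine hlim.congr fun s => ?_
    exact (hasSum_taylorCoeff (R := 3) (differentiable_sectionPoly e φ t s).differentiableOn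
      (by simp)).tsum_eq
  · refine le_trans ?_ (hB s k)
    gcongr
    linarith
  · rw [Complex.norm_real, Real.norm_of_nonneg (hα0 k), inv_pow, ← div_eq_mul_inv]
    exact ((div_le_one (by positivity)).mpr (hαle k)).trans (le_max_right _ _)
  · intro u hu hur
    have hur' : u < Real.exp (-(|t| * C)) := by rwa [Real.exp_neg]
    have hlim := h.tendsto_sectionPoly_of_small hK hf hC e he t hu hur'
    have hlog : Real.log u ≤ -(|t| * C) := by
      have := Real.log_le_log hu hur'.le
      rwa [Real.log_exp] at this
    have hGint : Integrable (fun ω => Real.exp (Real.log u * (Ξ ω).real Set.univ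
        + t * linStat Ξ f ω)) P := by
      refine Integrable.of_bound (Real.measurable_exp.comp_aemeasurable
        ((hNm.const_mul _).aemeasurable.add (hX.const_mul t))).aestronglyMeasurable 1 ?_
      filter_upwards [h.ae_natCast hK] with ω ⟨k, hk⟩
      rw [Real.norm_of_nonneg (Real.exp_nonneg _), Real.exp_le_one_iff, measureReal_def, hk,
        ENNReal.toReal_natCast]
      have h1 := (abs_le.mp (abs_mul_linStat_le (Ξ := Ξ) hC t hk)).2
      have h2 : (0 : ℝ) ≤ k := Nat.cast_nonneg k
      nlinarith
    have hGsum := h.hasSum_setIntegral hK hGint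
    have hterm : ∀ k : ℕ, ∫ ω in {ω | Ξ ω Set.univ = k}, Real.exp (Real.log u *
        (Ξ ω).real Set.univ + t * linStat Ξ f ω) ∂P = α k * u ^ k := fun k => by
      rw [hα, mul_comm, ← integral_const_mul]
      refine setIntegral_congr_fun (hSm k) fun ω hω => ?_
      have hω' : Ξ ω Set.univ = k := hω
      rw [measureReal_def, hω', ENNReal.toReal_natCast, Real.exp_add, mul_comm (Real.log u),
        Real.exp_nat_mul, Real.exp_log hu]
    simp only [hterm] at hGsum
    have h3 : HasSum (fun k => (α k : ℂ) * (u : ℂ) ^ k) ((∫ ω, Real.exp (Real.log u *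
        (Ξ ω).real Set.univ + t * linStat Ξ f ω) ∂P : ℝ) : ℂ) := by
      have := Complex.hasSum_ofReal.mpr hGsum
      simpa using this
    rw [h3.tsum_eq]
    refine hlim.congr fun s => ?_
    have hu3 : ‖(u : ℂ)‖ < 3 := by
      rw [Complex.norm_real, Real.norm_of_nonneg hu.le]
      linarith
    exact (hasSum_taylorCoeff (R := 3) (differentiable_sectionPoly e φ t s).differentiableOn
      hu3).tsum_eq.symm

open ProbabilityTheory in
-- In an adapted basis the sections at $z=1$ are tilted determinants of compressions of $K$, which
-- inherit $0\le K\le1$; comparability passes to the limit.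
theorem IsDeterminantal.secondDiffComparable_cgf_of_finite_range (h : IsDeterminantal P Ξ K)
    (hK : 0 ≤ K) (hK1 : K ≤ 1) (hf : Measurable f) (hfin : (Set.range f).Finite)
    (hC : ∀ x, |f x| ≤ C) :
    (∀ t, Integrable (fun ω => Real.exp (t * linStat Ξ f ω)) P) ∧
      SecondDiffComparable (2 * C) (cgf (linStat Ξ f) P) := by
  classical
  obtain ⟨ι, e, φ, hφ, he⟩ := exists_hilbertBasis_adapted hf hfin
  have hφC : ∀ i, |φ i| ≤ C := fun i => by
    obtain ⟨x, hx⟩ := hφ i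
    exact hx ▸ hC x
  have hmain := h.tendsto_sectionPoly_one hK hf hC e hφC he
  refine ⟨fun t => (hmain t).1, ?_⟩
  refine SecondDiffComparable.of_tendsto (l := (atTop : Filter (Finset ι)))
    (F := fun s t => Real.log (tiltMatrix (Matrix.of fun i j : s => ⟪e i, K (e j)⟫_ℂ)
      (fun i => φ i) t).det.re) (fun s => ?_) fun t => ?_
  · exact secondDiffComparable_log_det (posSemidef_compression hK e s)
      (posSemidef_one_sub_compression hK1 e s) ((abs_nonneg _).trans (hC 0)) fun i => hφC i
  · have hpos : 0 < mgf (linStat Ξ f) P t := mgf_pos (hmain t).1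
    refine Tendsto.log ?_ hpos.ne'
    have := (Complex.continuous_re.tendsto _).comp (hmain t).2
    rw [Complex.ofReal_re] at this
    refine this.congr fun s => ?_
    rw [Function.comp_apply, sectionPoly_one]

end ExponentialMoments

/-! ### From finitely-valued to bounded measurable functions. -/

section BoundedStatistics

open ProbabilityTheory

variable {n : ℕ} {Ω : Type*} [MeasurableSpace Ω] {P : Measure Ω} [IsProbabilityMeasure P]
  {Ξ : Ω → Measure (Rn n)} {K : L2Rn n →L[ℂ] L2Rn n} {f : Rn n → ℝ} {C : ℝ}

theorem IsDeterminantal.secondDiffComparable_cgf (h : IsDeterminantal P Ξ K)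
    (hK : 0 ≤ K) (hK1 : K ≤ 1) (hf : Measurable f) (hC : ∀ x, |f x| ≤ C) :
    (∀ t, Integrable (fun ω => Real.exp (t * linStat Ξ f ω)) P) ∧
      SecondDiffComparable (2 * C) (cgf (linStat Ξ f) P) := by
  have hC0 : 0 ≤ C := (abs_nonneg _).trans (hC 0)
  -- The constant function $1$ counts points. All exponential moments of this count are finite,
  -- which supplies the dominating function $e^{|t|C\,\Xi(\mathbb R^n)}$.
  have hone := (h.secondDiffComparable_cgf_of_finite_range hK hK1 (f := fun _ => 1) (C := 1)
    measurable_const Set.finite_range_const (by simp)).1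
  have h0 : (0 : ℝ) ∈ Set.Icc (-C) C := ⟨by linarith, hC0⟩
  let F : ℕ → SimpleFunc (Rn n) ℝ := fun j => SimpleFunc.approxOn f hf (Set.Icc (-C) C) 0 h0 j
  have hFC : ∀ j x, |F j x| ≤ C := fun j x =>
    abs_le.mpr (SimpleFunc.approxOn_mem hf h0 j x)
  have hF : ∀ x, Tendsto (fun j => F j x) atTop (𝓝 (f x)) := fun x =>
    SimpleFunc.tendsto_approxOn hf h0 (subset_closure (abs_le.mp (hC x)))
  have hFm : ∀ j, Measurable (F j) := fun j => (F j).measurable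
  have hj := fun j => h.secondDiffComparable_cgf_of_finite_range hK hK1 (hFm j)
    (F j).finite_range (hFC j)
  have hone' : ∀ ω, linStat Ξ (fun _ => 1) ω = (Ξ ω).real Set.univ := fun ω => by
    simp [linStat]
  have hbound : ∀ (t : ℝ) (g : Rn n → ℝ), (∀ x, |g x| ≤ C) → ∀ᵐ ω ∂P,
      ‖Real.exp (t * linStat Ξ g ω)‖ ≤ Real.exp (|t| * C * linStat Ξ (fun _ => 1) ω) := by
    intro t g hg
    filter_upwards [h.ae_natCast hK] with ω ⟨k, hk⟩
    rw [Real.norm_of_nonneg (Real.exp_nonneg _), hone', measureReal_def, hk,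
      ENNReal.toReal_natCast]
    exact Real.exp_le_exp.mpr ((le_abs_self _).trans (abs_mul_linStat_le hg t hk))
  have hmeas : ∀ (t : ℝ) (g : Rn n → ℝ), Measurable g → (∀ x, |g x| ≤ C) →
      AEStronglyMeasurable (fun ω => Real.exp (t * linStat Ξ g ω)) P := fun t g hg hgC =>
    (Real.measurable_exp.comp_aemeasurable
      ((h.aemeasurable_linStat hK hg hgC).const_mul t)).aestronglyMeasurable
  have hint : ∀ t, Integrable (fun ω => Real.exp (t * linStat Ξ f ω)) P := fun t =>
    (hone (|t| * C)).mono' (hmeas t f hf hC) (hbound t f hC)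
  refine ⟨hint, SecondDiffComparable.of_tendsto (l := atTop) (fun j => (hj j).2) fun t => ?_⟩
  refine Tendsto.log ?_ (mgf_pos (hint t)).ne'
  refine tendsto_integral_of_dominated_convergence _ (fun j => hmeas t _ (hFm j) (hFC j))
    (hone (|t| * C)) (fun j => hbound t _ (hFC j)) ?_
  filter_upwards [h.ae_isFiniteMeasure hK] with ω hω
  refine (Real.continuous_exp.tendsto _).comp (Tendsto.const_mul t ?_)
  exact tendsto_integral_of_dominated_convergence (fun _ => C)
    (fun j => (hFm j).aestronglyMeasurable) (integrable_const _)
    (fun j => ae_of_all _ (hFC j)) (ae_of_all _ hF)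

end BoundedStatistics

/-! ### Second-order expansion of the cumulant generating function. -/

section CumulantExpansion

open ProbabilityTheory

/-- Converts the comparison of second differences back into one of second derivatives. -/
theorem tendsto_secondDiff_div_sq {G g₁ : ℝ → ℝ} {a g₂ : ℝ} (h1 : ∀ t, HasDerivAt G (g₁ t) t)
    (h2 : HasDerivAt g₁ g₂ a) : Tendsto (fun h => secondDiff G a h / h ^ 2) (𝓝[≠] 0) (𝓝 g₂) := by
  refine HasDerivAt.lhopital_zero_nhdsNE (f' := fun h => g₁ (a + h) - g₁ (a - h))
    (g' := fun h => 2 * h) ?_ ?_ ?_ ?_ ?_ ?_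
  · refine Eventually.of_forall fun h => ?_
    have e1 := (h1 (a + h)).comp_const_add a h
    have e2 := (h1 (a - h)).comp_const_sub a h
    have e3 := (e1.add e2).sub_const (2 * G a)
    rw [← sub_eq_add_neg] at e3
    exact e3
  · exact Eventually.of_forall fun h => by simpa using hasDerivAt_pow 2 h
  · filter_upwards [self_mem_nhdsWithin] with h hh
    simpa using hh
  · have hc : Continuous G := continuous_iff_continuousAt.mpr fun t => (h1 t).continuousAt
    have : Continuous fun h => secondDiff G a h := by unfold secondDiff; fun_prop
    have h3 := this.tendsto 0
    simp only [secondDiff, add_zero, sub_zero] at h3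
    rw [show G a + G a - 2 * G a = 0 by ring] at h3
    exact h3.mono_left nhdsWithin_le_nhds
  · have : Continuous fun h : ℝ => h ^ 2 := by fun_prop
    have h3 := this.tendsto 0
    rw [zero_pow two_ne_zero] at h3
    exact h3.mono_left nhdsWithin_le_nhds
  · have e1 := h2.tendsto_slope_zero
    have hneg : Tendsto (fun h : ℝ => -h) (𝓝[≠] 0) (𝓝[≠] 0) := by
      refine tendsto_nhdsWithin_iff.mpr ⟨?_, ?_⟩
      · have := (continuous_neg (G := ℝ)).tendsto 0
        rw [neg_zero] at this
        exact this.mono_left nhdsWithin_le_nhds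
      · filter_upwards [self_mem_nhdsWithin] with h hh
        simpa using hh
    have e2 := e1.comp hneg
    have e3 := (e1.add e2).div_const 2
    rw [add_self_div_two] at e3
    refine e3.congr' ?_
    filter_upwards [self_mem_nhdsWithin] with h hh
    have hh' : h ≠ 0 := hh
    simp only [Function.comp_apply, smul_eq_mul, ← sub_eq_add_neg]
    field_simp
    ring

theorem exists_taylor_two {G : ℝ → ℝ} (hG : ContDiff ℝ 2 G) {t : ℝ} (ht : t ≠ 0) :
    ∃ u, |u| ≤ |t| ∧ G t = G 0 + deriv G 0 * t + iteratedDeriv 2 G u * t ^ 2 / 2 := by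
  obtain ⟨u, hu, h⟩ := taylor_mean_remainder_lagrange_iteratedDeriv (f := G) (n := 1) ht.symm
    (hG.contDiffOn)
  refine ⟨u, ?_, ?_⟩
  · rcases lt_or_gt_of_ne ht with h0 | h0
    · rw [Set.uIoo_of_gt h0] at hu
      rw [abs_of_neg hu.2, abs_of_neg h0]; linarith [hu.1]
    · rw [Set.uIoo_of_lt h0] at hu
      rw [abs_of_pos hu.1, abs_of_pos h0]; exact hu.2.le
  · have hd : derivWithin G (Set.uIcc 0 t) 0 = deriv G 0 :=
      ((hG.differentiable (by norm_num)) 0).derivWithin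
        ((uniqueDiffOn_uIcc ht.symm) 0 Set.left_mem_uIcc)
    simp [taylorWithinEval_succ, hd] at h
    linarith

variable {Ω : Type*} [MeasurableSpace Ω] {P : Measure Ω} [IsProbabilityMeasure P] {X : Ω → ℝ}

omit [IsProbabilityMeasure P] in
theorem integrableExpSet_eq_univ (hX : ∀ t, Integrable (fun ω => Real.exp (t * X ω)) P) :
    integrableExpSet X P = Set.univ :=
  Set.eq_univ_of_forall hX

omit [IsProbabilityMeasure P] in
theorem contDiff_cgf (hX : ∀ t, Integrable (fun ω => Real.exp (t * X ω)) P) :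
    ContDiff ℝ 2 (cgf X P) := by
  have : AnalyticOnNhd ℝ (cgf X P) Set.univ := by
    have := analyticOnNhd_cgf (X := X) (μ := P)
    rwa [integrableExpSet_eq_univ hX, interior_univ] at this
  exact contDiffOn_univ.mp (this.contDiffOn uniqueDiffOn_univ)

theorem iteratedDeriv_two_cgf_zero (hX : ∀ t, Integrable (fun ω => Real.exp (t * X ω)) P) :
    iteratedDeriv 2 (cgf X P) 0 = variance X P := by
  rw [← variance_tilted_mul (by rw [integrableExpSet_eq_univ hX]; simp)]
  simp

omit [IsProbabilityMeasure P] in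
theorem iteratedDeriv_two_cgf_le (hX : ∀ t, Integrable (fun ω => Real.exp (t * X ω)) P) {c : ℝ}
    (hc : SecondDiffComparable c (cgf X P)) (a b : ℝ) :
    iteratedDeriv 2 (cgf X P) a ≤ Real.exp (c * |a - b|) * iteratedDeriv 2 (cgf X P) b := by
  have hG := contDiff_cgf hX
  have h1 : ∀ t, HasDerivAt (cgf X P) (deriv (cgf X P) t) t := fun t =>
    ((hG.differentiable (by norm_num)) t).hasDerivAt
  have h2 : ∀ t, HasDerivAt (deriv (cgf X P)) (iteratedDeriv 2 (cgf X P) t) t := fun t => by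
    rw [iteratedDeriv_succ, iteratedDeriv_one]
    have := hG.differentiable_iteratedDeriv 1 (by norm_num)
    rw [iteratedDeriv_one] at this
    exact (this t).hasDerivAt
  refine le_of_tendsto_of_tendsto (tendsto_secondDiff_div_sq h1 (h2 a))
    ((tendsto_secondDiff_div_sq h1 (h2 b)).const_mul _) (Eventually.of_forall fun h => ?_)
  simp only
  rw [← mul_div_assoc]
  exact div_le_div_of_nonneg_right (hc a b h) (sq_nonneg h)

/-- The Lagrange remainder involves $W=G''(u)$ with $|u|\le|t|$. Comparing it both ways with
$V=G''(0)$, up to $\kappa=e^{c|t|}$, gives $|W-V|\le(\kappa-1)V$. -/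
theorem abs_cgf_sub_le (hX : ∀ t, Integrable (fun ω => Real.exp (t * X ω)) P) {c : ℝ}
    (hc0 : 0 ≤ c) (hc : SecondDiffComparable c (cgf X P)) (t : ℝ) :
    |cgf X P t - t * ∫ ω, X ω ∂P - variance X P * t ^ 2 / 2|
      ≤ (Real.exp (c * |t|) - 1) * (variance X P * t ^ 2 / 2) := by
  rcases eq_or_ne t 0 with rfl | ht
  · simp
  obtain ⟨u, hu, h⟩ := exists_taylor_two (contDiff_cgf hX) ht
  have hd : deriv (cgf X P) 0 = ∫ ω, X ω ∂P := by
    rw [deriv_cgf_zero (by rw [integrableExpSet_eq_univ hX]; simp)]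
    simp
  have hV := iteratedDeriv_two_cgf_zero hX
  have hV0 : 0 ≤ variance X P := variance_nonneg _ _
  have h1 := iteratedDeriv_two_cgf_le hX hc u 0
  have h2 := iteratedDeriv_two_cgf_le hX hc 0 u
  rw [hV, sub_zero] at h1
  rw [hV, zero_sub, abs_neg] at h2
  set κ := Real.exp (c * |t|) with hκ
  set W := iteratedDeriv 2 (cgf X P) u
  set V := variance X P
  have hle : Real.exp (c * |u|) ≤ κ := Real.exp_le_exp.mpr (by gcongr)
  have hpos := Real.exp_pos (c * |u|)
  have hκ1 : 1 ≤ κ := Real.one_le_exp (by positivity)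
  -- A negative value would make $V\le e^{c|u|}W$ negative, contrary to its being a variance.
  have hW0 : 0 ≤ W := by
    by_contra hneg
    push Not at hneg
    nlinarith
  have h3 : W ≤ κ * V := h1.trans (by gcongr)
  have h4 : V ≤ κ * W := h2.trans (by gcongr)
  rw [h, cgf_zero, hd]
  rw [show 0 + (∫ ω, X ω ∂P) * t + W * t ^ 2 / 2 - t * ∫ ω, X ω ∂P - V * t ^ 2 / 2
    = (W - V) * (t ^ 2 / 2) by ring, abs_mul, abs_of_nonneg (show (0:ℝ) ≤ t ^ 2 / 2 by positivity),
    show (κ - 1) * (V * t ^ 2 / 2) = ((κ - 1) * V) * (t ^ 2 / 2) by ring]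
  gcongr
  rw [abs_le]
  constructor
  · rcases le_total W V with hWV | hWV
    · nlinarith
    · nlinarith
  · linarith

end CumulantExpansion

/-! ### From bounded functions to classes in $L^\infty$. -/

section EssentiallyBoundedStatistics

open ProbabilityTheory

theorem exists_measurable_abs_le_ae_eq {α : Type*} [MeasurableSpace α] {μ : Measure α}
    {f : α → ℝ} {C : ℝ} (hC : 0 ≤ C) (hf : MemLp f ∞ μ)
    (hfC : eLpNorm f ∞ μ ≤ ENNReal.ofReal C) :
    ∃ g : α → ℝ, Measurable g ∧ (∀ x, |g x| ≤ C) ∧ f =ᵐ[μ] g := by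
  have hm := hf.aestronglyMeasurable.aemeasurable
  refine ⟨fun x => max (-C) (min C (hm.mk f x)),
    measurable_const.max (measurable_const.min hm.measurable_mk), fun x => ?_, ?_⟩
  · exact abs_le.mpr ⟨le_max_left _ _, max_le (by linarith) (min_le_left _ _)⟩
  · have hb : ∀ᵐ x ∂μ, |f x| ≤ C := by
      rw [eLpNorm_exponent_top] at hfC
      filter_upwards [ae_le_eLpNormEssSup (f := f) (μ := μ)] with x hx
      have := hx.trans hfC
      rw [Real.enorm_eq_ofReal_abs] at this
      exact (ENNReal.ofReal_le_ofReal_iff hC).mp this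
    filter_upwards [hm.ae_eq_mk, hb] with x hx hx'
    rw [← hx, min_eq_right (abs_le.mp hx').2, max_eq_right (abs_le.mp hx').1]

variable {n : ℕ} {Ω : Type*} [MeasurableSpace Ω] {P : Measure Ω} [IsProbabilityMeasure P]
  {Ξ : Ω → Measure (Rn n)} {K : L2Rn n →L[ℂ] L2Rn n} {f g : Rn n → ℝ} {C : ℝ}

/-- A Lebesgue-null set is null for the mean measure, hence almost surely carries no points. -/
theorem IsDeterminantal.linStat_congr_ae (h : IsDeterminantal P Ξ K) (hK : 0 ≤ K)
    (hfg : f =ᵐ[volume] g) : linStat Ξ f =ᵐ[P] linStat Ξ g := by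
  have hbind : f =ᵐ[P.bind Ξ] g := (h.exists_estimates hK).2.1.ae_eq hfg
  have hae : ∀ᵐ ω ∂P, f =ᵐ[Ξ ω] g :=
    Measure.ae_ae_of_ae_bind h.measurable.aemeasurable hbind
  filter_upwards [hae] with ω hω using integral_congr_ae hω

theorem IsDeterminantal.secondDiffComparable_cgf_of_memLp (h : IsDeterminantal P Ξ K)
    (hK : 0 ≤ K) (hK1 : K ≤ 1) (hC : 0 ≤ C) (hf : MemLp f ∞ volume)
    (hfC : eLpNorm f ∞ volume ≤ ENNReal.ofReal C) :
    (∀ t, Integrable (fun ω => Real.exp (t * linStat Ξ f ω)) P) ∧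
      SecondDiffComparable (2 * C) (cgf (linStat Ξ f) P) := by
  obtain ⟨g, hg, hgC, hfg⟩ := exists_measurable_abs_le_ae_eq hC hf hfC
  have hae := h.linStat_congr_ae hK hfg
  obtain ⟨h1, h2⟩ := h.secondDiffComparable_cgf hK hK1 hg hgC
  refine ⟨fun t => (h1 t).congr ?_, ?_⟩
  · filter_upwards [hae] with ω hω
    rw [hω]
  · have : cgf (linStat Ξ f) P = cgf (linStat Ξ g) P := by
      ext t
      rw [cgf, cgf, mgf_congr hae]
    rwa [this]

end EssentiallyBoundedStatistics

/-! ### Gaussian asymptotics and convergence in distribution. -/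

section GaussianAsymptotics

open ProbabilityTheory

variable {Ω : Type*} [MeasurableSpace Ω] {P : Measure Ω} [IsProbabilityMeasure P] {X : Ω → ℝ}

omit [IsProbabilityMeasure P] in
theorem memLp_two_of_integrable_exp (hX : ∀ t, Integrable (fun ω => Real.exp (t * X ω)) P) :
    MemLp X 2 P := by
  have := memLp_of_mem_interior_integrableExpSet (X := X) (μ := P)
    (by rw [integrableExpSet_eq_univ hX]; simp) 2
  simpa using this

theorem exp_sub_one_le_mul_exp (x : ℝ) : Real.exp x - 1 ≤ x * Real.exp x := by
  have h := Real.add_one_le_exp (-x)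
  have h1 : Real.exp (-x) * Real.exp x = 1 := by rw [← Real.exp_add]; simp
  nlinarith [Real.exp_pos x]

/-- Normalized form of `abs_cgf_sub_le`. -/
theorem abs_cgf_div_sub_le (hX : ∀ t, Integrable (fun ω => Real.exp (t * X ω)) P) {c σ : ℝ}
    (hc0 : 0 ≤ c) (hc : SecondDiffComparable c (cgf X P)) (hσ : 0 < σ)
    (hσV : σ ^ 2 = variance X P) (t : ℝ) :
    |cgf X P (t / σ) - t / σ * ∫ ω, X ω ∂P - t ^ 2 / 2|
      ≤ c * |t| / σ * Real.exp (c * |t| / σ) * (t ^ 2 / 2) := by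
  have h := abs_cgf_sub_le hX hc0 hc (t / σ)
  have h2 : variance X P * (t / σ) ^ 2 / 2 = t ^ 2 / 2 := by
    rw [← hσV]; field_simp
  rw [h2, abs_div, abs_of_pos hσ] at h
  rw [mul_div_assoc c]
  exact h.trans (mul_le_mul_of_nonneg_right (exp_sub_one_le_mul_exp _) (by positivity))

theorem exists_mgf_eq_exp (hX : ∀ t, Integrable (fun ω => Real.exp (t * X ω)) P) {C σ : ℝ}
    (hC : 0 < C) (hc : SecondDiffComparable (2 * C) (cgf X P))
    (hσV : σ = √(variance X P)) {t : ℝ} (ht : |t| ≤ 0.69 * σ / C) :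
    ∃ ε : ℝ, |ε| ≤ 8 * C * (|t| / σ) ∧
      mgf X P (-(t * σ⁻¹)) * Real.exp (t * σ⁻¹ * ∫ ω, X ω ∂P)
        = Real.exp (t ^ 2 * (1 / 2 + ε)) := by
  have hσ0 : 0 ≤ σ := hσV ▸ Real.sqrt_nonneg _
  rcases eq_or_ne t 0 with rfl | ht0
  · exact ⟨0, by simp⟩
  -- If $\sigma=0$, the range of `t` reduces to $t=0$, already treated.
  have hσ : 0 < σ := by
    refine hσ0.lt_of_ne fun h0 => ht0 ?_
    rw [← h0] at ht
    simpa using ht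
  have hsq : σ ^ 2 = variance X P := by rw [hσV, Real.sq_sqrt (variance_nonneg _ _)]
  have h := abs_cgf_div_sub_le hX (by positivity) hc hσ hsq (-t)
  have ht2 : 0 < t ^ 2 := by positivity
  -- The constant $0.69$ is used only here; $1.38\le2$ and $e^2<8$ give the factor $8$.
  have hx : 2 * C * |t| / σ ≤ 1.38 := by
    rw [div_le_iff₀ hσ]
    rw [le_div_iff₀ hC] at ht
    linarith
  have hexp : Real.exp (2 * C * |t| / σ) ≤ 8 := by
    have h1 : Real.exp (2 * C * |t| / σ) ≤ Real.exp (1 + 1) :=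
      Real.exp_le_exp.mpr (by linarith)
    rw [Real.exp_add] at h1
    have := Real.exp_one_lt_d9
    nlinarith [Real.exp_pos 1]
  rw [abs_neg, neg_sq, neg_div] at h
  refine ⟨(cgf X P (-(t / σ)) - -(t / σ) * ∫ ω, X ω ∂P - t ^ 2 / 2) / t ^ 2, ?_, ?_⟩
  · rw [abs_div, abs_of_pos ht2, div_le_iff₀ ht2]
    refine h.trans ?_
    have h0 : 0 ≤ 2 * C * |t| / σ := by positivity
    calc 2 * C * |t| / σ * Real.exp (2 * C * |t| / σ) * (t ^ 2 / 2)
        ≤ 2 * C * |t| / σ * 8 * (t ^ 2 / 2) := by gcongr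
      _ = 8 * C * (|t| / σ) * t ^ 2 := by ring
  · rw [← div_eq_mul_inv, ← exp_cgf (hX _), ← Real.exp_add]
    congr 1
    field_simp
    ring

/-- Locally bounded moment generating functions extend to locally bounded entire functions;
convergence on a real interval then propagates to the imaginary axis, where Lévy's theorem applies.
-/
theorem tendstoInDistribution_of_tendsto_mgf {Ω : ℕ → Type*} [∀ N, MeasurableSpace (Ω N)]
    {P : ∀ N, Measure (Ω N)} [∀ N, IsProbabilityMeasure (P N)] {Y : ∀ N, Ω N → ℝ}
    (hY : ∀ N, AEMeasurable (Y N) (P N))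
    (hint : ∀ N t, Integrable (fun ω => Real.exp (t * Y N ω)) (P N))
    (hb : ∀ R : ℝ, ∃ B, ∀ᶠ N in atTop, ∀ t, |t| ≤ R → mgf (Y N) (P N) t ≤ B)
    (hlim : ∀ t, Tendsto (fun N => mgf (Y N) (P N) t) atTop (𝓝 (Real.exp (t ^ 2 / 2)))) :
    TendstoInDistribution Y atTop (id : ℝ → ℝ) P (gaussianReal 0 1) where
  forall_aemeasurable := hY
  tendsto := by
    refine ProbabilityMeasure.tendsto_iff_tendsto_charFun.2 fun t => ?_
    -- A disc about $0$ containing the point $it$ at which the characteristic function is read off.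
    obtain ⟨B, hB⟩ := hb (|t| + 1)
    have hR : 0 < |t| + 1 := by positivity
    have key := tendsto_of_tendsto_on_real (l := atTop) (F := fun N => complexMGF (Y N) (P N))
      (F₀ := fun z => Complex.exp (z ^ 2 / 2)) (B := max B (Real.exp ((|t| + 1) ^ 2 / 2)))
      (R := |t| + 1) (r := 1) one_pos
      (Eventually.of_forall fun N => ?_) (hB.mono fun N hN z hz => ?_) ?_ (fun z hz => ?_)
      (fun u _ _ => ?_) (z := t * Complex.I) (by simp)
    · simpa [complexMGF_mul_I (hY _), charFun_gaussianReal, mul_pow, neg_div] using key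
    · refine (differentiableOn_complexMGF (X := Y N) (μ := P N)).mono fun z _ => ?_
      simp [integrableExpSet_eq_univ (hint N)]
    · exact (norm_complexMGF_le_mgf.trans
        (hN _ ((Complex.abs_re_le_norm z).trans hz.le))).trans (le_max_left _ _)
    · exact Differentiable.differentiableOn (by fun_prop)
    · refine le_trans ?_ (le_max_right _ _)
      refine (Complex.norm_exp_le_exp_norm _).trans (Real.exp_le_exp.mpr ?_)
      rw [norm_div, norm_pow, Complex.norm_ofNat]
      gcongr
    · have := (Complex.continuous_ofReal.tendsto _).comp (hlim u)
      simpa [Function.comp_def, complexMGF_ofReal] using this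

theorem tendstoInDistribution_standardized {Ω : ℕ → Type*} [∀ N, MeasurableSpace (Ω N)]
    {P : ∀ N, Measure (Ω N)} [∀ N, IsProbabilityMeasure (P N)] {X : ∀ N, Ω N → ℝ} {c : ℝ}
    (hint : ∀ N t, Integrable (fun ω => Real.exp (t * X N ω)) (P N)) (hc0 : 0 ≤ c)
    (hc : ∀ N, SecondDiffComparable c (cgf (X N) (P N))) {σ : ℕ → ℝ}
    (hσV : ∀ N, σ N ^ 2 = variance (X N) (P N)) (hσ : Tendsto σ atTop atTop) :
    TendstoInDistribution (fun N ω => (X N ω - ∫ ω', X N ω' ∂(P N)) / σ N) atTop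
      (id : ℝ → ℝ) P (gaussianReal 0 1) := by
  have hmul : ∀ N t ω, t * ((X N ω - ∫ ω', X N ω' ∂(P N)) / σ N)
      = t / σ N * X N ω + -(t / σ N * ∫ ω', X N ω' ∂(P N)) := fun N t ω => by ring
  have hmgf : ∀ N t, mgf (fun ω => (X N ω - ∫ ω', X N ω' ∂(P N)) / σ N) (P N) t
      = Real.exp (cgf (X N) (P N) (t / σ N) - t / σ N * ∫ ω, X N ω ∂(P N)) := by
    intro N t
    rw [sub_eq_add_neg, Real.exp_add, exp_cgf (hint N _)]
    simp only [mgf, hmul, Real.exp_add, integral_mul_const]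
  refine tendstoInDistribution_of_tendsto_mgf (fun N => ?_) (fun N t => ?_) (fun R => ?_)
    fun t => ?_
  · exact (((memLp_two_of_integrable_exp (hint N)).aestronglyMeasurable.aemeasurable).sub_const
      _).div_const _
  · simp only [hmul, Real.exp_add]
    exact (hint N _).mul_const _
  · refine ⟨Real.exp (c * R * Real.exp (c * R) * (R ^ 2 / 2) + R ^ 2 / 2), ?_⟩
    filter_upwards [hσ.eventually_ge_atTop 1] with N hN t ht
    have hN0 : 0 < σ N := by linarith
    rw [hmgf]
    refine Real.exp_le_exp.mpr ?_
    have h1 := (abs_le.mp (abs_cgf_div_sub_le (hint N) hc0 (hc N) hN0 (hσV N) t)).2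
    have h2 : c * |t| / σ N ≤ c * R :=
      (div_le_self (by positivity) hN).trans (by gcongr)
    have h3 : t ^ 2 ≤ R ^ 2 := by rw [← sq_abs t]; gcongr
    have hR : 0 ≤ R := (abs_nonneg t).trans ht
    have h4 : 0 ≤ c * |t| / σ N := by positivity
    have h5 : c * |t| / σ N * Real.exp (c * |t| / σ N) * (t ^ 2 / 2)
        ≤ c * R * Real.exp (c * R) * (R ^ 2 / 2) := by gcongr
    linarith
  · simp only [hmgf]
    refine (Real.continuous_exp.tendsto _).comp ?_
    have hz : Tendsto (fun N => c * |t| / σ N * Real.exp (c * |t| / σ N) * (t ^ 2 / 2)) atTop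
        (𝓝 0) := by
      have h1 : Tendsto (fun N => c * |t| / σ N) atTop (𝓝 0) := hσ.const_div_atTop _
      simpa using (h1.mul ((Real.continuous_exp.tendsto _).comp h1)).mul_const (t ^ 2 / 2)
    rw [tendsto_iff_norm_sub_tendsto_zero]
    refine squeeze_zero' (Eventually.of_forall fun _ => norm_nonneg _) ?_ hz
    filter_upwards [hσ.eventually_ge_atTop 1] with N hN
    exact abs_cgf_div_sub_le (hint N) hc0 (hc N) (by linarith) (hσV N) t

end GaussianAsymptotics

/-- Central limit theorem for linear statistics of determinantal point processes. The constant `A`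
in the error term depends on the bound `C` only. -/
theorem mainTheorem10 (C : ℝ) (hC : 0 < C) :
    ∃ A : ℝ, 0 ≤ A ∧
      ∀ (n : ℕ) (Ω : ℕ → Type*) [∀ N, MeasurableSpace (Ω N)]
        (P : ∀ N, Measure (Ω N)) [∀ N, IsProbabilityMeasure (P N)]
        (K : ℕ → (L2Rn n →L[ℂ] L2Rn n)) (Ξ : ∀ N, Ω N → Measure (Rn n))
        (f : ℕ → Rn n → ℝ) (σ : ℕ → ℝ),
        (∀ N, IsTraceClass (K N)) →
        (∀ N, 0 ≤ K N) →
        (∀ N, K N ≤ 1) →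
        (∀ N, IsDeterminantal (P N) (Ξ N) (K N)) →
        (∀ N, MemLp (f N) ∞ volume) →
        (∀ N, eLpNorm (f N) ∞ volume ≤ ENNReal.ofReal C) →
        (∀ N, σ N = √(ProbabilityTheory.variance (linStat (Ξ N) (f N)) (P N))) →
        Tendsto (fun N => ProbabilityTheory.variance (linStat (Ξ N) (f N)) (P N)) atTop atTop →
        -- mean and variance of the linear statistics are well-defined
        (∀ N, MemLp (linStat (Ξ N) (f N)) 2 (P N)) ∧
        -- asymptotics of the Laplace transform, uniform in `t` and `N`
        (∀ (N : ℕ) (t : ℝ), |t| ≤ 0.69 * σ N / C →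
          Integrable (fun ω => Real.exp (-linStat (Ξ N) (fun x => t * (σ N)⁻¹ * f N x) ω)) (P N) ∧
          ∃ ε : ℝ, |ε| ≤ A * (|t| / σ N) ∧
            laplaceFunctional (P N) (Ξ N) (fun x => t * (σ N)⁻¹ * f N x) *
                Real.exp (t * (σ N)⁻¹ * ∫ ω, linStat (Ξ N) (f N) ω ∂(P N)) =
              Real.exp (t ^ 2 * (1 / 2 + ε))) ∧
        -- convergence in distribution to a standard Gaussian
        TendstoInDistribution
          (fun N ω => (linStat (Ξ N) (f N) ω - ∫ ω', linStat (Ξ N) (f N) ω' ∂(P N)) / σ N)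
          atTop (id : ℝ → ℝ) P (ProbabilityTheory.gaussianReal 0 1) := by
  refine ⟨8 * C, by positivity, ?_⟩
  intro n Ω _ P _ K Ξ f σ _ hK hK1 hdet hf hfC hσ hvar
  have key := fun N => (hdet N).secondDiffComparable_cgf_of_memLp (hK N) (hK1 N) hC.le (hf N)
    (hfC N)
  have hlin : ∀ N t ω, -linStat (Ξ N) (fun x => t * (σ N)⁻¹ * f N x) ω
      = -(t * (σ N)⁻¹) * linStat (Ξ N) (f N) ω := fun N t ω => by
    rw [linStat_const_mul, neg_mul]
  refine ⟨fun N => memLp_two_of_integrable_exp (key N).1, fun N t ht => ⟨?_, ?_⟩, ?_⟩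
  · simp only [hlin]
    exact (key N).1 _
  · simp only [laplaceFunctional, hlin]
    exact exists_mgf_eq_exp (key N).1 hC (key N).2 (hσ N) ht
  · refine tendstoInDistribution_standardized (fun N => (key N).1)
      (mul_nonneg zero_le_two hC.le) (fun N => (key N).2) (fun N => ?_) ?_
    · rw [hσ N, Real.sq_sqrt (ProbabilityTheory.variance_nonneg _ _)]
    · exact (Real.tendsto_sqrt_atTop.comp hvar).congr fun N => (hσ N).symm
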